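/- **Theorem 1 (IND\$-CPA security of Gaussian Shading++).** Let $k$ be the security parameter, let $l(k),t(k),r(k),m(k)$ be natural numbers (code length, row sparsity, number of parity checks, plaintext length), $\eta\in[0,1]$ a constant noise rate, and $\mathsf{PRNG}_k:\{0,1\}^k\to\{0,1\}^{m(k)}$. *Scheme.* Key: a uniformly random $P\in\mathbb F_2^{r(k)\times l(k)}$ whose rows all have Hamming weight $t(k)$, a uniformly random $G\in\mathbb F_2^{l(k)\times k}$ with $PG=0$, and a uniform $sk_c\in\{0,1\}^k$. To encrypt $s^d\in\{0,1\}^{m(k)}$, draw a fresh uniform $seed\in\mathbb F_2^k$ and fresh noise $e\leftarrow\mathrm{Ber}(l(k),\eta)$ and output $$(G\cdot seed\oplus e)\;\|\;\bigl(\mathsf{PRNG}_k(\mathsf H(seed\,\|\,sk_c))\oplus s^d\bigr),$$ where $\mathsf H:\{0,1\}^*\to\{0,1\}^k$ is a random oracle. *Security.* An attacker is a probabilistic Boolean circuit with oracle gates for $\mathsf H$ and for encryption under the secret key. It queries these oracles adaptively, submits a challenge plaintext, receives either an encryption of it or a uniform string of the same length $l(k)+m(k)$, and outputs a bit (it may keep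 querying). Its advantage is the absolute difference of the probabilities of output $1$ in the two cases. $\mathrm{InSec}(T,L,k)$ is the maximal advantage over attackers of running time (size) at most $T(k)$ and total query length at most $L(k)$. For a scale $\sigma:\mathbb N\to\mathbb N$, the scheme is *IND\$-CPA secure at scale $\sigma$* if for all $T,L$ polynomially bounded in $\sigma$, $\mathrm{InSec}(T,L,k)$ is eventually at most $\sigma(k)^{-c}$ for every $c$. Two families of distributions are *indistinguishable at scale $\sigma$* if the same holds for the maximal distinguishing advantage of probabilistic Boolean circuits without oracles of size at most $T(k)$. At scale $\sigma(k)=k$ this is the usual polynomial-time, negligible-advantage notion; scale $\sigma(k)=2^{\lfloor\sqrt k\rfloor}$ means size $2^{O(\sqrt k)}$ and advantage $2^{-\omega(\sqrt k)}$. *Hardness assumptions.* *LPN at scale $\sigma$:* $(A,As\oplus e)$ and $(A,u)$ are indistinguishable at scale $\sigma$, for uniform $A\in\mathbb F_2^{l(k)\times k}$, $s\in\mathbb F_2^k$, $u\in\mathbb F_2^{l(k)}$ and $e\leftarrow\mathrm{Ber}(l(k),\eta)$. *Planted XOR at scale $\sigma$:* a uniform matrix in $\mathbb F_2^{l(k)\times(k+r(k))}$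 is indistinguishable at scale $\sigma$ from a uniform such matrix $M$ subject to $x^{\mathsf T}M=0$, where $x$ is a uniformly random secret vector of weight $t(k)$. *$\mathsf{PRNG}$ is pseudorandom at scale $\sigma$:* $\mathsf{PRNG}_k$ of a uniform $k$-bit seed is indistinguishable at scale $\sigma$ from $m(k)$ uniform bits. *Claim.* Suppose $t(k)=\Theta(\log l(k))$. 1. (Standard LPN and planted XOR.) If $l,r,m$ are polynomially bounded in $k$, $\mathsf{PRNG}$ is pseudorandom, and LPN and planted XOR hold, all at scale $\sigma(k)=k$, then the scheme is IND\$-CPA secure at scale $\sigma(k)=k$. 2. (Subexponential LPN.) Let $\sigma(k)=2^{\lfloor\sqrt k\rfloor}$. If $l,m$ are polynomially bounded in $\sigma$, if for some constants $\delta,\varepsilon>0$ and all large $k$ we have $r(k)\le(1-\delta)\,l(k)$ and $2^k\le\binom{l(k)}{t(k)}^{1-\varepsilon}$, and if $\mathsf{PRNG}$ is pseudorandom and LPN holds at scale $\sigma$, then the scheme is IND\$-CPA secure at scale $\sigma$. -/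

import Mathlib

open Filter Asymptotics
open scoped Matrix

noncomputable section

namespace GSPlus

/-! ### Bits and elementary sampling -/

/-- Bits are elements of the field with two elements; addition is XOR. -/
abbrev Bit : Type := ZMod 2

/-- Bit strings of length `n`, i.e. vectors over the field with two elements. -/
abbrev Bits (n : ℕ) : Type := Fin n → Bit

/-- The uniform distribution on the elements of a finite type that satisfy `p`
(and the point mass at `0` if there are none). -/
def uniformSubjectTo {α : Type} [Fintype α] [Zero α] (p : α → Prop) : PMF α :=
  open Classical in
  if h : (Finset.univ.filter p).Nonempty then PMF.uniformOfFinset (Finset.univ.filter p) h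
  else PMF.pure 0

/-- The uniform distribution on a finite type. -/
def unif (α : Type) [Fintype α] [Nonempty α] : PMF α := PMF.uniformOfFintype α

/-- One bit that is `1` with probability `η` and `0` with probability `1 - η`. -/
def noiseBit (η : unitInterval) : PMF Bit :=
  PMF.ofFintype (fun b => if b = 1 then ENNReal.ofReal η else ENNReal.ofReal (1 - η)) (by
    have h : (Finset.univ : Finset Bit) = {0, 1} := by decide
    rw [h, Finset.sum_pair (by decide)]
    simp only [zero_ne_one, if_false, if_true]
    rw [← ENNReal.ofReal_add (sub_nonneg.2 η.2.2) η.2.1]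
    simp)

/-- `n` independent samples of `p`. -/
def iid {α : Type} (p : PMF α) : (n : ℕ) → PMF (Fin n → α)
  | 0 => PMF.pure Fin.elim0
  | n + 1 => p.bind fun a => (iid p n).bind fun v => PMF.pure (Fin.cons a v)

/-- The noise vector `Ber(n, η)`: `n` independent bits, each `1` with probability `η`. -/
def noise (n : ℕ) (η : unitInterval) : PMF (Bits n) := iid (noiseBit η) n

/-- A matrix written as a bit string, row by row. -/
def matrixBits {a b : ℕ} (A : Matrix (Fin a) (Fin b) Bit) : List Bit :=
  (List.ofFn fun i => List.ofFn (A i)).flatten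

/-- A bit string of arbitrary length read as a block of length `n`
(cut off, or filled up with zeros). -/
def toBlock (n : ℕ) (x : List Bit) : Bits n := fun i => x.getD i 0

/-! ### Probabilistic oracle circuits

Adversaries are probabilistic Boolean circuits with oracle gates, written as straight-line programs
over one-bit registers. Their size counts the gates, an oracle gate being charged for every bit it
sends and every bit it receives. An oracle may keep a hidden state of type `S`. -/

/-- The gates; `ι` is the set of names of the available oracles and `d` is the register written. -/
inductive Gate (ι : Type) : Type
  | const (d : ℕ) (b : Bit) : Gate ι
  | coin (d : ℕ) : Gate ι
  | xor (d a b : ℕ) : Gate ι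
  | and (d a b : ℕ) : Gate ι
  | query (o : ι) (src dst : List ℕ) : Gate ι

/-- The contents of the registers. -/
abbrev Registers : Type := ℕ → Bit

/-- Stateful probabilistic oracles. -/
abbrev Oracles (ι S : Type) : Type := ι → List Bit → S → PMF (List Bit × S)

/-- Write the bits `x` into the registers `dst`, one after the other. -/
def writeBits (dst : List ℕ) (x : List Bit) (ρ : Registers) : Registers :=
  (dst.zip x).foldl (fun ρ p => Function.update ρ p.1 p.2) ρ

/-- Execution of one gate. -/
def Gate.exec {ι S : Type} (O : Oracles ι S) : Gate ι → Registers × S → PMF (Registers × S)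
  | .const d b, (ρ, s) => PMF.pure (Function.update ρ d b, s)
  | .coin d, (ρ, s) => (unif Bit).map fun b => (Function.update ρ d b, s)
  | .xor d a b, (ρ, s) => PMF.pure (Function.update ρ d (ρ a + ρ b), s)
  | .and d a b, (ρ, s) => PMF.pure (Function.update ρ d (ρ a * ρ b), s)
  | .query o src dst, (ρ, s) => (O o (src.map ρ) s).map fun y => (writeBits dst y.1 ρ, y.2)

/-- The number of steps a gate is charged for. -/
def Gate.cost {ι : Type} : Gate ι → ℕ
  | .query _ src dst => 1 + src.length + dst.length
  | _ => 1

/-- The number of bits a gate sends to an oracle. -/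
def Gate.queryBits {ι : Type} : Gate ι → ℕ
  | .query _ src _ => src.length
  | _ => 0

/-- A circuit: its gates in the order of evaluation. -/
abbrev Circuit (ι : Type) : Type := List (Gate ι)

/-- Evaluation of a circuit. -/
def Circuit.run {ι S : Type} (O : Oracles ι S) : Circuit ι → Registers × S → PMF (Registers × S)
  | [], x => PMF.pure x
  | G :: C, x => (G.exec O x).bind (Circuit.run O C)

/-- The size of a circuit. -/
def Circuit.size {ι : Type} (C : Circuit ι) : ℕ := (C.map Gate.cost).sum

/-- The total length of the oracle queries of a circuit. -/
def Circuit.queryBits {ι : Type} (C : Circuit ι) : ℕ := (C.map Gate.queryBits).sum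

/-! ### Growth rates, computational indistinguishability -/

/-- `T` is at most polynomial in `σ`. -/
def PolyIn (σ T : ℕ → ℕ) : Prop := ∃ c : ℕ, ∀ k, T k ≤ σ k ^ c + c

/-- `f` is eventually below every inverse power of `σ`. -/
def NegligibleIn (σ : ℕ → ℕ) (f : ℕ → ℝ) : Prop :=
  ∀ c : ℕ, ∀ᶠ k in atTop, |f k| ≤ ((σ k : ℝ) ^ c)⁻¹

/-- The scale of polynomial security: polynomial and negligible in the security parameter `k`. -/
def polyScale (k : ℕ) : ℕ := k

/-- The scale of subexponential security: adversaries of size `2 ^ O(√k)`, advantages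
`2 ^ (-ω(√k))`. -/
def subexpScale (k : ℕ) : ℕ := 2 ^ Nat.sqrt k

/-- A distinguisher: a circuit without oracles that finds its input in the registers
`0, 1, 2, …` and leaves its verdict in the register `out`. -/
structure Distinguisher : Type where
  circuit : Circuit Empty
  out : ℕ

/-- The probability that the distinguisher answers `1` on a sample of `X`. -/
def Distinguisher.accept (D : Distinguisher) (X : PMF (List Bit)) : ℝ :=
  ((X.bind fun x =>
    (Circuit.run (S := Unit) (fun o => o.elim) D.circuit (fun i => x.getD i 0, ())).map
      fun y : Registers × Unit => y.1 D.out) 1).toReal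

/-- The largest advantage of a distinguisher of size at most `T` between `X` and `Y`. -/
def distInSec (T : ℕ) (X Y : PMF (List Bit)) : ℝ :=
  ⨆ D : {D : Distinguisher // D.circuit.size ≤ T}, |D.1.accept X - D.1.accept Y|

/-- Computational indistinguishability at the scale `σ` of two families of distributions. -/
def Indistinguishable (σ : ℕ → ℕ) (X Y : ℕ → PMF (List Bit)) : Prop :=
  ∀ T : ℕ → ℕ, PolyIn σ T → NegligibleIn σ fun k => distInSec (T k) (X k) (Y k)

/-! ### The hardness assumptions -/

/-- The LPN distribution `(A, A s ⊕ e)` with a secret of length `k` and `n` samples. -/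
def lpnReal (n k : ℕ) (η : unitInterval) : PMF (List Bit) :=
  (unif (Matrix (Fin n) (Fin k) Bit)).bind fun A =>
  (unif (Bits k)).bind fun s =>
  (noise n η).bind fun e =>
  PMF.pure (matrixBits A ++ List.ofFn (A *ᵥ s + e))

/-- The distribution `(A, u)` with `A` and `u` uniform and independent. -/
def lpnIdeal (n k : ℕ) : PMF (List Bit) :=
  (unif (Matrix (Fin n) (Fin k) Bit)).bind fun A =>
  (unif (Bits n)).bind fun u =>
  PMF.pure (matrixBits A ++ List.ofFn u)

/-- Learning parity with noise, secret length `k`, `l k` samples, noise rate `η`, is hard at the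
scale `σ`. -/
def LPNHard (σ : ℕ → ℕ) (l : ℕ → ℕ) (η : unitInterval) : Prop :=
  Indistinguishable σ (fun k => lpnReal (l k) k η) (fun k => lpnIdeal (l k) k)

/-- A uniform `n × q` matrix with a planted relation: its rows indexed by a secret random `t`-subset
add up to zero. -/
def xorPlanted (n q t : ℕ) : PMF (List Bit) :=
  (uniformSubjectTo fun s : Bits n => hammingNorm s = t).bind fun s =>
  (uniformSubjectTo fun G : Matrix (Fin n) (Fin q) Bit => s ᵥ* G = 0).bind fun G =>
  PMF.pure (matrixBits G)

/-- A uniform `n × q` matrix. -/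
def xorUniform (n q : ℕ) : PMF (List Bit) :=
  (unif (Matrix (Fin n) (Fin q) Bit)).bind fun G => PMF.pure (matrixBits G)

/-- The planted XOR problem with `n k` variables, `q k` equations and sparsity `t k` is hard at the
scale `σ`. -/
def PlantedXORHard (σ : ℕ → ℕ) (n q t : ℕ → ℕ) : Prop :=
  Indistinguishable σ (fun k => xorPlanted (n k) (q k) (t k)) (fun k => xorUniform (n k) (q k))

/-- `F k`, applied to a uniform seed of `k` bits, is indistinguishable from `m k` uniform bits. -/
def PseudorandomGenerator (σ : ℕ → ℕ) (m : ℕ → ℕ) (F : (k : ℕ) → Bits k → Bits (m k)) : Prop :=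
  Indistinguishable σ
    (fun k => (unif (Bits k)).bind fun x => PMF.pure (List.ofFn (F k x)))
    (fun k => (unif (Bits (m k))).bind fun u => PMF.pure (List.ofFn u))

/-! ### The scheme -/

/-- LDPC key generation: `P` is a uniform `r × n` matrix all of whose rows are `t`-sparse,
`G` a uniform `n × g` matrix with `P * G = 0`. -/
def keyGen (n g t r : ℕ) : PMF (Matrix (Fin r) (Fin n) Bit × Matrix (Fin n) (Fin g) Bit) :=
  (uniformSubjectTo fun P : Matrix (Fin r) (Fin n) Bit => ∀ i, hammingNorm (P i) = t).bind fun P =>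
  (uniformSubjectTo fun G : Matrix (Fin n) (Fin g) Bit => P * G = 0).bind fun G =>
  PMF.pure (P, G)

/-- The table of the values of the random oracle that have been determined so far. -/
abbrev HashTable (k : ℕ) : Type := List Bit → Option (Bits k)

/-- The random oracle from bit strings of arbitrary length to `k` bits: a uniformly random function
whose values are drawn when they are needed for the first time, and remembered. -/
def randomOracle (k : ℕ) (x : List Bit) (τ : HashTable k) : PMF (Bits k × HashTable k) :=
  match τ x with
  | some y => PMF.pure (y, τ)
  | none => (unif (Bits k)).map fun y => (y, Function.update τ x (some y))

/-- One encryption of the plaintext `s` (fresh seed, fresh noise):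
`(G·seed ⊕ e) ‖ (PRNG(H(seed ‖ sk)) ⊕ s)`. -/
def encrypt {n k m : ℕ} (η : unitInterval) (PRNG : Bits k → Bits m)
    (G : Matrix (Fin n) (Fin k) Bit) (sk : Bits k) (s : Bits m) (τ : HashTable k) :
    PMF (List Bit × HashTable k) :=
  (unif (Bits k)).bind fun seed =>
  (noise n η).bind fun e =>
  (randomOracle k (List.ofFn seed ++ List.ofFn sk) τ).bind fun h =>
  PMF.pure (List.ofFn (G *ᵥ seed + e) ++ List.ofFn (PRNG h.1 + s), h.2)

/-! ### The chosen-plaintext attack -/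

/-- The oracles of the attacker: the hash function and the encryption under the secret key. -/
inductive CPAOracle : Type
  | hash
  | enc

/-- The oracles of the attacker when the key is `(G, sk)`. -/
def cpaOracles {n k m : ℕ} (η : unitInterval) (PRNG : Bits k → Bits m)
    (G : Matrix (Fin n) (Fin k) Bit) (sk : Bits k) : Oracles CPAOracle (HashTable k)
  | .hash, x, τ => (randomOracle k x τ).map fun y => (List.ofFn y.1, y.2)
  | .enc, x, τ => encrypt η PRNG G sk (toBlock m x) τ

/-- A chosen-plaintext attacker: the learning stage, the registers that hold the plaintext of the
challenge, the registers that receive the challenge, the guessing stage, the register of the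
guess. The challenge need not differ from the plaintexts encrypted before, and encryptions
may still be asked for in the guessing stage; both only make the attacker stronger. -/
structure CPAAdversary : Type where
  learn : Circuit CPAOracle
  plain : List ℕ
  recv : List ℕ
  guess : Circuit CPAOracle
  out : ℕ

/-- The running time of an attacker. -/
def CPAAdversary.time (A : CPAAdversary) : ℕ :=
  A.learn.size + A.plain.length + A.recv.length + A.guess.size

/-- The total length of the queries of an attacker. -/
def CPAAdversary.queryBits (A : CPAAdversary) : ℕ :=
  A.learn.queryBits + A.plain.length + A.guess.queryBits

/-- The guess of the attacker in the CPA game with challenge bit `b`: for `b = false` the challenge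
is an encryption of the chosen plaintext, for `b = true` a uniform string of the same length. -/
def cpaGame {m : ℕ} (n k t r : ℕ) (η : unitInterval) (PRNG : Bits k → Bits m)
    (A : CPAAdversary) (b : Bool) : PMF Bit :=
  (keyGen n k t r).bind fun key =>
  (unif (Bits k)).bind fun sk =>
  (Circuit.run (cpaOracles η PRNG key.2 sk) A.learn (fun _ => 0, fun _ => none)).bind fun x =>
  (match b with
    | false => encrypt η PRNG key.2 sk (toBlock m (A.plain.map x.1)) x.2
    | true => (unif (Bits (n + m))).map fun u => (List.ofFn u, x.2)).bind fun y =>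
  (Circuit.run (cpaOracles η PRNG key.2 sk) A.guess (writeBits A.recv y.1 x.1, y.2)).map
    fun z : Registers × HashTable k => z.1 A.out

/-- The CPA advantage. -/
def cpaAdv {m : ℕ} (n k t r : ℕ) (η : unitInterval) (PRNG : Bits k → Bits m)
    (A : CPAAdversary) : ℝ :=
  |(cpaGame n k t r η PRNG A false 1).toReal - (cpaGame n k t r η PRNG A true 1).toReal|

/-- The CPA insecurity: the largest advantage of an attacker that runs in time at most `T` and asks
queries of total length at most `L`. -/
def cpaInSec {m : ℕ} (n k t r : ℕ) (η : unitInterval) (PRNG : Bits k → Bits m)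
    (T L : ℕ) : ℝ :=
  ⨆ A : {A : CPAAdversary // A.time ≤ T ∧ A.queryBits ≤ L}, cpaAdv n k t r η PRNG A.1

/-- IND$-CPA security at the scale `σ`, of the scheme with code length `l k`, seed length `k`,
row sparsity `t k`, `r k` parity checks, noise rate `η` and plaintext length `m k`. -/
def INDCPA (σ : ℕ → ℕ) (l t r m : ℕ → ℕ) (η : unitInterval)
    (PRNG : (k : ℕ) → Bits k → Bits (m k)) : Prop :=
  ∀ T L : ℕ → ℕ, PolyIn σ T → PolyIn σ L →
    NegligibleIn σ fun k => cpaInSec (l k) k (t k) (r k) η (PRNG k) (T k) (L k)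

end GSPlus

end

/-! The proof is a chain of games that ends in one where every ciphertext, including the challenge,
is a uniform string, so that the challenge bit is invisible. The challenge is treated as one more
oracle query, of kind `enc` or `rnd`, so that the attack is the run of a single circuit
(`cpaGame_eq`).

Random oracle. The randomness of all encryptions can be drawn in advance (`eager_eq_lazy`). The hash
values that encryption uses are then fresh independent strings unless two seeds collide or the
attacker hashes a string ending in the secret key. In the game with fresh values the run does not
depend on that key, so the key can be drawn at the end and guessing it costs at most `2 ^ (-k)` per
gate (`close_game_padRun`). What remains is an attack on prepared pads, and a circuit without
oracles can simulate it at polynomial cost by keeping a log of the hash queries (`run_simCircuit`,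
`exists_distinguisher`). All further reductions go through this simulation. They are nonuniform:
seeds, noise, the other pads and parts of the key are hardwired, so neither the noise nor `PRNG` is
ever computed by a circuit.

Pads. A hybrid over the encryptions replaces the outputs of `PRNG` by uniform strings
(`close_linGame`). With seed and noise fixed, a pad is then an affine function of the bits of `G`.
Once `G` is a uniform matrix, a second hybrid over the encryptions, which share `G`, replaces each
`G s + e` by a uniform vector under LPN (`close_uniformGame`).

Key. It remains to replace `G`, uniform subject to `P G = 0`, by a uniform matrix. In both parts the
rows of `P` are introduced one at a time.

Under planted XOR, the newest row is the planted relation of an instance with `k + r` columns. The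
other rows are known to the reduction, which enforces them by column elimination, spending one
column per row. The elimination maps independent uniform columns of one kernel exactly to
independent uniform columns of the smaller kernel (`map_elimRow_seqSample`), so no error arises
(`close_keyGen_planted`).

In the second part the replacement is statistical. When a random row `p` is added to `ps`, the
second moment of the law of `G` exceeds that of the uniform law by at most `2 ^ k` times the
probability that two independent rows agree modulo the span of `ps` (`card_mul_sum_sq_le`). Fourier
analysis on the cube bounds the average of this probability over `ps` by the mean of `φ² (1 + |φ|) ^
r`, where `φ` is the character mean of a row, a normalised Krawtchouk value
(`close_keyGen_uniform`). On balanced strings `|φ|` is at most `1 / l` and Parseval gives a multiple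
of `1 / C(l, t)`. Unbalanced strings are exponentially rare, and the rate `r ≤ (1 - δ) l` lets this
rarity beat the factor `2 ^ r` (`charMoment_rowDist_le`). Since `2 ^ k ≤ C(l, t) ^ (1 - ε)`, the
product of `2 ^ k` with this moment is negligible (`negligibleIn_charMoment`). -/

noncomputable section

namespace GSPlus

open scoped ENNReal

/-! ### Closeness of probabilities -/

/-- `p` and `q` differ by at most `ε`. -/
def Close (ε p q : ℝ≥0∞) : Prop := p ≤ q + ε ∧ q ≤ p + ε

theorem Close.refl (p : ℝ≥0∞) : Close 0 p p := by simp [Close]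

theorem Close.symm {ε p q : ℝ≥0∞} (h : Close ε p q) : Close ε q p := ⟨h.2, h.1⟩

theorem Close.mono {ε δ p q : ℝ≥0∞} (h : Close ε p q) (hε : ε ≤ δ) : Close δ p q :=
  ⟨h.1.trans (by gcongr), h.2.trans (by gcongr)⟩

theorem Close.trans {ε δ p q r : ℝ≥0∞} (h : Close ε p q) (h' : Close δ q r) :
    Close (ε + δ) p r := by
  constructor
  · calc p ≤ q + ε := h.1
      _ ≤ r + δ + ε := by gcongr; exact h'.1
      _ = r + (ε + δ) := by ring
  · calc r ≤ q + δ := h'.2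
      _ ≤ p + ε + δ := by gcongr; exact h.2
      _ = p + (ε + δ) := by ring

theorem Close.abs_toReal_sub_le {ε p q : ℝ≥0∞} (h : Close ε p q) (hε : ε ≠ ∞) (hp : p ≠ ∞)
    (hq : q ≠ ∞) : |p.toReal - q.toReal| ≤ ε.toReal := by
  rw [abs_le]
  have h1 := ENNReal.toReal_mono (by simp [hε, hq]) h.1
  have h2 := ENNReal.toReal_mono (by simp [hε, hp]) h.2
  rw [ENNReal.toReal_add hq hε] at h1
  rw [ENNReal.toReal_add hp hε] at h2
  constructor <;> linarith

theorem close_of_abs_toReal_sub_le {ε : ℝ} {p q : ℝ≥0∞} (hp : p ≠ ∞) (hq : q ≠ ∞)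
    (h : |p.toReal - q.toReal| ≤ ε) : Close (ENNReal.ofReal ε) p q := by
  have hε : 0 ≤ ε := (abs_nonneg _).trans h
  rw [abs_le] at h
  constructor
  · rw [← ENNReal.ofReal_toReal hp, ← ENNReal.ofReal_toReal hq,
      ← ENNReal.ofReal_add ENNReal.toReal_nonneg hε]
    exact ENNReal.ofReal_le_ofReal (by linarith)
  · rw [← ENNReal.ofReal_toReal hp, ← ENNReal.ofReal_toReal hq,
      ← ENNReal.ofReal_add ENNReal.toReal_nonneg hε]
    exact ENNReal.ofReal_le_ofReal (by linarith)

theorem bind_apply_le_add {α β : Type} {X : PMF α} {f g : α → PMF β} {b : β} {ε : ℝ≥0∞}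
    (h : ∀ a ∈ X.support, f a b ≤ g a b + ε) : (X.bind f) b ≤ (X.bind g) b + ε := by
  rw [PMF.bind_apply, PMF.bind_apply]
  calc ∑' a, X a * f a b ≤ ∑' a, (X a * g a b + X a * ε) := by
        refine ENNReal.tsum_le_tsum fun a => ?_
        by_cases ha : a ∈ X.support
        · rw [← mul_add]; gcongr; exact h a ha
        · simp [(PMF.apply_eq_zero_iff _ _).2 ha]
    _ = _ := by rw [ENNReal.tsum_add, ENNReal.tsum_mul_right, PMF.tsum_coe, one_mul]

theorem Close.bind_of_mem_support {α β : Type} {X : PMF α} {f g : α → PMF β} {b : β} {ε : ℝ≥0∞}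
    (h : ∀ a ∈ X.support, Close ε (f a b) (g a b)) : Close ε ((X.bind f) b) ((X.bind g) b) :=
  ⟨bind_apply_le_add fun a ha => (h a ha).1, bind_apply_le_add fun a ha => (h a ha).2⟩

/-- This is the averaging behind the nonuniform reductions: a bound valid for each value of the
shared randomness survives mixing, so a reduction may hardwire the value. -/
theorem Close.bind {α β : Type} {X : PMF α} {f g : α → PMF β} {b : β} {ε : ℝ≥0∞}
    (h : ∀ a, Close ε (f a b) (g a b)) : Close ε ((X.bind f) b) ((X.bind g) b) :=
  Close.bind_of_mem_support fun a _ => h a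

/-! ### Products of distributions, hybrid arguments -/

/-- Independent samples of the distributions in a list. -/
def seqSample {β : Type} : List (PMF β) → PMF (List β)
  | [] => PMF.pure []
  | X :: Xs => X.bind fun a => (seqSample Xs).bind fun v => PMF.pure (a :: v)

theorem seqSample_map {β γ : Type} (g : β → γ) (Xs : List (PMF β)) :
    seqSample (Xs.map fun X => X.map g) = (seqSample Xs).map (List.map g) := by
  induction Xs with
  | nil => simp [seqSample, PMF.pure_map]
  | cons X Xs ih => simp [seqSample, ih, PMF.map_bind, PMF.bind_map, PMF.pure_map, Function.comp_def]

theorem length_of_mem_support_seqSample {β : Type} {Xs : List (PMF β)} {v : List β}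
    (hv : v ∈ (seqSample Xs).support) : v.length = Xs.length := by
  induction Xs generalizing v with
  | nil => simp [seqSample] at hv; simp [hv]
  | cons X Xs ih =>
    simp only [seqSample, PMF.mem_support_bind_iff, PMF.mem_support_pure_iff] at hv
    obtain ⟨a, -, w, hw, rfl⟩ := hv
    simp [ih hw]

/-- Replacing the factors of a product of distributions one by one. -/
theorem close_seqSample {β γ : Type} {ε : ℝ≥0∞} {b : γ} {Xs Ys : List (PMF β)}
    (f : List β → PMF γ)
    (h : List.Forall₂ (fun X Y => ∀ pre post : List β, pre.length + 1 + post.length = Xs.length →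
      Close ε ((X.bind fun a => f (pre ++ a :: post)) b) ((Y.bind fun a => f (pre ++ a :: post)) b))
      Xs Ys) :
    Close (Xs.length * ε) (((seqSample Xs).bind f) b) (((seqSample Ys).bind f) b) := by
  induction Xs generalizing f Ys with
  | nil =>
    cases h
    simp [seqSample, Close]
  | cons X Xs ih =>
    cases h with
    | @cons _ Y _ Ys hXY hrest =>
    simp only [seqSample, PMF.bind_bind, PMF.pure_bind]
    -- The tail is exchanged while the head is fixed and joins `pre`; afterwards the head is
    -- exchanged against a tail already drawn from `Ys`.
    have h1 : Close (Xs.length * ε)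
        ((X.bind fun a => (seqSample Xs).bind fun v => f (a :: v)) b)
        ((X.bind fun a => (seqSample Ys).bind fun v => f (a :: v)) b) := by
      refine Close.bind fun a => ih (fun v => f (a :: v)) (hrest.imp fun X' Y' hX' pre post hl => ?_)
      exact hX' (a :: pre) post (by simp; omega)
    have h2 : Close ε
        ((X.bind fun a => (seqSample Ys).bind fun v => f (a :: v)) b)
        ((Y.bind fun a => (seqSample Ys).bind fun v => f (a :: v)) b) := by
      rw [PMF.bind_comm, PMF.bind_comm Y]
      refine Close.bind_of_mem_support fun v hv => ?_
      have := hXY [] v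
        (by simp [length_of_mem_support_seqSample hv, hrest.length_eq]; omega)
      simpa using this
    refine (h1.trans h2).mono ?_
    simp only [List.length_cons]
    push_cast
    rw [add_mul, one_mul]

/-! ### Uniform distributions -/

theorem unif_apply {α : Type} [Fintype α] [Nonempty α] (a : α) :
    unif α a = (Fintype.card α : ℝ≥0∞)⁻¹ := by
  simp [unif]

theorem unif_map_equiv {α β : Type} [Fintype α] [Nonempty α] [Fintype β] [Nonempty β]
    (e : α ≃ β) : (unif α).map e = unif β := by
  classical
  ext b
  rw [PMF.map_apply, tsum_eq_single (e.symm b)]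
  · simp [unif_apply, Fintype.card_congr e]
  · intro a ha
    rw [if_neg]
    rintro rfl
    simp at ha

theorem unif_bind_equiv {α β γ : Type} [Fintype α] [Nonempty α] [Fintype β] [Nonempty β]
    (e : α ≃ β) (f : β → PMF γ) : (unif α).bind (fun a => f (e a)) = (unif β).bind f := by
  rw [← unif_map_equiv e, PMF.bind_map]; rfl

theorem unif_prod {α β : Type} [Fintype α] [Nonempty α] [Fintype β] [Nonempty β] :
    unif (α × β) = (unif α).bind fun a => (unif β).bind fun b => PMF.pure (a, b) := by
  classical
  ext ⟨a, b⟩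
  rw [PMF.bind_apply, tsum_eq_single a]
  · rw [PMF.bind_apply, tsum_eq_single b]
    · simp only [unif_apply, PMF.pure_apply]
      rw [Fintype.card_prod, Nat.cast_mul, ENNReal.mul_inv (by simp) (by simp)]
      simp
    · intro b' hb'
      simp [PMF.pure_apply, Ne.symm hb']
  · intro a' ha'
    rw [PMF.bind_apply]
    simp [PMF.pure_apply, Ne.symm ha']

theorem unif_append {α : Type} [Fintype α] [Nonempty α] (n m : ℕ) :
    unif (Fin (n + m) → α) =
      (unif (Fin n → α)).bind fun u => (unif (Fin m → α)).bind fun v =>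
        PMF.pure (Fin.append u v) := by
  rw [← unif_map_equiv (Fin.appendEquiv n m), unif_prod]
  simp [PMF.map_bind, PMF.pure_map, Fin.appendEquiv]

theorem unif_cons {α : Type} [Fintype α] [Nonempty α] (n : ℕ) :
    unif (Fin (n + 1) → α) =
      (unif α).bind fun a => (unif (Fin n → α)).bind fun v =>
        PMF.pure (Fin.cons a v) := by
  rw [← unif_map_equiv (Fin.consEquiv fun _ : Fin (n + 1) => α), unif_prod]
  simp [PMF.map_bind, PMF.pure_map, Fin.consEquiv]

/-- The one-time pad: translation permutes a finite group. -/
theorem unif_bind_add {α γ : Type} [Fintype α] [AddGroup α] (c : α) (f : α → PMF γ) :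
    ((unif α).bind fun a => f (a + c)) = (unif α).bind f :=
  unif_bind_equiv (Equiv.addRight c) f

/-! ### Running circuits -/

section Run

variable {ι S : Type} (O : Oracles ι S)

theorem run_nil (x : Registers × S) : Circuit.run O [] x = PMF.pure x := rfl

theorem run_cons (G : Gate ι) (C : Circuit ι) (x : Registers × S) :
    Circuit.run O (G :: C) x = (G.exec O x).bind (Circuit.run O C) := rfl

theorem run_append (C D : Circuit ι) (x : Registers × S) :
    Circuit.run O (C ++ D) x = (Circuit.run O C x).bind (Circuit.run O D) := by
  induction C generalizing x with
  | nil => simp [run_nil]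
  | cons G C ih =>
    simp only [List.cons_append, run_cons, PMF.bind_bind]
    congr 1
    ext1 y
    rw [ih]

end Run

theorem size_append {ι : Type} (C D : Circuit ι) :
    Circuit.size (C ++ D) = Circuit.size C + Circuit.size D := by
  simp [Circuit.size]

theorem size_cons {ι : Type} (G : Gate ι) (C : Circuit ι) :
    Circuit.size (G :: C) = G.cost + Circuit.size C := by
  simp [Circuit.size]

/-- Renaming the oracles of a gate. -/
def Gate.rename {ι κ : Type} (f : ι → κ) : Gate ι → Gate κ
  | .const d b => .const d b
  | .coin d => .coin d
  | .xor d a b => .xor d a b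
  | .and d a b => .and d a b
  | .query o src dst => .query (f o) src dst

theorem Gate.exec_rename {ι κ S : Type} (f : ι → κ) (O : Oracles κ S) (G : Gate ι) :
    (G.rename f).exec O = G.exec fun o => O (f o) := by
  cases G <;> rfl

theorem run_rename {ι κ S : Type} (f : ι → κ) (O : Oracles κ S) (C : Circuit ι) :
    Circuit.run O (C.map (Gate.rename f)) = Circuit.run (fun o => O (f o)) C := by
  induction C with
  | nil => rfl
  | cons G C ih => funext x; simp only [List.map_cons, run_cons, ih, Gate.exec_rename]

theorem Gate.cost_rename {ι κ : Type} (f : ι → κ) (G : Gate ι) :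
    (G.rename f).cost = G.cost := by
  cases G <;> rfl

theorem size_rename {ι κ : Type} (f : ι → κ) (C : Circuit ι) :
    Circuit.size (C.map (Gate.rename f)) = Circuit.size C := by
  simp [Circuit.size, Function.comp_def, Gate.cost_rename]

/-! ### Writing blocks of registers -/

theorem writeBits_nil_left (x : List Bit) (ρ : Registers) : writeBits [] x ρ = ρ := by
  simp [writeBits]

theorem writeBits_nil_right (ds : List ℕ) (ρ : Registers) : writeBits ds [] ρ = ρ := by
  simp [writeBits]

theorem writeBits_cons (d : ℕ) (ds : List ℕ) (b : Bit) (x : List Bit) (ρ : Registers) :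
    writeBits (d :: ds) (b :: x) ρ = writeBits ds x (Function.update ρ d b) := by
  simp [writeBits]

theorem writeBits_of_notMem {ds : List ℕ} {x : List Bit} {ρ : Registers} {r : ℕ} (hr : r ∉ ds) :
    writeBits ds x ρ r = ρ r := by
  induction ds generalizing x ρ with
  | nil => rw [writeBits_nil_left]
  | cons d ds ih =>
    cases x with
    | nil => rw [writeBits_nil_right]
    | cons b x =>
      simp only [List.mem_cons, not_or] at hr
      rw [writeBits_cons, ih hr.2, Function.update_of_ne hr.1]

theorem map_writeBits_of_disjoint {ds rs : List ℕ} {x : List Bit} {ρ : Registers}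
    (h : ∀ r ∈ rs, r ∉ ds) : rs.map (writeBits ds x ρ) = rs.map ρ :=
  List.map_congr_left fun r hr => writeBits_of_notMem (h r hr)

theorem map_writeBits_self {ds : List ℕ} {x : List Bit} {ρ : Registers} (hd : ds.Nodup)
    (hl : ds.length = x.length) : ds.map (writeBits ds x ρ) = x := by
  induction ds generalizing x ρ with
  | nil => simpa using hl.symm
  | cons d ds ih =>
    cases x with
    | nil => simp at hl
    | cons b x =>
      rw [List.nodup_cons] at hd
      rw [writeBits_cons, List.map_cons, ih hd.2 (by simpa using hl), writeBits_of_notMem hd.1]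
      simp

/-- Injectivity of `e` prevents a write to one renamed register from touching another. It is used
with `e = advReg B`, the address map of the simulated registers. -/
theorem writeBits_comp {e : ℕ → ℕ} (he : Function.Injective e) (ds : List ℕ) (x : List Bit)
    (ρ : Registers) :
    (fun i => writeBits (ds.map e) x ρ (e i)) = writeBits ds x fun i => ρ (e i) := by
  induction ds generalizing x ρ with
  | nil => simp [writeBits_nil_left]
  | cons d ds ih =>
    cases x with
    | nil => simp [writeBits_nil_right]
    | cons b x =>
      rw [List.map_cons, writeBits_cons, writeBits_cons, ih]
      congr 1
      funext i
      by_cases h : i = d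
      · subst h; simp
      · rw [Function.update_of_ne h, Function.update_of_ne (fun h' => h (he h'))]

/-! ### Deterministic straight-line programs -/

/-- The gates that neither toss coins nor query oracles. -/
inductive Op : Type
  | const (d : ℕ) (b : Bit) : Op
  | xor (d a b : ℕ) : Op
  | and (d a b : ℕ) : Op

/-- The register written. -/
def Op.dst : Op → ℕ
  | .const d _ => d
  | .xor d _ _ => d
  | .and d _ _ => d

/-- Execution of a deterministic gate. -/
def Op.eval : Op → Registers → Registers
  | .const d b, ρ => Function.update ρ d b
  | .xor d a b, ρ => Function.update ρ d (ρ a + ρ b)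
  | .and d a b, ρ => Function.update ρ d (ρ a * ρ b)

/-- Execution of a deterministic program. -/
def evals (L : List Op) (ρ : Registers) : Registers := L.foldl (fun ρ o => o.eval ρ) ρ

/-- A deterministic gate as a gate. -/
def Op.toGate {ι : Type} : Op → Gate ι
  | .const d b => .const d b
  | .xor d a b => .xor d a b
  | .and d a b => .and d a b

/-- A deterministic program as a circuit. -/
def toCircuit {ι : Type} (L : List Op) : Circuit ι := L.map Op.toGate

@[simp] theorem evals_nil (ρ : Registers) : evals [] ρ = ρ := rfl

@[simp] theorem evals_cons (o : Op) (L : List Op) (ρ : Registers) :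
    evals (o :: L) ρ = evals L (o.eval ρ) := rfl

@[simp] theorem evals_append (L L' : List Op) (ρ : Registers) :
    evals (L ++ L') ρ = evals L' (evals L ρ) := by simp [evals]

theorem run_toCircuit {ι S : Type} (O : Oracles ι S) (L : List Op) (ρ : Registers) (s : S) :
    Circuit.run O (toCircuit L) (ρ, s) = PMF.pure (evals L ρ, s) := by
  induction L generalizing ρ with
  | nil => rfl
  | cons o L ih =>
    have : o.toGate.exec O (ρ, s) = PMF.pure (o.eval ρ, s) := by cases o <;> rfl
    rw [toCircuit, List.map_cons, run_cons, this, PMF.pure_bind]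
    exact ih _

theorem size_toCircuit {ι : Type} (L : List Op) : (toCircuit L : Circuit ι).size = L.length := by
  induction L with
  | nil => rfl
  | cons o L ih =>
    rw [toCircuit, List.map_cons, size_cons]
    have : (o.toGate : Gate ι).cost = 1 := by cases o <;> rfl
    rw [this, List.length_cons, ← ih, add_comm]; rfl

theorem Op.eval_of_ne {o : Op} {ρ : Registers} {r : ℕ} (h : r ≠ o.dst) : o.eval ρ r = ρ r := by
  cases o <;> exact Function.update_of_ne h _ _

theorem evals_of_notMem {L : List Op} {ρ : Registers} {r : ℕ} (h : ∀ o ∈ L, r ≠ o.dst) :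
    evals L ρ r = ρ r := by
  induction L generalizing ρ with
  | nil => rfl
  | cons o L ih =>
    rw [evals_cons, ih fun o' ho' => h o' (List.mem_cons_of_mem _ ho'),
      Op.eval_of_ne (h o List.mem_cons_self)]

/-- For every entry `(d, b, S)`, write the sum of `b` and the registers in `S` into `d`. -/
def affineBlock (L : List (ℕ × Bit × List ℕ)) : List Op :=
  L.flatMap fun e => Op.const e.1 e.2.1 :: e.2.2.map fun s => Op.xor e.1 e.1 s

/-- The value that an entry of an affine block writes. -/
def affineValue (ρ : Registers) (e : ℕ × Bit × List ℕ) : Bit := e.2.1 + (e.2.2.map ρ).sum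

theorem evals_xor_list (d : ℕ) (S : List ℕ) (h : d ∉ S) (ρ : Registers) :
    evals (S.map fun s => Op.xor d d s) ρ = Function.update ρ d (ρ d + (S.map ρ).sum) := by
  induction S generalizing ρ with
  | nil => simp
  | cons s S ih =>
    simp only [List.mem_cons, not_or] at h
    rw [List.map_cons, evals_cons, ih h.2, Op.eval]
    have : S.map (Function.update ρ d (ρ d + ρ s)) = S.map ρ :=
      List.map_congr_left fun r hr => Function.update_of_ne (by rintro rfl; exact h.2 hr) _ _
    rw [this]
    simp [add_assoc]

/-- Since no target is a source of any entry, no write disturbs a later read, and the sequential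
program evaluates all forms on the original registers. -/
theorem evals_affineBlock {L : List (ℕ × Bit × List ℕ)}
    (h : ∀ e ∈ L, ∀ e' ∈ L, e.1 ∉ e'.2.2) (ρ : Registers) :
    evals (affineBlock L) ρ = writeBits (L.map Prod.fst) (L.map (affineValue ρ)) ρ := by
  induction L generalizing ρ with
  | nil => rfl
  | cons e L ih =>
    have h1 : e.1 ∉ e.2.2 := h e List.mem_cons_self e List.mem_cons_self
    have hS (b : Bit) (S : List ℕ) (hS : e.1 ∉ S) :
        S.map (Function.update ρ e.1 b) = S.map ρ :=
      List.map_congr_left fun r hr => Function.update_of_ne (by rintro rfl; exact hS hr) _ _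
    rw [affineBlock, List.flatMap_cons, evals_append]
    change evals (affineBlock L) _ = _
    rw [ih fun e he e' he' => h e (List.mem_cons_of_mem _ he) e' (List.mem_cons_of_mem _ he'),
      evals_cons, evals_xor_list _ _ h1, Op.eval, List.map_cons, List.map_cons, writeBits_cons,
      hS _ _ h1, Function.update_self, Function.update_idem]
    congr 1
    refine List.map_congr_left fun e' he' => ?_
    simp only [affineValue]
    rw [hS _ _ (h e List.mem_cons_self e' (List.mem_cons_of_mem _ he'))]

theorem dst_of_mem_affineBlock {L : List (ℕ × Bit × List ℕ)} {o : Op} (h : o ∈ affineBlock L) :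
    o.dst ∈ L.map Prod.fst := by
  simp only [affineBlock, List.mem_flatMap, List.mem_cons, List.mem_map] at h
  obtain ⟨e, he, rfl | ⟨s, -, rfl⟩⟩ := h <;> exact List.mem_map_of_mem he

theorem length_affineBlock (L : List (ℕ × Bit × List ℕ)) :
    (affineBlock L).length = (L.map fun e => 1 + e.2.2.length).sum := by
  simp [affineBlock, List.length_flatMap, add_comm]

theorem length_affineBlock_le {L : List (ℕ × Bit × List ℕ)} {c : ℕ}
    (h : ∀ e ∈ L, e.2.2.length ≤ c) : (affineBlock L).length ≤ L.length * (1 + c) := by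
  rw [length_affineBlock, ← smul_eq_mul, ← List.length_map (fun e => 1 + e.2.2.length)]
  refine List.sum_le_card_nsmul _ _ fun x hx => ?_
  obtain ⟨e, he, rfl⟩ := List.mem_map.1 hx
  have := h e he
  omega

/-- A block of coin tosses. -/
def coinBlock {ι : Type} (ds : List ℕ) : Circuit ι := ds.map Gate.coin

theorem run_coinBlock {ι S : Type} (O : Oracles ι S) {n : ℕ} (ds : List ℕ) (hn : ds.length = n)
    (ρ : Registers) (s : S) :
    Circuit.run O (coinBlock ds) (ρ, s) =
      (unif (Bits n)).bind fun v => PMF.pure (writeBits ds (List.ofFn v) ρ, s) := by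
  induction ds generalizing ρ n with
  | nil =>
    subst hn
    simp [coinBlock, run_nil, writeBits_nil_left]
  | cons d ds ih =>
    subst hn
    rw [List.length_cons, unif_cons, coinBlock, List.map_cons, run_cons, Gate.exec]
    simp only [PMF.bind_bind, PMF.pure_bind, PMF.bind_map]
    congr 1
    funext b
    rw [Function.comp_apply]
    refine (ih rfl _).trans ?_
    simp [writeBits_cons]

theorem size_coinBlock {ι : Type} (ds : List ℕ) : (coinBlock ds : Circuit ι).size = ds.length := by
  induction ds with
  | nil => rfl
  | cons d ds ih =>
    have h : (Gate.coin d : Gate ι).cost = 1 := rfl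
    rw [coinBlock, List.map_cons, size_cons, h, List.length_cons, ← ih, add_comm]; rfl

/-! ### Conditional copying -/

/-- Multiply the register `flag` by the indicator of the equality of the pairs of registers. -/
def eqOps (flag tmp : ℕ) (z : List (ℕ × ℕ)) : List Op :=
  z.flatMap fun p => [.const tmp 1, .xor tmp tmp p.1, .xor tmp tmp p.2, .and flag flag tmp]

theorem dst_of_mem_eqOps {flag tmp : ℕ} {z : List (ℕ × ℕ)} {o : Op} (h : o ∈ eqOps flag tmp z) :
    o.dst = flag ∨ o.dst = tmp := by
  simp only [eqOps, List.mem_flatMap, List.mem_cons, List.not_mem_nil, or_false] at h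
  obtain ⟨p, -, rfl | rfl | rfl | rfl⟩ := h <;> simp [Op.dst]

theorem Bit.eq_zero_or_one (b : Bit) : b = 0 ∨ b = 1 := by
  revert b; decide

/-- Over the field with two elements `1 + a + b` is the indicator of `a = b`, so the flag becomes a
product of indicators. -/
theorem evals_eqOps {flag tmp : ℕ} (hft : flag ≠ tmp) {z : List (ℕ × ℕ)}
    (hz : ∀ p ∈ z, p.1 ≠ flag ∧ p.1 ≠ tmp ∧ p.2 ≠ flag ∧ p.2 ≠ tmp) (ρ : Registers) :
    evals (eqOps flag tmp z) ρ flag = if ∀ p ∈ z, ρ p.1 = ρ p.2 then ρ flag else 0 := by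
  induction z generalizing ρ with
  | nil => simp [eqOps]
  | cons p z ih =>
    obtain ⟨h1, h2, h3, h4⟩ := hz p List.mem_cons_self
    rw [eqOps, List.flatMap_cons, evals_append]
    change evals (eqOps flag tmp z) _ flag = _
    rw [ih fun q hq => hz q (List.mem_cons_of_mem _ hq)]
    have hρ : ∀ r, r ≠ flag → r ≠ tmp → evals [.const tmp 1, .xor tmp tmp p.1, .xor tmp tmp p.2,
        .and flag flag tmp] ρ r = ρ r := by
      intro r hr1 hr2
      apply evals_of_notMem
      simp [Op.dst, hr1, hr2]
    have hf : evals [.const tmp 1, .xor tmp tmp p.1, .xor tmp tmp p.2,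
        .and flag flag tmp] ρ flag = ρ flag * (1 + ρ p.1 + ρ p.2) := by
      simp [Op.eval, h2, h4, hft]
    rw [hf]
    have hall : (∀ q ∈ z, evals [.const tmp 1, .xor tmp tmp p.1, .xor tmp tmp p.2,
        .and flag flag tmp] ρ q.1 = evals [.const tmp 1, .xor tmp tmp p.1, .xor tmp tmp p.2,
        .and flag flag tmp] ρ q.2) ↔ ∀ q ∈ z, ρ q.1 = ρ q.2 := by
      refine forall₂_congr fun q hq => ?_
      obtain ⟨g1, g2, g3, g4⟩ := hz q (List.mem_cons_of_mem _ hq)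
      rw [hρ _ g1 g2, hρ _ g3 g4]
    rw [if_congr hall rfl rfl]
    simp only [List.forall_mem_cons]
    have hb : ∀ a b c : Bit, c * (1 + a + b) = if a = b then c else 0 := by decide
    rw [hb]
    split_ifs <;> tauto

/-- Copy the first component of each pair to the second one if the register `flag` holds `1`. -/
def selOps (flag tmp : ℕ) (z : List (ℕ × ℕ)) : List Op :=
  z.flatMap fun p => [.xor tmp p.1 p.2, .and tmp tmp flag, .xor p.2 p.2 tmp]

theorem dst_of_mem_selOps {flag tmp : ℕ} {z : List (ℕ × ℕ)} {o : Op} (h : o ∈ selOps flag tmp z) :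
    o.dst = tmp ∨ o.dst ∈ z.map Prod.snd := by
  simp only [selOps, List.mem_flatMap, List.mem_cons, List.not_mem_nil, or_false] at h
  obtain ⟨p, hp, rfl | rfl | rfl⟩ := h
  · simp [Op.dst]
  · simp [Op.dst]
  · exact Or.inr (List.mem_map_of_mem hp)

/-- The multiplexer is `b + (a + b) * flag`. The disjointness hypotheses keep earlier copies from
changing later sources or the flag. -/
theorem evals_selOps {flag tmp : ℕ} (hft : flag ≠ tmp) {z : List (ℕ × ℕ)}
    (hz : ∀ p ∈ z, p.1 ≠ tmp ∧ p.2 ≠ tmp ∧ p.2 ≠ flag) (hnd : (z.map Prod.snd).Nodup)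
    (hdisj : ∀ p ∈ z, p.1 ∉ z.map Prod.snd) (ρ : Registers) :
    (z.map Prod.snd).map (evals (selOps flag tmp z) ρ) =
      if ρ flag = 1 then (z.map Prod.fst).map ρ else (z.map Prod.snd).map ρ := by
  induction z generalizing ρ with
  | nil => simp
  | cons p z ih =>
    obtain ⟨h1, h2, h3⟩ := hz p List.mem_cons_self
    rw [List.map_cons, List.nodup_cons] at hnd
    obtain ⟨ρ', hρ'⟩ : ∃ ρ', ρ' =
      evals [.xor tmp p.1 p.2, .and tmp tmp flag, .xor p.2 p.2 tmp] ρ := ⟨_, rfl⟩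
    have hne : ∀ r, r ≠ p.2 → r ≠ tmp → ρ' r = ρ r := by
      intro r hr1 hr2
      rw [hρ']
      apply evals_of_notMem
      simp [Op.dst, hr1, hr2]
    have hp2 : ρ' p.2 = if ρ flag = 1 then ρ p.1 else ρ p.2 := by
      have hb : ∀ a b c : Bit, b + (a + b) * c = if c = 1 then a else b := by decide
      rw [hρ', ← hb]
      simp [Op.eval, h2, hft]
    rw [selOps, List.flatMap_cons]
    simp only [evals_append]
    rw [← hρ']
    change List.map (evals (selOps flag tmp z) ρ') _ = _
    rw [List.map_cons, List.map_cons, ih (fun q hq => hz q (List.mem_cons_of_mem _ hq)) hnd.2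
      (fun q hq h => hdisj q (List.mem_cons_of_mem _ hq) (List.mem_cons_of_mem _ h)) ρ',
      hne flag h3.symm hft]
    have e1 : (z.map Prod.fst).map ρ' = (z.map Prod.fst).map ρ := by
      refine List.map_congr_left fun r hr => ?_
      obtain ⟨q, hq, rfl⟩ := List.mem_map.1 hr
      refine hne _ (fun h => hdisj q (List.mem_cons_of_mem _ hq) ?_)
        (hz q (List.mem_cons_of_mem _ hq)).1
      rw [h]; exact List.mem_cons_self
    have e2 : (z.map Prod.snd).map ρ' = (z.map Prod.snd).map ρ := by
      refine List.map_congr_left fun r hr => ?_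
      obtain ⟨q, hq, rfl⟩ := List.mem_map.1 hr
      exact hne _ (fun h => hnd.1 (h ▸ hr)) (hz q (List.mem_cons_of_mem _ hq)).2.1
    have e3 : evals (selOps flag tmp z) ρ' p.2 = ρ' p.2 := by
      apply evals_of_notMem
      intro o ho h
      rcases dst_of_mem_selOps ho with h' | h'
      · exact h2 (h.trans h')
      · exact hnd.1 (h ▸ h')
    rw [e1, e2, e3, hp2]
    split_ifs <;> simp

/-- Copy the block `ansSrc` to the block `ans` if the blocks `key` and `x` agree. -/
def condCopy (flag tmp : ℕ) (key x ansSrc ans : List ℕ) : List Op :=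
  .const flag 1 :: (eqOps flag tmp (key.zip x) ++ selOps flag tmp (ansSrc.zip ans))

theorem length_condCopy_le (flag tmp : ℕ) (key x ansSrc ans : List ℕ) :
    (condCopy flag tmp key x ansSrc ans).length ≤ 1 + 4 * x.length + 3 * ans.length := by
  simp [condCopy, eqOps, selOps, List.length_flatMap]
  omega

theorem evals_condCopy_of_ne {flag tmp : ℕ} {key x ansSrc ans : List ℕ} {r : ℕ} (hf : r ≠ flag)
    (ht : r ≠ tmp) (ha : r ∉ ans) (ρ : Registers) :
    evals (condCopy flag tmp key x ansSrc ans) ρ r = ρ r := by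
  apply evals_of_notMem
  intro o ho h
  simp only [condCopy, List.mem_cons, List.mem_append] at ho
  rcases ho with rfl | ho | ho
  · exact hf h
  · rcases dst_of_mem_eqOps ho with h' | h'
    · exact hf (h.trans h')
    · exact ht (h.trans h')
  · rcases dst_of_mem_selOps ho with h' | h'
    · exact ht (h.trans h')
    · obtain ⟨p, hp, hp'⟩ := List.mem_map.1 h'
      exact ha (h ▸ hp' ▸ (List.of_mem_zip hp).2)

theorem map_evals_condCopy {flag tmp : ℕ} (hft : flag ≠ tmp) {key x ansSrc ans : List ℕ}
    (hkx : key.length = x.length) (hans : ansSrc.length = ans.length) (hnd : ans.Nodup)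
    (hkey : ∀ r ∈ key, r ≠ flag ∧ r ≠ tmp) (hx : ∀ r ∈ x, r ≠ flag ∧ r ≠ tmp)
    (hsrc : ∀ r ∈ ansSrc, r ≠ flag ∧ r ≠ tmp ∧ r ∉ ans) (hdst : ∀ r ∈ ans, r ≠ flag ∧ r ≠ tmp)
    (ρ : Registers) :
    ans.map (evals (condCopy flag tmp key x ansSrc ans) ρ) =
      if key.map ρ = x.map ρ then ansSrc.map ρ else ans.map ρ := by
  have hsnd : (ansSrc.zip ans).map Prod.snd = ans := List.map_snd_zip hans.ge
  have hfst : (ansSrc.zip ans).map Prod.fst = ansSrc := List.map_fst_zip hans.le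
  obtain ⟨ρ', hρ'⟩ : ∃ ρ', ρ' = evals (.const flag 1 :: eqOps flag tmp (key.zip x)) ρ := ⟨_, rfl⟩
  have hne : ∀ r, r ≠ flag → r ≠ tmp → ρ' r = ρ r := by
    intro r h1 h2
    rw [hρ']
    apply evals_of_notMem
    intro o ho h
    rcases List.mem_cons.1 ho with rfl | ho
    · exact h1 h
    · rcases dst_of_mem_eqOps ho with h' | h'
      · exact h1 (h.trans h')
      · exact h2 (h.trans h')
  have hflag : ρ' flag = if key.map ρ = x.map ρ then 1 else 0 := by
    rw [hρ', evals_cons, evals_eqOps hft]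
    · simp only [Op.eval, Function.update_self]
      refine if_congr ?_ rfl rfl
      have : ∀ p ∈ key.zip x, Function.update ρ flag 1 p.1 = ρ p.1 ∧
          Function.update ρ flag 1 p.2 = ρ p.2 := fun p hp =>
        ⟨Function.update_of_ne (hkey _ (List.of_mem_zip hp).1).1 _ _,
          Function.update_of_ne (hx _ (List.of_mem_zip hp).2).1 _ _⟩
      rw [show (∀ p ∈ key.zip x, Function.update ρ flag 1 p.1 = Function.update ρ flag 1 p.2) ↔
        ∀ p ∈ key.zip x, ρ p.1 = ρ p.2 from
        forall₂_congr fun p hp => by rw [(this p hp).1, (this p hp).2]]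
      rw [← List.forall₂_eq_eq_eq, List.forall₂_map_left_iff, List.forall₂_map_right_iff,
        List.forall₂_iff_zip]
      constructor
      · exact fun h => ⟨hkx, fun {a b} hab => h (a, b) hab⟩
      · exact fun h p hp => h.2 hp
    · intro p hp
      have h1 := hkey _ (List.of_mem_zip hp).1
      have h2 := hx _ (List.of_mem_zip hp).2
      exact ⟨h1.1, h1.2, h2.1, h2.2⟩
  have key' := evals_selOps hft (z := ansSrc.zip ans) (fun p hp =>
    ⟨(hsrc _ (List.of_mem_zip hp).1).2.1, (hdst _ (List.of_mem_zip hp).2).2,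
      (hdst _ (List.of_mem_zip hp).2).1⟩) (by rwa [hsnd])
    (fun p hp => by rw [hsnd]; exact (hsrc _ (List.of_mem_zip hp).1).2.2) ρ'
  rw [hsnd, hfst] at key'
  have e : evals (condCopy flag tmp key x ansSrc ans) ρ =
      evals (selOps flag tmp (ansSrc.zip ans)) ρ' := by
    rw [condCopy, ← List.cons_append, evals_append, hρ']
  rw [e, key', hflag]
  have e1 : ansSrc.map ρ' = ansSrc.map ρ :=
    List.map_congr_left fun r hr => hne r (hsrc r hr).1 (hsrc r hr).2.1
  have e2 : ans.map ρ' = ans.map ρ :=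
    List.map_congr_left fun r hr => hne r (hdst r hr).1 (hdst r hr).2
  rw [e1, e2]
  split_ifs <;> simp_all

/-! ### The offline game

The answers of the encryption oracle are prepared in advance as a list of pads `(c, y)`; the
plaintext `s` is encrypted as `c ‖ (y ⊕ s)`. -/

/-- The oracles of the security game: hash function, encryption, and random strings in place of
encryptions. -/
inductive GameOracle : Type
  | hash
  | enc
  | rnd

/-- Encrypt with the next pad. -/
def popPad {n k m : ℕ} (x : List Bit) :
    HashTable k × List (Bits n × Bits m) → List Bit × (HashTable k × List (Bits n × Bits m))
  | (τ, []) => ([], (τ, []))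
  | (τ, p :: ℓ) => (List.ofFn p.1 ++ List.ofFn (p.2 + toBlock m x), (τ, ℓ))

/-- The oracles that encrypt with prepared pads. -/
def padOracles (n k m : ℕ) : Oracles GameOracle (HashTable k × List (Bits n × Bits m))
  | .hash, x, s => (randomOracle k x s.1).map fun y => (List.ofFn y.1, (y.2, s.2))
  | .enc, x, s => PMF.pure (popPad x s)
  | .rnd, x, s => PMF.pure (popPad x s)

/-- A value may be drawn even when the table already has one, since an unused draw changes nothing.
This removes the branch, so that a straight-line circuit can imitate the oracle. -/
theorem randomOracle_eq_bind (k : ℕ) (x : List Bit) (τ : HashTable k) :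
    randomOracle k x τ = (unif (Bits k)).bind fun v =>
      PMF.pure ((τ x).getD v, Function.update τ x (some ((τ x).getD v))) := by
  rw [randomOracle]
  cases h : τ x with
  | none => rfl
  | some y =>
    simp only [Option.getD_some, PMF.bind_const]
    rw [← h, Function.update_eq_self]

/-! ### Simulation of the offline game by a circuit without oracles -/

/-- The register that represents the register `i` of the adversary. -/
def advReg (B i : ℕ) : ℕ := B + 2 * i

/-- The auxiliary registers of the simulator. -/
def auxReg (B j : ℕ) : ℕ := B + 2 * j + 1

/-- A block of consecutive auxiliary registers. -/
def auxBlock (B s a : ℕ) : List ℕ := List.ofFn fun i : Fin a => auxReg B (s + i)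

theorem advReg_injective (B : ℕ) : Function.Injective (advReg B) := fun i j h => by
  simp only [advReg] at h; omega

theorem advReg_ne_auxReg (B i j : ℕ) : advReg B i ≠ auxReg B j := by
  simp only [advReg, auxReg]; omega

theorem auxReg_inj {B i j : ℕ} : auxReg B i = auxReg B j ↔ i = j := by
  simp only [auxReg]; omega

theorem mem_auxBlock {B s a r : ℕ} : r ∈ auxBlock B s a ↔ ∃ j, s ≤ j ∧ j < s + a ∧ r = auxReg B j := by
  simp only [auxBlock, List.mem_ofFn]
  constructor
  · rintro ⟨i, rfl⟩
    exact ⟨s + i, by omega, by omega, rfl⟩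
  · rintro ⟨j, h1, h2, rfl⟩
    exact ⟨⟨j - s, by omega⟩, by simp only [auxReg_inj]; omega⟩

@[simp] theorem length_auxBlock (B s a : ℕ) : (auxBlock B s a).length = a := by simp [auxBlock]

theorem nodup_auxBlock (B s a : ℕ) : (auxBlock B s a).Nodup := by
  rw [auxBlock, List.nodup_ofFn]
  intro i j h
  simp only [auxReg_inj] at h
  omega

theorem auxBlock_add (B s a b : ℕ) :
    auxBlock B s (a + b) = auxBlock B s a ++ auxBlock B (s + a) b := by
  simp only [auxBlock, List.ofFn_add, Fin.val_natAdd, add_assoc]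
  rfl

theorem advReg_notMem_auxBlock (B i s a : ℕ) : advReg B i ∉ auxBlock B s a := by
  rw [mem_auxBlock]
  rintro ⟨j, -, -, h⟩
  exact advReg_ne_auxReg _ _ _ h

theorem auxReg_notMem_map_advReg (B j : ℕ) (ds : List ℕ) : auxReg B j ∉ ds.map (advReg B) := by
  rw [List.mem_map]
  rintro ⟨i, -, h⟩
  exact advReg_ne_auxReg _ _ _ h

/-- Copy the registers `ss` to the registers `ds`. -/
def copyBlock (ds ss : List ℕ) : List Op :=
  affineBlock ((ds.zip ss).map fun p => (p.1, 0, [p.2]))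

theorem evals_copyBlock {ds ss : List ℕ} (h : ∀ d ∈ ds, d ∉ ss) (ρ : Registers) :
    evals (copyBlock ds ss) ρ = writeBits ds (ss.map ρ) ρ := by
  rw [copyBlock, evals_affineBlock]
  · simp only [writeBits, List.map_map]
    congr 1
    induction ds generalizing ss with
    | nil => simp
    | cons d ds ih =>
      cases ss with
      | nil => simp
      | cons s ss =>
        have := ih (ss := ss) fun d hd h' =>
          h d (List.mem_cons_of_mem _ hd) (List.mem_cons_of_mem _ h')
        simp only [List.zip_cons_cons, List.map_cons, this]
        simp [affineValue]
  · intro e he e' he'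
    obtain ⟨p, hp, rfl⟩ := List.mem_map.1 he
    obtain ⟨p', hp', rfl⟩ := List.mem_map.1 he'
    simp only [List.mem_singleton]
    intro h'
    exact h _ (List.of_mem_zip hp).1 (h' ▸ (List.of_mem_zip hp').2)

theorem length_copyBlock_le (ds ss : List ℕ) : (copyBlock ds ss).length ≤ 2 * ds.length := by
  refine (length_affineBlock_le (c := 1) ?_).trans ?_
  · intro e he
    obtain ⟨p, -, rfl⟩ := List.mem_map.1 he
    simp
  · simp; omega

/-- What the simulator knows at compile time: the addresses and lengths of the earlier hash queries
(latest first), the next free auxiliary register, the number of pads used. -/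
structure SimState : Type where
  log : List (ℕ × ℕ)
  next : ℕ
  used : ℕ

/-- Look up the query in the block `X` in the log and write the answer, if there is one, to `A`. -/
def lookupOps (B k : ℕ) (X A : List ℕ) : List (ℕ × ℕ) → List Op
  | [] => []
  | (s, a) :: log => lookupOps B k X A log ++
      if a = X.length then
        condCopy (auxReg B 0) (auxReg B 1) (auxBlock B s a) X (auxBlock B (s + a) k) A
      else []

/-- The table represented by the log. -/
def tableOf (B k : ℕ) (ρ : Registers) : List (ℕ × ℕ) → HashTable k
  | [], _ => none
  | (s, a) :: log, x =>
      if (auxBlock B s a).map ρ = x then some fun i => ρ (auxReg B (s + a + i))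
      else tableOf B k ρ log x

/-- The pads `j, …, Q - 1` stored from the register `base` on. -/
def padsOf (n m base Q : ℕ) (ρ : Registers) (j : ℕ) : List (Bits n × Bits m) :=
  (List.range' j (Q - j)).map fun j =>
    (fun i => ρ (base + j * (n + m) + i), fun i => ρ (base + j * (n + m) + n + i))

/-- The simulated state of the game. -/
def SimState.decode (n k m base Q B : ℕ) (st : SimState) (ρ : Registers) :
    Registers × (HashTable k × List (Bits n × Bits m)) :=
  (fun i => ρ (advReg B i), (tableOf B k ρ st.log, padsOf n m base Q ρ st.used))

/-- The entries by which the simulator encrypts with the pad `j`. -/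
def padEntries (n m base B s j : ℕ) (src : List ℕ) : List (ℕ × Bit × List ℕ) :=
  (List.ofFn fun i : Fin n => (auxReg B (s + i), 0, [base + j * (n + m) + i])) ++
  List.ofFn fun i : Fin m =>
    (auxReg B (s + n + i), 0, (base + j * (n + m) + n + i) :: (src[(i : ℕ)]?.toList.map (advReg B)))

/-- Simulation of a gate. -/
def simGate (n k m base Q B : ℕ) (st : SimState) : Gate GameOracle → Circuit Empty
  | .const d b => [.const (advReg B d) b]
  | .coin d => [.coin (advReg B d)]
  | .xor d a b => [.xor (advReg B d) (advReg B a) (advReg B b)]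
  | .and d a b => [.and (advReg B d) (advReg B a) (advReg B b)]
  | .query .hash src dst =>
      toCircuit (copyBlock (auxBlock B st.next src.length) (src.map (advReg B))) ++
      (coinBlock (auxBlock B (st.next + src.length) k) ++
      toCircuit (lookupOps B k (auxBlock B st.next src.length)
        (auxBlock B (st.next + src.length) k) st.log ++
      copyBlock (dst.map (advReg B)) (auxBlock B (st.next + src.length) k)))
  | .query _ src dst =>
      if st.used < Q then
        toCircuit (affineBlock (padEntries n m base B st.next st.used src) ++
          copyBlock (dst.map (advReg B)) (auxBlock B st.next (n + m)))
      else []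

/-- The change of the compile time state. -/
def SimState.step (n k m : ℕ) (st : SimState) : Gate GameOracle → SimState
  | .query .hash src _ =>
      ⟨(st.next, src.length) :: st.log, st.next + src.length + k, st.used⟩
  | .query _ _ _ => ⟨st.log, st.next + (n + m), st.used + 1⟩
  | _ => st

/-- The blocks of the log lie between the scratch registers and the free registers. -/
def SimState.WellFormed (k : ℕ) (st : SimState) : Prop :=
  2 ≤ st.next ∧ ∀ e ∈ st.log, 2 ≤ e.1 ∧ e.1 + e.2 + k ≤ st.next

theorem SimState.WellFormed.step {n k m : ℕ} {st : SimState} (h : st.WellFormed k)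
    (G : Gate GameOracle) : (st.step n k m G).WellFormed k := by
  obtain ⟨h1, h2⟩ := h
  cases G with
  | query o src dst =>
    have h3 : ∀ c, ∀ e ∈ st.log, 2 ≤ e.1 ∧ e.1 + e.2 + k ≤ st.next + c := fun c e he => by
      have := h2 e he
      omega
    cases o with
    | hash =>
      refine ⟨by simp only [SimState.step]; omega, fun e he => ?_⟩
      simp only [SimState.step, List.mem_cons] at he ⊢
      rcases he with rfl | he
      · exact ⟨h1, le_rfl⟩
      · have := h3 (src.length + k) e he
        omega
    | enc => exact ⟨h1.trans (Nat.le_add_right _ _), h3 _⟩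
    | rnd => exact ⟨h1.trans (Nat.le_add_right _ _), h3 _⟩
  | _ => exact ⟨h1, h2⟩

theorem evals_lookupOps_of_ne {B k : ℕ} {X A : List ℕ} {log : List (ℕ × ℕ)} {r : ℕ}
    (h0 : r ≠ auxReg B 0) (h1 : r ≠ auxReg B 1) (hA : r ∉ A) (ρ : Registers) :
    evals (lookupOps B k X A log) ρ r = ρ r := by
  induction log with
  | nil => rfl
  | cons e log ih =>
    rw [lookupOps, evals_append]
    split_ifs
    · rw [evals_condCopy_of_ne h0 h1 hA, ih]
    · rw [evals_nil, ih]

theorem tableOf_congr {B k : ℕ} {ρ ρ' : Registers} {log : List (ℕ × ℕ)}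
    (h : ∀ e ∈ log, ∀ j, e.1 ≤ j → j < e.1 + e.2 + k → ρ (auxReg B j) = ρ' (auxReg B j)) :
    tableOf B k ρ log = tableOf B k ρ' log := by
  induction log with
  | nil => rfl
  | cons e log ih =>
    obtain ⟨s, a⟩ := e
    have ih := ih fun e he => h e (List.mem_cons_of_mem _ he)
    have h0 := h (s, a) List.mem_cons_self
    simp only at h0
    funext x
    have e1 : (auxBlock B s a).map ρ = (auxBlock B s a).map ρ' := by
      refine List.map_congr_left fun r hr => ?_
      obtain ⟨j, hj1, hj2, rfl⟩ := mem_auxBlock.1 hr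
      exact h0 j hj1 (by omega)
    have e2 : (fun i : Fin k => ρ (auxReg B (s + a + i))) = fun i : Fin k => ρ' (auxReg B (s + a + i)) := by
      funext i
      exact h0 _ (by omega) (by omega)
    simp only [tableOf, e1, e2, ih]

/-- Older log entries are tried first, so the latest match has the last word, which is the priority
used by `tableOf`. Entries of another length cannot match and are skipped at compile time. The
answer block keeps its coin tosses if nothing matches. -/
theorem map_evals_lookupOps {B k s a : ℕ} (hs : 2 ≤ s) {log : List (ℕ × ℕ)}
    (hlog : ∀ e ∈ log, 2 ≤ e.1 ∧ e.1 + e.2 + k ≤ s) (ρ : Registers) :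
    (auxBlock B (s + a) k).map
        (evals (lookupOps B k (auxBlock B s a) (auxBlock B (s + a) k) log) ρ) =
      ((tableOf B k ρ log ((auxBlock B s a).map ρ)).map List.ofFn).getD
        ((auxBlock B (s + a) k).map ρ) := by
  have hft : auxReg B 0 ≠ auxReg B 1 := by simp [auxReg_inj]
  have hblock : ∀ s' a', 2 ≤ s' → ∀ r ∈ auxBlock B s' a', r ≠ auxReg B 0 ∧ r ≠ auxReg B 1 := by
    intro s' a' hs' r hr
    obtain ⟨j, hj1, hj2, rfl⟩ := mem_auxBlock.1 hr
    simp only [ne_eq, auxReg_inj]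
    omega
  induction log with
  | nil => rfl
  | cons e log ih =>
    obtain ⟨s', a'⟩ := e
    have ih := ih fun e he => hlog e (List.mem_cons_of_mem _ he)
    obtain ⟨h1, h2⟩ := hlog (s', a') List.mem_cons_self
    simp only at h1 h2
    rw [lookupOps]
    simp only [length_auxBlock, evals_append]
    by_cases ha : a' = a
    · subst ha
      rw [if_pos rfl]
      have hdisj : ∀ r ∈ auxBlock B (s' + a') k, r ∉ auxBlock B (s + a') k := by
        intro r hr hr'
        obtain ⟨j, hj1, hj2, rfl⟩ := mem_auxBlock.1 hr
        obtain ⟨j', hj1', hj2', h⟩ := mem_auxBlock.1 hr'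
        rw [auxReg_inj] at h
        omega
      rw [map_evals_condCopy hft (by simp) (by simp) (nodup_auxBlock _ _ _) (hblock _ _ h1)
        (hblock _ _ hs) (fun r hr => ⟨(hblock _ _ (by omega) r hr).1,
          (hblock _ _ (by omega) r hr).2, hdisj r hr⟩) (hblock _ _ (by omega))]
      have hsame : ∀ s'' a'', 2 ≤ s'' → s'' + a'' ≤ s + a' →
          (auxBlock B s'' a'').map
            (evals (lookupOps B k (auxBlock B s a') (auxBlock B (s + a') k) log) ρ) =
          (auxBlock B s'' a'').map ρ := by
        intro s'' a'' hs'' hle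
        refine List.map_congr_left fun r hr => ?_
        refine evals_lookupOps_of_ne (hblock _ _ hs'' r hr).1 (hblock _ _ hs'' r hr).2 ?_ ρ
        obtain ⟨j, hj1, hj2, rfl⟩ := mem_auxBlock.1 hr
        intro hr'
        obtain ⟨j', hj1', hj2', h⟩ := mem_auxBlock.1 hr'
        rw [auxReg_inj] at h
        omega
      rw [hsame s' a' h1 (by omega), hsame s a' hs le_rfl, hsame (s' + a') k (by omega) (by omega),
        ih, tableOf]
      by_cases hx : (auxBlock B s' a').map ρ = (auxBlock B s a').map ρ
      · rw [if_pos hx, if_pos hx]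
        simp [auxBlock, Function.comp_def]
      · rw [if_neg hx, if_neg hx]
    · rw [if_neg ha, evals_nil, ih, tableOf, if_neg]
      intro h
      apply ha
      simpa using congrArg List.length h

section Simulation

variable {n k m base Q B : ℕ}

theorem padsOf_congr {ρ ρ' : Registers} {j : ℕ} (hB : base + Q * (n + m) ≤ B)
    (h : ∀ r < B, ρ r = ρ' r) : padsOf n m base Q ρ j = padsOf n m base Q ρ' j := by
  refine List.map_congr_left fun i hi => ?_
  have hi : i < Q := by rw [List.mem_range'_1] at hi; omega
  have : (i + 1) * (n + m) ≤ Q * (n + m) := Nat.mul_le_mul_right _ hi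
  rw [add_mul] at this
  refine Prod.ext (funext fun a => h _ ?_) (funext fun a => h _ ?_)
  · omega
  · omega

theorem padsOf_eq_cons {ρ : Registers} {j : ℕ} (hj : j < Q) :
    padsOf n m base Q ρ j =
      (fun i : Fin n => ρ (base + j * (n + m) + i),
        fun i : Fin m => ρ (base + j * (n + m) + n + i)) :: padsOf n m base Q ρ (j + 1) := by
  obtain ⟨c, hc⟩ : ∃ c, Q - j = c + 1 := ⟨Q - j - 1, by omega⟩
  have : Q - (j + 1) = c := by omega
  simp only [padsOf, hc, this, List.range'_succ, List.map_cons]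

theorem toBlock_map (src : List ℕ) (f : ℕ → ℕ) (ρ : Registers) (i : Fin m) :
    toBlock m (src.map fun r => ρ (f r)) i = ((src[(i : ℕ)]?.toList.map f).map ρ).sum := by
  simp only [toBlock, List.getD_eq_getElem?_getD, List.getElem?_map]
  cases src[(i : ℕ)]? <;> simp

theorem map_fst_padEntries (s j : ℕ) (src : List ℕ) :
    (padEntries n m base B s j src).map Prod.fst = auxBlock B s (n + m) := by
  rw [auxBlock_add]
  simp [padEntries, auxBlock, Function.comp_def, List.map_ofFn]

theorem map_affineValue_padEntries (s j : ℕ) (src : List ℕ) (ρ : Registers) :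
    (padEntries n m base B s j src).map (affineValue ρ) =
      List.ofFn (fun i : Fin n => ρ (base + j * (n + m) + i)) ++
      List.ofFn ((fun i : Fin m => ρ (base + j * (n + m) + n + i)) +
        toBlock m (src.map fun r => ρ (advReg B r))) := by
  simp only [padEntries, List.map_append, List.map_ofFn]
  congr 2
  · funext i
    simp [affineValue]
  · funext i
    simp only [Function.comp_apply, affineValue, Pi.add_apply, toBlock_map]
    simp

/-- Pads lie below `B`, simulated registers at even and auxiliary ones at odd distance from `B`;
writing to simulated registers therefore leaves the table and the pads alone. -/
theorem decode_writeBits_advReg (hB : base + Q * (n + m) ≤ B) (st : SimState) (ds : List ℕ)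
    (x : List Bit) (ρ : Registers) :
    st.decode n k m base Q B (writeBits (ds.map (advReg B)) x ρ) =
      (writeBits ds x fun i => ρ (advReg B i),
        (tableOf B k ρ st.log, padsOf n m base Q ρ st.used)) := by
  rw [SimState.decode, writeBits_comp (advReg_injective B)]
  congr 2
  · exact tableOf_congr fun e _ j _ _ =>
      writeBits_of_notMem (auxReg_notMem_map_advReg _ _ _)
  · refine padsOf_congr hB fun r hr => writeBits_of_notMem ?_
    rw [List.mem_map]
    rintro ⟨i, -, rfl⟩
    simp only [advReg] at hr
    omega

theorem decode_update_advReg (hB : base + Q * (n + m) ≤ B) (st : SimState) (d : ℕ) (b : Bit)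
    (ρ : Registers) :
    st.decode n k m base Q B (Function.update ρ (advReg B d) b) =
      (Function.update (fun i => ρ (advReg B i)) d b,
        (tableOf B k ρ st.log, padsOf n m base Q ρ st.used)) := by
  have := decode_writeBits_advReg (k := k) hB st [d] [b] ρ
  simpa [writeBits] using this

/-- The query is copied to a fresh block, coins fill the answer block behind it, and a logged answer
overwrites them. Pushing the address of the pair onto the log is exactly the `Function.update` of
the table. -/
theorem run_simGate_hash (hB : base + Q * (n + m) ≤ B) {st : SimState} (hst : st.WellFormed k)
    (O : Oracles Empty Unit) (src dst : List ℕ) (ρ : Registers) :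
    (Circuit.run O (simGate n k m base Q B st (.query .hash src dst)) (ρ, ())).map
        (fun y => (st.step n k m (.query .hash src dst)).decode n k m base Q B y.1) =
      Gate.exec (padOracles n k m) (.query .hash src dst) (st.decode n k m base Q B ρ) := by
  obtain ⟨h1, h2⟩ := hst
  simp only [simGate, run_append, run_toCircuit, PMF.pure_bind, Gate.exec, padOracles,
    SimState.decode, randomOracle_eq_bind, PMF.map_bind, PMF.pure_map,
    run_coinBlock O (n := k) (auxBlock B (st.next + src.length) k) (length_auxBlock _ _ _),
    PMF.bind_bind]
  congr 1
  funext v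
  congr 1
  obtain ⟨X, hX⟩ : ∃ X, X = auxBlock B st.next src.length := ⟨_, rfl⟩
  obtain ⟨A, hA⟩ : ∃ A, A = auxBlock B (st.next + src.length) k := ⟨_, rfl⟩
  have hXr : ∀ r ∈ X, ∃ j, st.next ≤ j ∧ j < st.next + src.length ∧ r = auxReg B j :=
    fun r hr => mem_auxBlock.1 (hX ▸ hr)
  have hAr : ∀ r ∈ A, ∃ j, st.next + src.length ≤ j ∧ j < st.next + src.length + k ∧
    r = auxReg B j := fun r hr => mem_auxBlock.1 (hA ▸ hr)
  have hXA : ∀ r ∈ X, r ∉ A := by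
    intro r hr hr'
    obtain ⟨j, hj1, hj2, rfl⟩ := hXr r hr
    obtain ⟨j', hj1', hj2', h⟩ := hAr _ hr'
    rw [auxReg_inj] at h
    omega
  rw [← hX, ← hA, evals_append, evals_copyBlock (ds := X), evals_copyBlock (ss := A)]
  rotate_left
  · intro d hd hd'
    rw [hA] at hd'
    obtain ⟨i, -, rfl⟩ := List.mem_map.1 hd
    exact advReg_notMem_auxBlock _ _ _ _ hd'
  · intro d hd
    obtain ⟨j, -, -, rfl⟩ := hXr d hd
    exact auxReg_notMem_map_advReg _ _ _
  obtain ⟨x, hx⟩ : ∃ x, x = (src.map (advReg B)).map ρ := ⟨_, rfl⟩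
  have hx' : src.map (fun i => ρ (advReg B i)) = x := by rw [hx, List.map_map]; rfl
  rw [← hx, hx']
  -- `ρ₂` is the state after copying the query and tossing the coins, `ρ₃` the state after the
  -- lookup. The rest tracks which registers each of these leaves unchanged.
  obtain ⟨ρ₂, hρ₂⟩ : ∃ ρ₂, ρ₂ = writeBits A (List.ofFn v) (writeBits X x ρ) := ⟨_, rfl⟩
  obtain ⟨ρ₃, hρ₃⟩ : ∃ ρ₃, ρ₃ = evals (lookupOps B k X A st.log) ρ₂ := ⟨_, rfl⟩
  rw [← hρ₂, ← hρ₃]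
  refine (decode_writeBits_advReg hB (st.step n k m (.query .hash src dst)) _ _ _).trans ?_
  have hne₂ : ∀ r, r ∉ X → r ∉ A → ρ₂ r = ρ r := fun r hr hr' => by
    rw [hρ₂, writeBits_of_notMem hr', writeBits_of_notMem hr]
  have hX₂ : X.map ρ₂ = x := by
    rw [hρ₂, map_writeBits_of_disjoint hXA, map_writeBits_self (hX ▸ nodup_auxBlock _ _ _)]
    simp [hX, hx]
  have hA₂ : A.map ρ₂ = List.ofFn v := by
    rw [hρ₂, map_writeBits_self (hA ▸ nodup_auxBlock _ _ _)]
    simp [hA]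
  have htab₂ : tableOf B k ρ₂ st.log = tableOf B k ρ st.log := by
    refine tableOf_congr fun e he j hj1 hj2 => hne₂ _ (fun h => ?_) fun h => ?_
    · obtain ⟨j', hj1', hj2', h⟩ := hXr _ h
      rw [auxReg_inj] at h
      have := h2 e he
      omega
    · obtain ⟨j', hj1', hj2', h⟩ := hAr _ h
      rw [auxReg_inj] at h
      have := h2 e he
      omega
  have hne₃ : ∀ r, r ≠ auxReg B 0 → r ≠ auxReg B 1 → r ∉ A → ρ₃ r = ρ₂ r := fun r hr0 hr1 hr => by
    rw [hρ₃, evals_lookupOps_of_ne hr0 hr1 hr]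
  have hA₃ : A.map ρ₃ = List.ofFn ((tableOf B k ρ st.log x).getD v) := by
    rw [hρ₃, hA, hX, map_evals_lookupOps h1 h2, ← hA, ← hX, hX₂, hA₂, htab₂]
    cases tableOf B k ρ st.log x <;> rfl
  have hX₃ : X.map ρ₃ = x := by
    rw [← hX₂]
    refine List.map_congr_left fun r hr => hne₃ r ?_ ?_ (hXA r hr) <;>
    · obtain ⟨j, hj1, hj2, rfl⟩ := hXr r hr
      simp only [ne_eq, auxReg_inj]
      omega
  have hadv : ∀ i, ρ₃ (advReg B i) = ρ (advReg B i) := by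
    intro i
    rw [hne₃ _ (advReg_ne_auxReg _ _ _) (advReg_ne_auxReg _ _ _)
      (hA ▸ advReg_notMem_auxBlock _ _ _ _), hne₂ _ (hX ▸ advReg_notMem_auxBlock _ _ _ _)
      (hA ▸ advReg_notMem_auxBlock _ _ _ _)]
  have htab₃ : tableOf B k ρ₃ st.log = tableOf B k ρ st.log := by
    rw [← htab₂]
    refine tableOf_congr fun e he j hj1 hj2 => hne₃ _ ?_ ?_ fun h => ?_
    · have := h2 e he
      simp only [ne_eq, auxReg_inj]
      omega
    · have := h2 e he
      simp only [ne_eq, auxReg_inj]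
      omega
    · obtain ⟨j', hj1', hj2', h⟩ := hAr _ h
      rw [auxReg_inj] at h
      have := h2 e he
      omega
  have hlow : ∀ r < B, ρ₃ r = ρ r := by
    intro r hr
    have hr' : ∀ j, r ≠ auxReg B j := fun j => by simp only [auxReg]; omega
    rw [hne₃ _ (hr' _) (hr' _), hne₂]
    · exact fun h => by obtain ⟨j, -, -, h⟩ := hXr _ h; exact hr' j h
    · exact fun h => by obtain ⟨j, -, -, h⟩ := hAr _ h; exact hr' j h
    · exact fun h => by obtain ⟨j, -, -, h⟩ := hAr _ h; exact hr' j h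
  rw [hA₃]
  simp only [hadv, SimState.step]
  congr 2
  · funext x'
    rw [tableOf, ← hX, hX₃, htab₃, Function.update_apply]
    by_cases h : x = x'
    · rw [if_pos h, if_pos h.symm]
      have h3 := hA₃
      rw [hA, auxBlock, List.map_ofFn] at h3
      exact congrArg some (List.ofFn_injective h3)
    · rw [if_neg h, if_neg (Ne.symm h)]
  · exact padsOf_congr hB hlow

theorem run_simGate_pad (hB : base + Q * (n + m) ≤ B) {st : SimState} (hst : st.WellFormed k)
    (O : Oracles Empty Unit) (src dst : List ℕ) (ρ : Registers) :
    (Circuit.run O (simGate n k m base Q B st (.query .enc src dst)) (ρ, ())).map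
        (fun y => (st.step n k m (.query .enc src dst)).decode n k m base Q B y.1) =
      Gate.exec (padOracles n k m) (.query .enc src dst) (st.decode n k m base Q B ρ) := by
  obtain ⟨h1, h2⟩ := hst
  simp only [simGate, Gate.exec, padOracles, PMF.pure_map]
  by_cases hQ : st.used < Q
  swap
  -- Once the pads are used up, the oracle answers with the empty string, and writing it changes no
  -- register, just as the empty circuit does.
  · have e : ∀ j, st.used ≤ j → padsOf n m base Q ρ j = [] := fun j hj => by
      simp [padsOf, show Q - j = 0 by omega]
    rw [if_neg hQ, run_nil, PMF.pure_map]
    simp [SimState.decode, SimState.step, e, popPad, writeBits_nil_right]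
  rw [if_pos hQ, run_toCircuit, PMF.pure_map, evals_append, evals_affineBlock, evals_copyBlock]
  rotate_left
  · intro d hd hd'
    obtain ⟨i, -, rfl⟩ := List.mem_map.1 hd
    exact advReg_notMem_auxBlock _ _ _ _ hd'
  · intro e he e' he' h
    have he1 : e.1 ∈ auxBlock B st.next (n + m) := by
      rw [← map_fst_padEntries (n := n) (m := m) (base := base) st.next st.used src]
      exact List.mem_map_of_mem he
    obtain ⟨j, -, -, hj⟩ := mem_auxBlock.1 he1
    rw [hj] at h
    have hQ' : (st.used + 1) * (n + m) ≤ Q * (n + m) := Nat.mul_le_mul_right _ hQ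
    rw [add_mul] at hQ'
    simp only [padEntries, List.mem_append, List.mem_ofFn] at he'
    rcases he' with ⟨i, rfl⟩ | ⟨i, rfl⟩
    · simp only [List.mem_singleton, auxReg] at h
      omega
    · simp only [List.mem_cons] at h
      rcases h with h | h
      · simp only [auxReg] at h
        omega
      · exact auxReg_notMem_map_advReg _ _ _ h
  congr 1
  rw [map_fst_padEntries, map_affineValue_padEntries, decode_writeBits_advReg hB,
    map_writeBits_self (nodup_auxBlock _ _ _) (by simp)]
  obtain ⟨x, hx⟩ : ∃ x, x = List.ofFn (fun i : Fin n => ρ (base + st.used * (n + m) + i)) ++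
      List.ofFn ((fun i : Fin m => ρ (base + st.used * (n + m) + n + i)) +
        toBlock m (src.map fun r => ρ (advReg B r))) := ⟨_, rfl⟩
  rw [← hx]
  simp only [SimState.decode, padsOf_eq_cons hQ, popPad, ← hx, SimState.step]
  congr 2
  · funext i
    exact writeBits_of_notMem (advReg_notMem_auxBlock _ _ _ _)
  · refine tableOf_congr fun e he j hj1 hj2 => writeBits_of_notMem fun h => ?_
    obtain ⟨j', hj1', hj2', h⟩ := mem_auxBlock.1 h
    rw [auxReg_inj] at h
    have := h2 e he
    omega
  · refine padsOf_congr hB fun r hr => writeBits_of_notMem fun h => ?_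
    obtain ⟨j', hj1', hj2', h⟩ := mem_auxBlock.1 h
    simp only [auxReg] at h
    omega

theorem run_simGate (hB : base + Q * (n + m) ≤ B) {st : SimState} (hst : st.WellFormed k)
    (O : Oracles Empty Unit) (G : Gate GameOracle) (ρ : Registers) :
    (Circuit.run O (simGate n k m base Q B st G) (ρ, ())).map
        (fun y => (st.step n k m G).decode n k m base Q B y.1) =
      G.exec (padOracles n k m) (st.decode n k m base Q B ρ) := by
  cases G with
  | const d b =>
    simp only [simGate, run_cons, Gate.exec, PMF.pure_bind, run_nil, PMF.pure_map,
      SimState.step, decode_update_advReg hB]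
    rfl
  | coin d =>
    simp only [simGate, run_cons, Gate.exec, PMF.bind_map, PMF.map_bind,
      SimState.step, Function.comp_def, run_nil, PMF.pure_map, decode_update_advReg hB]
    rfl
  | xor d a b =>
    simp only [simGate, run_cons, Gate.exec, PMF.pure_bind, run_nil, PMF.pure_map,
      SimState.step, decode_update_advReg hB]
    rfl
  | and d a b =>
    simp only [simGate, run_cons, Gate.exec, PMF.pure_bind, run_nil, PMF.pure_map,
      SimState.step, decode_update_advReg hB]
    rfl
  | query o src dst =>
    cases o with
    | hash => exact run_simGate_hash hB hst O src dst ρ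
    | enc => exact run_simGate_pad hB hst O src dst ρ
    | rnd => exact run_simGate_pad hB hst O src dst ρ

/-- Simulation of a circuit. -/
def simCircuit (n k m base Q B : ℕ) : SimState → Circuit GameOracle → Circuit Empty
  | _, [] => []
  | st, G :: C => simGate n k m base Q B st G ++ simCircuit n k m base Q B (st.step n k m G) C

/-- `decode` intertwines a simulated gate with the gate itself by `run_simGate`, and this composes
along the circuit. -/
theorem run_simCircuit (hB : base + Q * (n + m) ≤ B) {st : SimState} (hst : st.WellFormed k)
    (O : Oracles Empty Unit) (C : Circuit GameOracle) (ρ : Registers) :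
    (Circuit.run O (simCircuit n k m base Q B st C) (ρ, ())).map (fun y i => y.1 (advReg B i)) =
      (Circuit.run (padOracles n k m) C (st.decode n k m base Q B ρ)).map Prod.fst := by
  induction C generalizing st ρ with
  | nil => simp [simCircuit, run_nil, PMF.pure_map, SimState.decode]
  | cons G C ih =>
    rw [simCircuit, run_append, run_cons, ← run_simGate hB hst O G ρ, PMF.map_bind, PMF.map_bind,
      PMF.bind_map]
    congr 1
    funext y
    exact ih (hst.step G) y.1

/-- The state of the simulator at the beginning. -/
def SimState.init : SimState := ⟨[], 2, 0⟩

theorem SimState.wellFormed_init : SimState.init.WellFormed k := by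
  simp [SimState.init, SimState.WellFormed]

theorem SimState.decode_init (ρ : Registers) :
    SimState.init.decode n k m base Q B ρ =
      (fun i => ρ (advReg B i), (fun _ => none, padsOf n m base Q ρ 0)) := rfl

/-! ### The size of the simulation -/

theorem length_lookupOps_le (k : ℕ) (X A : List ℕ) (log : List (ℕ × ℕ)) :
    (lookupOps B k X A log).length ≤ log.length * (1 + 4 * X.length + 3 * A.length) := by
  induction log with
  | nil => simp [lookupOps]
  | cons e log ih =>
    rw [lookupOps, List.length_append, List.length_cons, add_mul, one_mul]
    refine add_le_add ih ?_
    split_ifs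
    · exact length_condCopy_le _ _ _ _ _ _
    · simp

theorem length_log_step (st : SimState) (G : Gate GameOracle) :
    (st.step n k m G).log.length ≤ st.log.length + 1 := by
  cases G with
  | query o src dst => cases o <;> simp [SimState.step]
  | _ => simp [SimState.step]

/-- Only a hash gate pays for the log: each earlier query is compared with the new one at a cost
linear in the query length and in `k`. A pad gate costs at most three operations per ciphertext bit
plus copying. -/
theorem size_simGate_le (st : SimState) (G : Gate GameOracle) :
    (simGate n k m base Q B st G).size ≤
      G.cost * ((st.log.length + 4) * (4 + 3 * k) + (n + m) * 3) := by
  have hone : 1 ≤ (st.log.length + 4) * (4 + 3 * k) + (n + m) * 3 := by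
    have : 1 * 1 ≤ (st.log.length + 4) * (4 + 3 * k) := Nat.mul_le_mul (by omega) (by omega)
    omega
  cases G with
  | const d b => simpa [simGate, size_cons, Gate.cost, Circuit.size] using hone
  | coin d => simpa [simGate, size_cons, Gate.cost, Circuit.size] using hone
  | xor d a b => simpa [simGate, size_cons, Gate.cost, Circuit.size] using hone
  | and d a b => simpa [simGate, size_cons, Gate.cost, Circuit.size] using hone
  | query o src dst =>
    have hpad : (if st.used < Q then
        toCircuit (affineBlock (padEntries n m base B st.next st.used src) ++
          copyBlock (dst.map (advReg B)) (auxBlock B st.next (n + m)))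
        else [] : Circuit Empty).size ≤
        (1 + src.length + dst.length) * ((st.log.length + 4) * (4 + 3 * k) + (n + m) * 3) := by
      split_ifs
      · rw [size_toCircuit, List.length_append]
        have h1 : (affineBlock (padEntries n m base B st.next st.used src)).length ≤
            (n + m) * 3 := by
          refine (length_affineBlock_le (c := 2) fun e he => ?_).trans ?_
          · simp only [padEntries, List.mem_append, List.mem_ofFn] at he
            rcases he with ⟨i, rfl⟩ | ⟨i, rfl⟩
            · simp
            · simp only [List.length_cons, List.length_map]
              cases src[(i : ℕ)]? <;> simp
          · simp [padEntries]
        have h2 := length_copyBlock_le (dst.map (advReg B)) (auxBlock B st.next (n + m))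
        rw [List.length_map] at h2
        have h3 : 4 * 4 ≤ (st.log.length + 4) * (4 + 3 * k) := Nat.mul_le_mul (by omega) (by omega)
        nlinarith
      · simp [Circuit.size]
    cases o with
    | hash =>
      simp only [simGate, size_append, size_toCircuit, size_coinBlock, Gate.cost,
        List.length_append, length_auxBlock]
      have h1 := length_copyBlock_le (auxBlock B st.next src.length) (src.map (advReg B))
      have h2 := length_copyBlock_le (dst.map (advReg B)) (auxBlock B (st.next + src.length) k)
      have h3 := length_lookupOps_le (B := B) k (auxBlock B st.next src.length)
        (auxBlock B (st.next + src.length) k) st.log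
      simp only [length_auxBlock, List.length_map] at h1 h2 h3
      have h4 : 1 + 4 * src.length + 3 * k ≤ (1 + src.length + dst.length) * (4 + 3 * k) := by
        nlinarith
      have h5 := Nat.mul_le_mul_left st.log.length h4
      nlinarith
    | enc => exact hpad
    | rnd => exact hpad

theorem size_simCircuit_le (st : SimState) (C : Circuit GameOracle) :
    (simCircuit n k m base Q B st C).size ≤
      C.size * ((st.log.length + C.length + 4) * (4 + 3 * k) + (n + m) * 3) := by
  induction C generalizing st with
  | nil => simp [simCircuit, Circuit.size]
  | cons G C ih =>
    rw [simCircuit, size_append, size_cons, add_mul]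
    refine add_le_add ((size_simGate_le st G).trans ?_) ((ih _).trans ?_)
    · gcongr
      omega
    · have := length_log_step (n := n) (k := k) (m := m) st G
      have h : (st.step n k m G).log.length + C.length + 4 ≤
          st.log.length + (G :: C).length + 4 := by rw [List.length_cons]; omega
      gcongr

theorem length_le_size {ι : Type} (C : Circuit ι) : C.length ≤ C.size := by
  induction C with
  | nil => simp
  | cons G C ih =>
    have : 1 ≤ G.cost := by
      cases G with
      | query o src dst => simp only [Gate.cost]; omega
      | _ => simp [Gate.cost]
    rw [size_cons, List.length_cons]
    omega

theorem size_simCircuit_init_le (C : Circuit GameOracle) :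
    (simCircuit n k m base Q B SimState.init C).size ≤
      C.size * ((C.size + 4) * (4 + 3 * k) + (n + m) * 3) := by
  refine (size_simCircuit_le _ C).trans ?_
  have := length_le_size C
  simp only [SimState.init, List.length_nil, zero_add]
  gcongr

end Simulation

/-! ### Expectations -/

/-- The expectation of a function with values in `[0, ∞]`. -/
def expect {α : Type} (p : PMF α) (f : α → ℝ≥0∞) : ℝ≥0∞ := ∑' a, p a * f a

section Expect

variable {α β : Type} {p : PMF α} {f g : α → ℝ≥0∞}

theorem expect_mono (h : ∀ a ∈ p.support, f a ≤ g a) : expect p f ≤ expect p g := by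
  refine ENNReal.tsum_le_tsum fun a => ?_
  by_cases ha : a ∈ p.support
  · gcongr; exact h a ha
  · simp [(PMF.apply_eq_zero_iff _ _).2 ha]

theorem expect_add : expect p (fun a => f a + g a) = expect p f + expect p g := by
  simp only [expect, mul_add, ENNReal.tsum_add]

theorem expect_const (p : PMF α) (c : ℝ≥0∞) : expect p (fun _ => c) = c := by
  rw [expect, ENNReal.tsum_mul_right, PMF.tsum_coe, one_mul]

theorem expect_pure (a : α) (f : α → ℝ≥0∞) : expect (PMF.pure a) f = f a := by
  classical
  rw [expect, tsum_eq_single a]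
  · simp
  · intro b hb
    simp [PMF.pure_apply, hb]

theorem expect_bind (p : PMF α) (q : α → PMF β) (f : β → ℝ≥0∞) :
    expect (p.bind q) f = expect p fun a => expect (q a) f := by
  simp only [expect, PMF.bind_apply, ← ENNReal.tsum_mul_right, ← ENNReal.tsum_mul_left]
  rw [ENNReal.tsum_comm]
  simp only [mul_assoc]

theorem expect_map (p : PMF α) (h : α → β) (f : β → ℝ≥0∞) :
    expect (p.map h) f = expect p fun a => f (h a) := by
  rw [PMF.map, expect_bind]
  simp only [Function.comp_apply, expect_pure]

theorem expect_comm (p : PMF α) (q : PMF β) (f : α → β → ℝ≥0∞) :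
    expect p (fun a => expect q (f a)) = expect q fun b => expect p fun a => f a b := by
  simp only [expect, ← ENNReal.tsum_mul_left]
  rw [ENNReal.tsum_comm]
  refine tsum_congr fun b => tsum_congr fun a => ?_
  ring

theorem bind_apply_eq_expect (p : PMF α) (q : α → PMF β) (b : β) :
    (p.bind q) b = expect p fun a => q a b := rfl

theorem map_apply_eq_expect [DecidableEq β] (p : PMF α) (h : α → β) (b : β) :
    (p.map h) b = expect p fun a => if h a = b then 1 else 0 := by
  rw [PMF.map, bind_apply_eq_expect]
  refine congrArg (expect p) (funext fun a => ?_)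
  rw [Function.comp_apply, PMF.pure_apply]
  by_cases h' : h a = b
  · rw [if_pos h', if_pos h'.symm]
  · rw [if_neg h', if_neg (Ne.symm h')]

theorem expect_eq_zero (h : ∀ a ∈ p.support, f a = 0) : expect p f = 0 := by
  rw [← expect_const p 0]
  exact le_antisymm (expect_mono fun a ha => (h a ha).le) (by simp [expect])

theorem expect_unif [Fintype α] [Nonempty α] (f : α → ℝ≥0∞) :
    expect (unif α) f = (Fintype.card α : ℝ≥0∞)⁻¹ * ∑ a, f a := by
  rw [expect, tsum_fintype, Finset.mul_sum]
  simp only [unif_apply]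

end Expect

/-- One-sided bounds at both bits suffice: an excess at `1` is a deficit at `0`, because both masses
sum to one. Hence the bad-event argument need only be run in one direction. -/
theorem close_of_le {P P' : PMF Bit} {ε : ℝ≥0∞} (h : ∀ b, P b ≤ P' b + ε) :
    Close ε (P 1) (P' 1) := by
  have hsum : ∀ R : PMF Bit, R 0 + R 1 = 1 := fun R => by
    rw [← R.tsum_coe, tsum_fintype]
    exact (Fin.sum_univ_two R).symm
  refine ⟨h 1, ?_⟩
  have h1 : P' 0 + P' 1 ≤ P' 0 + (P 1 + ε) := by
    rw [hsum, ← hsum P]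
    calc P 0 + P 1 ≤ P' 0 + ε + P 1 := by gcongr; exact h 0
      _ = _ := by ring
  exact (ENNReal.add_le_add_iff_left (P'.apply_ne_top 0)).1 h1

/-! ### The attack as the execution of a single circuit -/

section Game

variable {n k m : ℕ} (η : unitInterval) (PRNG : Bits k → Bits m) (G : Matrix (Fin n) (Fin k) Bit)
  (sk : Bits k)

/-- The oracles of the attack, with an additional oracle for random strings. -/
def gameOracles : Oracles GameOracle (HashTable k)
  | .hash, x, τ => (randomOracle k x τ).map fun y => (List.ofFn y.1, y.2)
  | .enc, x, τ => encrypt η PRNG G sk (toBlock m x) τ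
  | .rnd, _, τ => (unif (Bits (n + m))).map fun u => (List.ofFn u, τ)

/-- The oracles of the attacker among the oracles of the game. -/
def CPAOracle.toGame : CPAOracle → GameOracle
  | .hash => .hash
  | .enc => .enc

/-- The circuit that plays the attack with challenge bit `b`. -/
def gameCircuit (A : CPAAdversary) (b : Bool) : Circuit GameOracle :=
  A.learn.map (Gate.rename CPAOracle.toGame) ++
    .query (if b then .rnd else .enc) A.plain A.recv :: A.guess.map (Gate.rename CPAOracle.toGame)

theorem size_gameCircuit (A : CPAAdversary) (b : Bool) : (gameCircuit A b).size = A.time + 1 := by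
  simp only [gameCircuit, size_append, size_cons, size_rename, Gate.cost, CPAAdversary.time]
  omega

/-- The challenge becomes an oracle gate, so the two games run circuits that differ in a single
gate. -/
theorem cpaGame_eq (t r : ℕ) (A : CPAAdversary) (b : Bool) :
    cpaGame n k t r η PRNG A b =
      (keyGen n k t r).bind fun key => (unif (Bits k)).bind fun sk =>
        (Circuit.run (gameOracles η PRNG key.2 sk) (gameCircuit A b)
          (fun _ => 0, fun _ => none)).map fun z => z.1 A.out := by
  have hO : ∀ (G : Matrix (Fin n) (Fin k) Bit) sk,
      (fun o => gameOracles η PRNG G sk (CPAOracle.toGame o)) = cpaOracles η PRNG G sk := by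
    intro G sk
    funext o
    cases o <;> rfl
  unfold cpaGame
  congr 1; funext key
  congr 1; funext sk
  rw [gameCircuit, run_append, run_rename, hO, PMF.map_bind]
  congr 1; funext x
  rw [run_cons, run_rename, hO, PMF.map_bind, Gate.exec, PMF.bind_map]
  cases b <;> rfl

/-- What an encryption draws: either a seed, the noise and a fresh hash value, or a random pad. -/
abbrev Entry (n k m : ℕ) : Type := (Bits k × Bits n × Bits k) ⊕ (Bits n × Bits m)

/-- Encrypt with the next entry. -/
def popEntry (x : List Bit) :
    HashTable k × List (Entry n k m) → List Bit × (HashTable k × List (Entry n k m))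
  | (τ, []) => ([], (τ, []))
  | (τ, .inl (s, e, h) :: ℓ) =>
      (List.ofFn (G *ᵥ s + e) ++
        List.ofFn (PRNG ((τ (List.ofFn s ++ List.ofFn sk)).getD h) + toBlock m x),
        (Function.update τ (List.ofFn s ++ List.ofFn sk)
          (some ((τ (List.ofFn s ++ List.ofFn sk)).getD h)), ℓ))
  | (τ, .inr p :: ℓ) => (List.ofFn p.1 ++ List.ofFn (p.2 + toBlock m x), (τ, ℓ))

/-- The oracles of the game when the randomness of the encryptions is drawn in advance. -/
def eagerOracles : Oracles GameOracle (HashTable k × List (Entry n k m))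
  | .hash, x, s => (randomOracle k x s.1).map fun y => (List.ofFn y.1, (y.2, s.2))
  | .enc, x, s => PMF.pure (popEntry PRNG G sk x s)
  | .rnd, x, s => PMF.pure (popEntry PRNG G sk x s)

/-- Which of the encryptions of a circuit are proper encryptions. -/
def encKinds : Circuit GameOracle → List Bool
  | [] => []
  | .query .enc _ _ :: C => true :: encKinds C
  | .query .rnd _ _ :: C => false :: encKinds C
  | _ :: C => encKinds C

theorem length_encKinds_le (C : Circuit GameOracle) : (encKinds C).length ≤ C.length := by
  induction C with
  | nil => simp [encKinds]
  | cons G C ih =>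
    rcases G with _ | _ | _ | _ | ⟨_ | _ | _, src, dst⟩ <;> simp only [encKinds, List.length_cons] <;>
      omega

/-- The distribution of the randomness of an encryption. -/
def entryDist (n k m : ℕ) (η : unitInterval) : Bool → PMF (Entry n k m)
  | true => (unif (Bits k)).bind fun s => (noise n η).bind fun e => (unif (Bits k)).bind fun h =>
      PMF.pure (.inl (s, e, h))
  | false => (unif (Bits n)).bind fun c => (unif (Bits m)).bind fun y => PMF.pure (.inr (c, y))

/-- Each encryption consumes exactly one entry and `encKinds` lists the kinds in order, so drawing
an entry early commutes with everything before its use. -/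
theorem eager_eq_lazy (C : Circuit GameOracle) (ρ : Registers) (τ : HashTable k) :
    ((seqSample ((encKinds C).map (entryDist n k m η))).bind fun ℓ =>
      (Circuit.run (eagerOracles PRNG G sk) C (ρ, (τ, ℓ))).map Prod.fst) =
    (Circuit.run (gameOracles η PRNG G sk) C (ρ, τ)).map Prod.fst := by
  induction C generalizing ρ τ with
  | nil => simp [encKinds, seqSample, run_nil, PMF.pure_map]
  | cons g C ih =>
    -- Gates that consume no entry commute with the sampling of the whole list.
    have easy : (encKinds (g :: C) = encKinds C) →
        (∀ ℓ, g.exec (eagerOracles PRNG G sk) (ρ, (τ, ℓ)) =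
          (g.exec (gameOracles η PRNG G sk) (ρ, τ)).bind fun y => PMF.pure (y.1, (y.2, ℓ))) →
        ((seqSample ((encKinds (g :: C)).map (entryDist n k m η))).bind fun ℓ =>
          (Circuit.run (eagerOracles PRNG G sk) (g :: C) (ρ, (τ, ℓ))).map Prod.fst) =
        (Circuit.run (gameOracles η PRNG G sk) (g :: C) (ρ, τ)).map Prod.fst := by
      intro h1 h2
      simp only [h1, run_cons, h2, PMF.bind_bind, PMF.pure_bind, PMF.map_bind]
      rw [PMF.bind_comm]
      congr 1
      funext y
      exact ih y.1 y.2
    -- Gates that consume an entry absorb the head of the list; only the tail has to be moved past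
    -- them.
    have hard : ∀ b, (encKinds (g :: C) = b :: encKinds C) →
        (((entryDist n k m η b).bind fun a => (seqSample ((encKinds C).map
            (entryDist n k m η))).bind fun ℓ =>
            (g.exec (eagerOracles PRNG G sk) (ρ, (τ, a :: ℓ))).bind
              fun y => (Circuit.run (eagerOracles PRNG G sk) C y).map Prod.fst) =
          (g.exec (gameOracles η PRNG G sk) (ρ, τ)).bind fun y =>
            (seqSample ((encKinds C).map (entryDist n k m η))).bind fun ℓ =>
              (Circuit.run (eagerOracles PRNG G sk) C (y.1, (y.2, ℓ))).map Prod.fst) →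
        ((seqSample ((encKinds (g :: C)).map (entryDist n k m η))).bind fun ℓ =>
          (Circuit.run (eagerOracles PRNG G sk) (g :: C) (ρ, (τ, ℓ))).map Prod.fst) =
        (Circuit.run (gameOracles η PRNG G sk) (g :: C) (ρ, τ)).map Prod.fst := by
      intro b h1 h2
      simp only [h1, List.map_cons, seqSample, PMF.bind_bind, PMF.pure_bind, run_cons,
        PMF.map_bind]
      rw [h2]
      congr 1
      funext y
      exact ih y.1 y.2
    cases g with
    | const d b => exact easy rfl fun ℓ => by simp [Gate.exec]
    | coin d => exact easy rfl fun ℓ => by simp [Gate.exec, PMF.map, Function.comp_def]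
    | xor d a b => exact easy rfl fun ℓ => by simp [Gate.exec]
    | and d a b => exact easy rfl fun ℓ => by simp [Gate.exec]
    | query o src dst =>
      cases o with
      | hash =>
        exact easy rfl fun ℓ => by
          simp [Gate.exec, PMF.map, Function.comp_def, eagerOracles, gameOracles]
      | enc =>
        refine hard true rfl ?_
        simp only [Gate.exec, eagerOracles, gameOracles, encrypt, entryDist, randomOracle_eq_bind,
          PMF.pure_map, PMF.pure_bind, PMF.bind_bind, PMF.map_bind, popEntry]
      | rnd =>
        refine hard false rfl ?_
        simp only [Gate.exec, eagerOracles, gameOracles, entryDist, unif_append,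
          PMF.pure_map, PMF.pure_bind, PMF.bind_bind, PMF.map_bind, popEntry]
        congr 1
        funext c
        -- A random answer is stored as a pad that is later XORed with the plaintext; shifting the
        -- uniform second half by the plaintext undoes this.
        refine (unif_bind_add (-toBlock m (src.map ρ)) _).symm.trans ?_
        simp [List.ofFn_fin_append]

/-! ### Identical until bad: the key is queried or a seed repeats. -/

/-- The pad that corresponds to an entry. -/
def Entry.toPad : Entry n k m → Bits n × Bits m
  | .inl (s, e, h) => (G *ᵥ s + e, PRNG h)
  | .inr p => p

/-- The seeds of the entries. -/
def seedsOf : List (Entry n k m) → List (Bits k)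
  | [] => []
  | .inl (s, _, _) :: ℓ => s :: seedsOf ℓ
  | .inr _ :: ℓ => seedsOf ℓ

/-- The hash function has been evaluated on a string that contains the key. -/
def KeyQueried (sk : Bits k) (τ : HashTable k) : Prop :=
  ∃ s : Bits k, τ (List.ofFn s ++ List.ofFn sk) ≠ none

theorem ofFn_append_inj {s s' sk sk' : Bits k}
    (h : List.ofFn s ++ List.ofFn sk = List.ofFn s' ++ List.ofFn sk') : s = s' ∧ sk = sk' := by
  have := List.append_inj h (by simp)
  exact ⟨List.ofFn_injective this.1, List.ofFn_injective this.2⟩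

theorem keyQueried_update {τ : HashTable k} {x : List Bit} {y : Bits k}
    (h : KeyQueried sk τ) : KeyQueried sk (Function.update τ x (some y)) := by
  obtain ⟨s, hs⟩ := h
  refine ⟨s, ?_⟩
  by_cases hx : List.ofFn s ++ List.ofFn sk = x
  · simp [hx]
  · rwa [Function.update_of_ne hx]

open Classical in
/-- The probability that a random key has been queried. -/
def keyRisk (τ : HashTable k) : ℝ≥0∞ :=
  expect (unif (Bits k)) fun sk => if KeyQueried sk τ then 1 else 0

theorem keyRisk_empty : keyRisk (k := k) (fun _ => none) = 0 :=
  expect_eq_zero fun sk _ => by simp [KeyQueried]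

theorem card_bits (k : ℕ) : Fintype.card (Bits k) = 2 ^ k := by simp [ZMod.card]

/-- A string splits in at most one way into a seed and a key of `k` bits each, so one new table
entry exposes at most one of the `2 ^ k` keys. -/
theorem keyRisk_update_le (τ : HashTable k) (x : List Bit) (y : Bits k) :
    keyRisk (Function.update τ x (some y)) ≤ keyRisk τ + (2 ^ k)⁻¹ := by
  classical
  have h1 : ∀ sk : Bits k, (if KeyQueried sk (Function.update τ x (some y)) then 1 else 0 : ℝ≥0∞) ≤
      (if KeyQueried sk τ then 1 else 0) +
        if ∃ s : Bits k, List.ofFn s ++ List.ofFn sk = x then 1 else 0 := by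
    intro sk
    by_cases h : KeyQueried sk (Function.update τ x (some y))
    · have h' := h
      obtain ⟨s, hs⟩ := h'
      by_cases hx : List.ofFn s ++ List.ofFn sk = x
      · rw [if_pos h, if_pos (⟨s, hx⟩ : ∃ s : Bits k, List.ofFn s ++ List.ofFn sk = x)]
        exact le_add_self
      · rw [Function.update_of_ne hx] at hs
        have hq : KeyQueried sk τ := ⟨s, hs⟩
        rw [if_pos hq]
        refine le_trans ?_ le_self_add
        simp [h]
    · rw [if_neg h]; exact zero_le
  refine (expect_mono fun sk _ => h1 sk).trans ?_
  rw [expect_add]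
  refine add_le_add le_rfl ?_
  rw [expect_unif, card_bits]
  push_cast
  refine mul_le_of_le_one_right' ?_
  rw [Finset.sum_boole]
  have : (Finset.univ.filter fun sk : Bits k => ∃ s : Bits k,
      List.ofFn s ++ List.ofFn sk = x).card ≤ 1 := by
    rw [Finset.card_le_one]
    intro a ha b hb
    obtain ⟨s, hs⟩ := (Finset.mem_filter.1 ha).2
    obtain ⟨s', hs'⟩ := (Finset.mem_filter.1 hb).2
    exact (ofFn_append_inj (hs.trans hs'.symm)).2
  exact_mod_cast this

/-- With prepared pads only a hash query can touch the table, and it sets one value; a property of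
the state need only be checked for these two kinds of successors. -/
theorem exec_padOracles_cases {P : Registers × (HashTable k × List (Bits n × Bits m)) → Prop}
    {ρ : Registers} {τ : HashTable k} {ℓ : List (Bits n × Bits m)} {g : Gate GameOracle}
    (h1 : ∀ ρ' ℓ', P (ρ', (τ, ℓ'))) (h2 : ∀ x y ρ' ℓ', P (ρ', (Function.update τ x (some y), ℓ')))
    {z : Registers × (HashTable k × List (Bits n × Bits m))}
    (hz : z ∈ (g.exec (padOracles n k m) (ρ, (τ, ℓ))).support) : P z := by
  have hpop : ∀ x, (popPad x (τ, ℓ)).2.1 = τ := fun x => by cases ℓ <;> rfl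
  have hP : ∀ ρ' (s : HashTable k × List (Bits n × Bits m)), s.1 = τ → P (ρ', s) := by
    rintro ρ' ⟨τ', ℓ'⟩ rfl
    exact h1 _ _
  cases g with
  | const d b => simp [Gate.exec] at hz; exact hz ▸ h1 _ _
  | coin d =>
    simp only [Gate.exec, PMF.mem_support_map_iff] at hz
    obtain ⟨b, -, rfl⟩ := hz
    exact h1 _ _
  | xor d a b => simp [Gate.exec] at hz; exact hz ▸ h1 _ _
  | and d a b => simp [Gate.exec] at hz; exact hz ▸ h1 _ _
  | query o src dst =>
    cases o with
    | hash =>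
      simp only [Gate.exec, padOracles, randomOracle_eq_bind, PMF.map_bind, PMF.pure_map,
        PMF.mem_support_bind_iff, PMF.mem_support_pure_iff] at hz
      obtain ⟨v, -, rfl⟩ := hz
      exact h2 _ _ _ _
    | enc =>
      simp only [Gate.exec, padOracles, PMF.pure_map, PMF.mem_support_pure_iff] at hz
      subst hz
      exact hP _ _ (hpop _)
    | rnd =>
      simp only [Gate.exec, padOracles, PMF.pure_map, PMF.mem_support_pure_iff] at hz
      subst hz
      exact hP _ _ (hpop _)

/-- The run does not mention the key, so the key can be thought of as drawn after the run, and every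
gate raises the risk by at most `2 ^ (-k)`. -/
theorem expect_keyRisk_le (C : Circuit GameOracle) (ρ : Registers) (τ : HashTable k)
    (ℓ : List (Bits n × Bits m)) :
    expect (Circuit.run (padOracles n k m) C (ρ, (τ, ℓ))) (fun z => keyRisk z.2.1) ≤
      keyRisk τ + C.length * (2 ^ k)⁻¹ := by
  induction C generalizing ρ τ ℓ with
  | nil => simp [run_nil, expect_pure]
  | cons g C ih =>
    rw [run_cons, expect_bind]
    refine (expect_mono (g := fun _ => keyRisk τ + (g :: C).length * (2 ^ k)⁻¹) fun z hz => ?_).trans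
      (expect_const _ _).le
    have hle : ∀ (ρ' : Registers) (τ' : HashTable k) (ℓ' : List (Bits n × Bits m)),
        keyRisk τ' ≤ keyRisk τ + (2 ^ k)⁻¹ →
        expect (Circuit.run (padOracles n k m) C (ρ', (τ', ℓ'))) (fun z => keyRisk z.2.1) ≤
          keyRisk τ + (g :: C).length * (2 ^ k)⁻¹ := by
      intro ρ' τ' ℓ' h
      refine (ih ρ' τ' ℓ').trans ((add_le_add_left h _).trans (le_of_eq ?_))
      rw [List.length_cons]
      push_cast
      ring
    exact exec_padOracles_cases (P := fun z =>
      expect (Circuit.run (padOracles n k m) C z) (fun z => keyRisk z.2.1) ≤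
          keyRisk τ + (g :: C).length * (2 ^ k)⁻¹)
      (fun ρ' ℓ' => hle _ _ _ le_self_add)
      (fun x y ρ' ℓ' => hle _ _ _ (keyRisk_update_le _ _ _)) hz

theorem keyQueried_of_mem_support {C : Circuit GameOracle} {ρ : Registers} {τ : HashTable k}
    {ℓ : List (Bits n × Bits m)} (h : KeyQueried sk τ)
    {z : Registers × (HashTable k × List (Bits n × Bits m))}
    (hz : z ∈ (Circuit.run (padOracles n k m) C (ρ, (τ, ℓ))).support) : KeyQueried sk z.2.1 := by
  induction C generalizing ρ τ ℓ with
  | nil =>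
    simp only [run_nil, PMF.mem_support_pure_iff] at hz
    exact hz ▸ h
  | cons g C ih =>
    rw [run_cons, PMF.mem_support_bind_iff] at hz
    obtain ⟨y, hy, hz⟩ := hz
    have : KeyQueried sk y.2.1 := exec_padOracles_cases (P := fun y => KeyQueried sk y.2.1)
      (fun _ _ => h) (fun _ _ _ _ => keyQueried_update _ h) hy
    exact ih this hz

open Classical in
/-- As long as the key has not been queried and the seeds are distinct, the hash values used for
encryption are fresh. -/
theorem expect_pad_le_expect_eager (C : Circuit GameOracle) (f : Registers → ℝ≥0∞)
    (ρ : Registers) (τ τ' : HashTable k) (ℓ : List (Entry n k m))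
    (hτ : ∀ x, (∀ s : Bits k, x ≠ List.ofFn s ++ List.ofFn sk) → τ' x = τ x)
    (hfresh : ∀ s ∈ seedsOf ℓ, τ' (List.ofFn s ++ List.ofFn sk) = none)
    (hnd : (seedsOf ℓ).Nodup) :
    expect (Circuit.run (padOracles n k m) C (ρ, (τ, ℓ.map (Entry.toPad PRNG G))))
        (fun z => if KeyQueried sk z.2.1 then 0 else f z.1) ≤
      expect (Circuit.run (eagerOracles PRNG G sk) C (ρ, (τ', ℓ))) (fun z => f z.1) := by
  induction C generalizing ρ τ τ' ℓ with
  | nil =>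
    simp only [run_nil, expect_pure]
    split_ifs <;> simp
  | cons g C ih =>
    have pop : ∀ src dst : List ℕ,
        expect (Circuit.run (padOracles n k m) C
          (writeBits dst (popPad (src.map ρ) (τ, ℓ.map (Entry.toPad PRNG G))).1 ρ,
            (popPad (src.map ρ) (τ, ℓ.map (Entry.toPad PRNG G))).2))
          (fun z => if KeyQueried sk z.2.1 then 0 else f z.1) ≤
        expect (Circuit.run (eagerOracles PRNG G sk) C
          (writeBits dst (popEntry PRNG G sk (src.map ρ) (τ', ℓ)).1 ρ,
            (popEntry PRNG G sk (src.map ρ) (τ', ℓ)).2)) (fun z => f z.1) := by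
      intro src dst
      rcases ℓ with _ | ⟨⟨s, e, h⟩ | p, ℓ⟩
      · exact ih _ _ _ _ hτ hfresh hnd
      · simp only [seedsOf, List.nodup_cons, List.mem_cons, forall_eq_or_imp] at hfresh hnd
        -- The table of the eager game has no value at this seed, so encryption uses the value `h`
        -- drawn in advance, which is what the pad contains.
        simp only [List.map_cons, popPad, popEntry, Entry.toPad, hfresh.1, Option.getD_none]
        refine ih _ _ _ _ (fun x hx => ?_) (fun s' hs' => ?_) hnd.2
        · rw [Function.update_of_ne (hx s), hτ x hx]
        · rw [Function.update_of_ne, hfresh.2 s' hs']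
          intro heq
          exact hnd.1 ((ofFn_append_inj heq).1 ▸ hs')
      · exact ih _ _ _ _ hτ hfresh hnd
    rw [run_cons, run_cons, expect_bind, expect_bind]
    cases g with
    | const d b => simpa only [Gate.exec, expect_pure] using ih _ _ _ _ hτ hfresh hnd
    | coin d =>
      simp only [Gate.exec, expect_map]
      exact expect_mono fun b _ => ih _ _ _ _ hτ hfresh hnd
    | xor d a b => simpa only [Gate.exec, expect_pure] using ih _ _ _ _ hτ hfresh hnd
    | and d a b => simpa only [Gate.exec, expect_pure] using ih _ _ _ _ hτ hfresh hnd
    | query o src dst =>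
      cases o with
      | hash =>
        simp only [Gate.exec, padOracles, eagerOracles, randomOracle_eq_bind, PMF.map_bind,
          PMF.pure_map, expect_bind, expect_pure]
        refine expect_mono fun v _ => ?_
        -- A hash query that ends in the key makes the left side vanish for good, since the event
        -- persists. Any other query sees the same value in both tables.
        by_cases hx : ∃ s : Bits k, src.map ρ = List.ofFn s ++ List.ofFn sk
        · obtain ⟨s, hs⟩ := hx
          refine le_of_eq_of_le (expect_eq_zero fun z hz => if_pos ?_) zero_le
          refine keyQueried_of_mem_support sk (C := C) ⟨s, ?_⟩ hz
          rw [hs, Function.update_self]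
          simp
        · have hx' : ∀ s : Bits k, src.map ρ ≠ List.ofFn s ++ List.ofFn sk :=
            fun s hs => hx ⟨s, hs⟩
          rw [hτ _ hx']
          refine ih _ _ _ _ (fun x hx'' => ?_) (fun s hs => ?_) hnd
          · by_cases hxx : x = src.map ρ
            · simp [hxx]
            · rw [Function.update_of_ne hxx, Function.update_of_ne hxx, hτ x hx'']
          · rw [Function.update_of_ne (Ne.symm (hx' s)), hfresh s hs]
      | enc => simpa only [Gate.exec, padOracles, eagerOracles, PMF.pure_map, expect_pure]
          using (pop src dst)
      | rnd => simpa only [Gate.exec, padOracles, eagerOracles, PMF.pure_map, expect_pure]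
          using (pop src dst)

/-- The output of a circuit that encrypts with the given pads. -/
def padRun (n k m : ℕ) (C : Circuit GameOracle) (out : ℕ) (ℓ : List (Bits n × Bits m)) : PMF Bit :=
  (Circuit.run (padOracles n k m) C (fun _ => 0, (fun _ => none, ℓ))).map fun z => z.1 out

/-- The indicator of the output is at most its restriction to runs in which the key is not queried,
plus the indicator that it is. The first term is compared with the eager game, the second is the key
risk. -/
theorem padRun_apply_le (C : Circuit GameOracle) (out : ℕ) {ℓ : List (Entry n k m)}
    (hnd : (seedsOf ℓ).Nodup) (b : Bit) :
    padRun n k m C out (ℓ.map (Entry.toPad PRNG G)) b ≤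
      ((unif (Bits k)).bind fun sk =>
        (Circuit.run (eagerOracles PRNG G sk) C (fun _ => 0, (fun _ => none, ℓ))).map
          fun z => z.1 out) b + C.length * (2 ^ k)⁻¹ := by
  classical
  obtain ⟨f, hf⟩ : ∃ f : Registers → ℝ≥0∞, f = fun ρ => if ρ out = b then 1 else 0 := ⟨_, rfl⟩
  have hf1 : ∀ ρ, f ρ ≤ 1 := fun ρ => by rw [hf]; dsimp only; split_ifs <;> simp
  rw [bind_apply_eq_expect, padRun]
  simp only [map_apply_eq_expect]
  obtain ⟨R, hR⟩ : ∃ R, R = Circuit.run (padOracles n k m) C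
    (fun _ => 0, (fun _ => none, ℓ.map (Entry.toPad PRNG G))) := ⟨_, rfl⟩
  rw [← hR]
  calc expect R (fun z => if z.1 out = b then 1 else 0)
      = expect (unif (Bits k)) fun _ => expect R fun z => f z.1 := by
        rw [expect_const, hf]
    _ ≤ expect (unif (Bits k)) fun sk => (expect R (fun z => if KeyQueried sk z.2.1 then 0 else f z.1))
          + expect R fun z => if KeyQueried sk z.2.1 then 1 else 0 := by
        refine expect_mono fun sk _ => ?_
        rw [← expect_add]
        refine expect_mono fun z _ => ?_
        split_ifs
        · rw [zero_add]; exact hf1 _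
        · rw [add_zero]
    _ ≤ _ := by
        rw [expect_add]
        refine add_le_add (expect_mono fun sk _ => ?_) ?_
        · rw [hR]
          refine (expect_pad_le_expect_eager PRNG G sk C f _ _ _ ℓ (fun _ _ => rfl)
            (fun _ _ => rfl) hnd).trans ?_
          rw [hf]
        -- Drawing the key last turns the probability of the bad event into the expected `keyRisk`.
        · rw [expect_comm]
          have := expect_keyRisk_le (k := k) C (fun _ => 0) (fun _ => none) (ℓ.map (Entry.toPad PRNG G))
          rw [keyRisk_empty, zero_add, ← hR] at this
          exact this

open Classical in
-- Union bound: each entry contributes at most one uniform seed.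
theorem expect_mem_seedsOf_le (s : Bits k) (kinds : List Bool) :
    expect (seqSample (kinds.map (entryDist n k m η))) (fun ℓ => if s ∈ seedsOf ℓ then 1 else 0) ≤
      kinds.length * (2 ^ k)⁻¹ := by
  induction kinds with
  | nil => simp [seqSample, expect_pure, seedsOf]
  | cons b kinds ih =>
    rw [List.map_cons, seqSample, expect_bind]
    simp only [expect_bind, expect_pure]
    cases b with
    | false =>
      simp only [entryDist, expect_bind, expect_pure, seedsOf]
      refine (expect_const _ _).le.trans ((expect_const _ _).le.trans (ih.trans ?_))
      gcongr
      simp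
    | true =>
      simp only [entryDist, expect_bind, expect_pure, seedsOf, expect_const, List.mem_cons]
      calc _ ≤ expect (unif (Bits k)) (fun s' => (if s = s' then 1 else 0) +
              kinds.length * (2 ^ k)⁻¹) := by
            refine expect_mono fun s' _ => ?_
            by_cases h : s = s'
            · simp only [h, true_or, if_true, expect_const]
              exact le_self_add
            · simpa only [h, false_or, if_false, zero_add] using ih
        _ = _ := by
            rw [expect_add, expect_const, expect_unif, card_bits]
            simp
            ring

open Classical in
-- Birthday bound, adding one seed at a time; `j * j + j ≤ (j + 1) * (j + 1)` closes the induction.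
theorem expect_not_nodup_seedsOf_le (kinds : List Bool) :
    expect (seqSample (kinds.map (entryDist n k m η)))
        (fun ℓ => if (seedsOf ℓ).Nodup then 0 else 1) ≤
      kinds.length * kinds.length * (2 ^ k)⁻¹ := by
  induction kinds with
  | nil => simp [seqSample, expect_pure, seedsOf]
  | cons b kinds ih =>
    rw [List.map_cons, seqSample, expect_bind]
    simp only [expect_bind, expect_pure]
    have hle : (kinds.length * kinds.length * (2 ^ k)⁻¹ + kinds.length * (2 ^ k)⁻¹ : ℝ≥0∞) ≤
        (b :: kinds).length * (b :: kinds).length * (2 ^ k)⁻¹ := by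
      rw [← add_mul]
      gcongr
      rw [List.length_cons]
      exact_mod_cast (by nlinarith : kinds.length * kinds.length + kinds.length ≤
        (kinds.length + 1) * (kinds.length + 1))
    cases b with
    | false =>
      simp only [entryDist, expect_bind, expect_pure, seedsOf]
      exact (expect_const _ _).le.trans ((expect_const _ _).le.trans
        (ih.trans (le_self_add.trans hle)))
    | true =>
      simp only [entryDist, expect_bind, expect_pure, seedsOf, expect_const, List.nodup_cons]
      refine le_trans (expect_mono (g := fun _ => kinds.length * kinds.length * (2 ^ k)⁻¹ +
        kinds.length * (2 ^ k)⁻¹) fun s _ => ?_) ((expect_const _ _).le.trans hle)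
      refine le_trans (expect_mono (g := fun ℓ => (if (seedsOf ℓ).Nodup then 0 else 1) +
        if s ∈ seedsOf ℓ then 1 else 0) fun ℓ _ => ?_) ?_
      · by_cases h1 : s ∈ seedsOf ℓ
        · simp [h1]
        · simp [h1]
      · rw [expect_add]
        exact add_le_add ih (expect_mem_seedsOf_le η s kinds)

/-- The hash values used for encryption may be replaced by independent random strings. -/
theorem close_game_padRun (C : Circuit GameOracle) (out : ℕ) :
    Close ((C.length + C.length * C.length) * (2 ^ k)⁻¹)
      (((unif (Bits k)).bind fun sk => (Circuit.run (gameOracles η PRNG G sk) C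
        (fun _ => 0, fun _ => none)).map fun z => z.1 out) 1)
      (((seqSample ((encKinds C).map (entryDist n k m η))).bind fun ℓ =>
        padRun n k m C out (ℓ.map (Entry.toPad PRNG G))) 1) := by
  classical
  refine Close.symm (close_of_le fun b => ?_)
  have hlazy : ((unif (Bits k)).bind fun sk => (Circuit.run (gameOracles η PRNG G sk) C
        (fun _ => 0, fun _ => none)).map fun z => z.1 out) =
      (seqSample ((encKinds C).map (entryDist n k m η))).bind fun ℓ => (unif (Bits k)).bind fun sk =>
        (Circuit.run (eagerOracles PRNG G sk) C (fun _ => 0, (fun _ => none, ℓ))).map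
          fun z => z.1 out := by
    rw [PMF.bind_comm]
    congr 1
    funext sk
    have h1 : ((fun z : Registers × HashTable k => z.1 out)) = (fun ρ : Registers => ρ out) ∘ Prod.fst :=
      rfl
    have h2 : ((fun z : Registers × (HashTable k × List (Entry n k m)) => z.1 out)) =
      (fun ρ : Registers => ρ out) ∘ Prod.fst := rfl
    rw [h1, h2]
    simp only [← PMF.map_comp]
    rw [← eager_eq_lazy, PMF.map_bind]
  rw [hlazy, bind_apply_eq_expect, bind_apply_eq_expect]
  -- When seeds collide the probability is simply bounded by one.
  refine (expect_mono (g := fun ℓ => (((unif (Bits k)).bind fun sk =>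
    (Circuit.run (eagerOracles PRNG G sk) C (fun _ => 0, (fun _ => none, ℓ))).map
      fun z => z.1 out) b + C.length * (2 ^ k)⁻¹) + if (seedsOf ℓ).Nodup then 0 else 1)
    fun ℓ _ => ?_).trans ?_
  · by_cases h : (seedsOf ℓ).Nodup
    · rw [if_pos h, add_zero]
      exact padRun_apply_le PRNG G C out h b
    · rw [if_neg h]
      exact (PMF.coe_le_one _ _).trans le_add_self
  · rw [expect_add, expect_add, expect_const, add_assoc, add_mul]
    gcongr
    refine (expect_not_nodup_seedsOf_le η _).trans ?_
    have := length_encKinds_le C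
    gcongr

end Game

/-! ### Distinguishers -/

/-- There are no oracles. -/
def noOracles : Oracles Empty Unit := fun o => o.elim

/-- The registers at the beginning of a distinguisher. -/
def inputRegs (x : List Bit) : Registers := fun i => x.getD i 0

/-- The answer of a distinguisher on an input. -/
def Distinguisher.answer (D : Distinguisher) (x : List Bit) : PMF Bit :=
  (Circuit.run noOracles D.circuit (inputRegs x, ())).map fun y => y.1 D.out

theorem Distinguisher.abs_accept_sub_le (D : Distinguisher) (X Y : PMF (List Bit)) :
    |D.accept X - D.accept Y| ≤ 1 := by
  have h : ∀ Z, 0 ≤ D.accept Z ∧ D.accept Z ≤ 1 := fun Z =>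
    ⟨ENNReal.toReal_nonneg, ENNReal.toReal_le_of_le_ofReal zero_le_one (by
      rw [ENNReal.ofReal_one]; exact PMF.coe_le_one _ _)⟩
  rw [abs_le]
  constructor <;> linarith [(h X).1, (h X).2, (h Y).1, (h Y).2]

theorem bddAbove_distInSec (T : ℕ) (X Y : PMF (List Bit)) :
    BddAbove (Set.range fun D : {D : Distinguisher // D.circuit.size ≤ T} =>
      |D.1.accept X - D.1.accept Y|) :=
  ⟨1, by rintro _ ⟨D, rfl⟩; exact D.1.abs_accept_sub_le X Y⟩

theorem distInSec_nonneg (T : ℕ) (X Y : PMF (List Bit)) : 0 ≤ distInSec T X Y :=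
  Real.iSup_nonneg fun _ => abs_nonneg _

theorem close_distInSec {T : ℕ} {X Y : PMF (List Bit)} (D : Distinguisher)
    (h : D.circuit.size ≤ T) :
    Close (ENNReal.ofReal (distInSec T X Y)) ((X.bind D.answer) 1) ((Y.bind D.answer) 1) :=
  close_of_abs_toReal_sub_le (PMF.apply_ne_top _ _) (PMF.apply_ne_top _ _)
    (le_ciSup (bddAbove_distInSec T X Y) ⟨D, h⟩)

/-! ### Reductions with affine preprocessing -/

section Reduction

variable {n k m : ℕ}

/-- Affine forms in the registers for the bits of a pad. -/
abbrev AffPad (n m : ℕ) : Type := (Fin n → Bit × List ℕ) × (Fin m → Bit × List ℕ)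

/-- The value of an affine form. -/
def affEval (ρ : Registers) (a : Bit × List ℕ) : Bit := a.1 + (a.2.map ρ).sum

/-- The value of a pad of affine forms. -/
def AffPad.eval (ρ : Registers) (p : AffPad n m) : Bits n × Bits m :=
  (fun i => affEval ρ (p.1 i), fun i => affEval ρ (p.2 i))

/-- The forms that occur in a pad. -/
def AffPad.forms (p : AffPad n m) : List (Bit × List ℕ) := List.ofFn p.1 ++ List.ofFn p.2

/-- A constant pad. -/
def AffPad.const (p : Bits n × Bits m) : AffPad n m := (fun i => (p.1 i, []), fun i => (p.2 i, []))

theorem AffPad.eval_const (ρ : Registers) (p : Bits n × Bits m) :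
    (AffPad.const p).eval ρ = p := by
  simp [AffPad.const, AffPad.eval, affEval]

theorem length_flatMap_forms (L : List (AffPad n m)) :
    (L.flatMap AffPad.forms).length = L.length * (n + m) := by
  induction L with
  | nil => simp
  | cons p L ih =>
    rw [List.flatMap_cons, List.length_append, ih, AffPad.forms]
    simp
    ring

theorem padsOf_eq_of_map_range' {base Q j : ℕ} {ρ : Registers} {L : List (Bits n × Bits m)}
    (hQ : j + L.length = Q)
    (h : (List.range' (base + j * (n + m)) (L.length * (n + m))).map ρ =
      L.flatMap fun p => List.ofFn p.1 ++ List.ofFn p.2) :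
    padsOf n m base Q ρ j = L := by
  induction L generalizing j with
  | nil =>
    simp only [List.length_nil, add_zero] at hQ
    simp [padsOf, hQ]
  | cons p L ih =>
    rw [List.length_cons] at hQ
    have hofFn : ∀ (s c : ℕ), (List.range' s c).map ρ = List.ofFn fun i : Fin c => ρ (s + i) := by
      intro s c
      rw [List.range'_eq_map_range, List.map_map, List.ofFn_eq_map, ← List.map_coe_finRange_eq_range,
        List.map_map]
      rfl
    rw [List.length_cons, List.flatMap_cons,
      show (L.length + 1) * (n + m) = n + (m + L.length * (n + m)) by ring,
      ← List.range'_append_1, ← List.range'_append_1, List.map_append, List.map_append,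
      List.append_assoc] at h
    obtain ⟨h1, h2⟩ := List.append_inj h (by simp)
    obtain ⟨h2, h3⟩ := List.append_inj h2 (by simp)
    rw [padsOf_eq_cons (by omega), ih (j := j + 1) (by omega)]
    · rw [hofFn] at h1 h2
      rw [List.ofFn_injective h1, List.ofFn_injective h2]
    · rw [← h3]
      congr 2
      ring

/-- Simulation of the offline game on pads that are computed from the input. -/
theorem exists_distinguisher (C : Circuit GameOracle) (out base c : ℕ) (P : List Op)
    (L : List (AffPad n m)) (hP : ∀ o ∈ P, o.dst < base)
    (hL : ∀ p ∈ L, ∀ a ∈ p.forms, a.2.length ≤ c ∧ ∀ r ∈ a.2, r < base) :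
    ∃ D : Distinguisher,
      D.circuit.size ≤ P.length + L.length * (n + m) * (1 + c) +
        C.size * ((C.size + 4) * (4 + 3 * k) + (n + m) * 3) ∧
      ∀ x : List Bit, x.length ≤ base → D.answer x =
        padRun n k m C out (L.map (AffPad.eval (evals P (inputRegs x)))) := by
  obtain ⟨B, hB⟩ : ∃ B, B = base + L.length * (n + m) := ⟨_, rfl⟩
  obtain ⟨E, hE⟩ : ∃ E : List (ℕ × Bit × List ℕ),
    E = (List.range' base (L.length * (n + m))).zip (L.flatMap AffPad.forms) := ⟨_, rfl⟩
  have hlen : (List.range' base (L.length * (n + m))).length = (L.flatMap AffPad.forms).length := by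
    rw [length_flatMap_forms, List.length_range']
  have hE1 : E.map Prod.fst = List.range' base (L.length * (n + m)) := by
    rw [hE, List.map_fst_zip hlen.le]
  have hE2 : E.map Prod.snd = L.flatMap AffPad.forms := by
    rw [hE, List.map_snd_zip hlen.ge]
  have hEforms : ∀ e ∈ E, e.2.2.length ≤ c ∧ ∀ r ∈ e.2.2, r < base := by
    intro e he
    have : e.2 ∈ L.flatMap AffPad.forms := hE2 ▸ List.mem_map_of_mem he
    obtain ⟨p, hp, ha⟩ := List.mem_flatMap.1 this
    exact hL p hp _ ha
  refine ⟨⟨toCircuit (P ++ affineBlock E) ++ simCircuit n k m base L.length B SimState.init C,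
    advReg B out⟩, ?_, fun x hx => ?_⟩
  · simp only [size_append, size_toCircuit, List.length_append]
    refine add_le_add (add_le_add le_rfl ?_) (size_simCircuit_init_le C)
    refine (length_affineBlock_le fun e he => (hEforms e he).1).trans ?_
    rw [hE, List.length_zip, ← hlen]
    simp
  · obtain ⟨ρ, hρ⟩ : ∃ ρ, ρ = evals P (inputRegs x) := ⟨_, rfl⟩
    have hev : evals (affineBlock E) ρ =
        writeBits (List.range' base (L.length * (n + m))) (E.map (affineValue ρ)) ρ := by
      rw [evals_affineBlock, hE1]
      intro e he e' he' h
      have h1 := (hEforms e' he').2 _ h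
      have h2 : e.1 ∈ List.range' base (L.length * (n + m)) := hE1 ▸ List.mem_map_of_mem he
      rw [List.mem_range'_1] at h2
      omega
    obtain ⟨ρ', hρ'⟩ : ∃ ρ', ρ' = evals (affineBlock E) ρ := ⟨_, rfl⟩
    -- The attacker must start from zero registers: those representing its registers lie beyond the
    -- input and beyond everything the preprocessing and the pads write.
    have hzero : (fun i => ρ' (advReg B i)) = fun _ => 0 := by
      funext i
      rw [hρ', hev, writeBits_of_notMem, hρ, evals_of_notMem, inputRegs, List.getD_eq_default]
      · simp only [advReg]; omega
      · intro o ho h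
        have := hP o ho
        simp only [advReg] at h
        omega
      · rw [List.mem_range'_1]
        simp only [advReg]
        omega
    have hpads : padsOf n m base L.length ρ' 0 = L.map (AffPad.eval ρ) := by
      refine padsOf_eq_of_map_range' (by simp) ?_
      rw [List.length_map, zero_mul, add_zero, hρ', hev, map_writeBits_self]
      · have : E.map (affineValue ρ) = (E.map Prod.snd).map (affEval ρ) := by
          rw [List.map_map]; rfl
        rw [this, hE2, List.map_flatMap, List.flatMap_map]
        simp [AffPad.forms, AffPad.eval, List.map_ofFn, Function.comp_def]
      · exact List.nodup_range'
      · rw [List.length_map, ← List.length_map (f := Prod.fst) (as := E), hE1]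
    have hsim := run_simCircuit (k := k) (n := n) (m := m) (base := base) (Q := L.length) (B := B)
      hB.ge SimState.wellFormed_init noOracles C ρ'
    rw [SimState.decode_init, hzero, hpads] at hsim
    rw [Distinguisher.answer, run_append, run_toCircuit, PMF.pure_bind, evals_append, ← hρ, ← hρ',
      padRun]
    have e1 : (fun y : Registers × Unit => y.1 (advReg B out)) =
      (fun ρ : Registers => ρ out) ∘ fun y : Registers × Unit => fun i => y.1 (advReg B i) := rfl
    have e2 : (fun z : Registers × (HashTable k × List (Bits n × Bits m)) => z.1 out) =
      (fun ρ : Registers => ρ out) ∘ Prod.fst := rfl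
    rw [e1, e2, ← PMF.map_comp, ← PMF.map_comp, hsim]

/-! ### Where the bits of an input sit in the registers. -/

theorem inputRegs_append_left {x y : List Bit} {i : ℕ} (h : i < x.length) :
    inputRegs (x ++ y) i = inputRegs x i := by
  simp only [inputRegs, List.getD_eq_getElem?_getD, List.getElem?_append_left h]

theorem inputRegs_append_right {x y : List Bit} (i : ℕ) :
    inputRegs (x ++ y) (x.length + i) = inputRegs y i := by
  simp only [inputRegs, List.getD_eq_getElem?_getD]
  rw [List.getElem?_append_right (Nat.le_add_right _ _), Nat.add_sub_cancel_left]

theorem inputRegs_ofFn {a : ℕ} (v : Bits a) (i : Fin a) : inputRegs (List.ofFn v) i = v i := by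
  simp [inputRegs]

theorem divNat_modNat_mul_add {a b : ℕ} (i : Fin a) (j : Fin b) (h : (i : ℕ) * b + j < a * b) :
    Fin.divNat (⟨i * b + j, h⟩ : Fin (a * b)) = i ∧
      Fin.modNat (⟨i * b + j, h⟩ : Fin (a * b)) = j := by
  have hb : 0 < b := j.pos
  constructor
  · apply Fin.ext
    simp only [Fin.divNat]
    rw [mul_comm, Nat.mul_add_div hb, Nat.div_eq_of_lt j.2, add_zero]
  · apply Fin.ext
    simp only [Fin.modNat]
    rw [mul_comm, Nat.mul_add_mod, Nat.mod_eq_of_lt j.2]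

theorem matrixBits_eq {a b : ℕ} (A : Matrix (Fin a) (Fin b) Bit) :
    matrixBits A = List.ofFn fun i : Fin (a * b) => A i.divNat i.modNat := by
  rw [List.ofFn_mul, matrixBits]
  refine congrArg List.flatten (congrArg List.ofFn (funext fun i => congrArg List.ofFn
    (funext fun j => ?_)))
  rw [(divNat_modNat_mul_add i j _).1, (divNat_modNat_mul_add i j _).2]

theorem length_matrixBits {a b : ℕ} (A : Matrix (Fin a) (Fin b) Bit) :
    (matrixBits A).length = a * b := by
  simp [matrixBits_eq]

theorem mul_add_lt {a b : ℕ} (i : Fin a) (j : Fin b) : (i : ℕ) * b + j < a * b :=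
  calc (i : ℕ) * b + j < (i + 1) * b := by rw [add_mul, one_mul]; omega
    _ ≤ a * b := Nat.mul_le_mul_right _ i.2

theorem inputRegs_matrixBits {a b : ℕ} (A : Matrix (Fin a) (Fin b) Bit) (i : Fin a) (j : Fin b) :
    inputRegs (matrixBits A) (i * b + j) = A i j := by
  have := inputRegs_ofFn (fun i : Fin (a * b) => A i.divNat i.modNat) ⟨i * b + j, mul_add_lt i j⟩
  rw [matrixBits_eq]
  refine this.trans ?_
  rw [(divNat_modNat_mul_add i j _).1, (divNat_modNat_mul_add i j _).2]

/-! ### Replacing the pads -/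

/-- A bound for the size of the reductions to the pseudorandom generator and to LPN. -/
def reductionSize (n k m s : ℕ) : ℕ :=
  s * (n + m) * (2 + k) + s * ((s + 4) * (4 + 3 * k) + (n + m) * 3)

theorem reduction_size_le {n k m s t q c : ℕ} (hq : q ≤ s) (ht : t ≤ s) (hc : c ≤ k + 1) :
    q * (n + m) * (1 + c) + t * ((t + 4) * (4 + 3 * k) + (n + m) * 3) ≤ reductionSize n k m s := by
  have : 1 + c ≤ 2 + k := by omega
  rw [reductionSize]
  gcongr

/-- The randomness of an encryption after the generator has been replaced: either a seed, the noise
and a random string or a random pad. -/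
abbrev LinEntry (n k m : ℕ) : Type := (Bits k × Bits n × Bits m) ⊕ (Bits n × Bits m)

/-- The distribution of the randomness of an encryption with a random string in place of the output
of the generator. -/
def linEntryDist (n k m : ℕ) (η : unitInterval) : Bool → PMF (LinEntry n k m)
  | true => (unif (Bits k)).bind fun s => (noise n η).bind fun e => (unif (Bits m)).bind fun u =>
      PMF.pure (.inl (s, e, u))
  | false => (unif (Bits n)).bind fun c => (unif (Bits m)).bind fun y => PMF.pure (.inr (c, y))

/-- The pad that corresponds to an entry. -/
def LinEntry.toPad (G : Matrix (Fin n) (Fin k) Bit) : LinEntry n k m → Bits n × Bits m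
  | .inl (s, e, u) => (G *ᵥ s + e, u)
  | .inr p => p

/-- The game with uniform strings in place of the outputs of the generator. -/
def linGame (C : Circuit GameOracle) (out : ℕ) (η : unitInterval) (G : Matrix (Fin n) (Fin k) Bit) :
    PMF Bit :=
  (seqSample ((encKinds C).map (linEntryDist n k m η))).bind fun ℓ =>
    padRun n k m C out (ℓ.map (LinEntry.toPad G))

/-- Hybrid over the encryptions. In each step the key, the seed, the noise and all other pads are
constants of the circuit; only the second half of one pad is read from the input, which is either an
output of the generator or uniform. -/
theorem close_linGame (C : Circuit GameOracle) (out : ℕ) (η : unitInterval)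
    (PRNG : Bits k → Bits m) (G : Matrix (Fin n) (Fin k) Bit) {s T : ℕ} (hs : C.size ≤ s)
    (hT : reductionSize n k m s ≤ T) :
    Close (s * ENNReal.ofReal (distInSec T
        ((unif (Bits k)).bind fun x => PMF.pure (List.ofFn (PRNG x)))
        ((unif (Bits m)).bind fun u => PMF.pure (List.ofFn u))))
      (((seqSample ((encKinds C).map (entryDist n k m η))).bind fun ℓ =>
        padRun n k m C out (ℓ.map (Entry.toPad PRNG G))) 1)
      (linGame (m := m) C out η G 1) := by
  obtain ⟨ε, hε⟩ : ∃ ε, ε = ENNReal.ofReal (distInSec T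
        ((unif (Bits k)).bind fun x => PMF.pure (List.ofFn (PRNG x)))
        ((unif (Bits m)).bind fun u => PMF.pure (List.ofFn u))) := ⟨_, rfl⟩
  have hlen : (encKinds C).length ≤ s :=
    (length_encKinds_le C).trans ((length_le_size C).trans hs)
  have e1 : ((seqSample ((encKinds C).map (entryDist n k m η))).bind fun ℓ =>
        padRun n k m C out (ℓ.map (Entry.toPad PRNG G))) =
      (seqSample ((encKinds C).map fun b => (entryDist n k m η b).map (Entry.toPad PRNG G))).bind
        (padRun n k m C out) := by
    have := seqSample_map (Entry.toPad PRNG G) ((encKinds C).map (entryDist n k m η))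
    rw [List.map_map] at this
    rw [← Function.comp_def (fun X : PMF (Entry n k m) => X.map (Entry.toPad PRNG G)), this,
      PMF.bind_map]
    rfl
  have e2 : linGame (m := m) C out η G =
      (seqSample ((encKinds C).map fun b => (linEntryDist n k m η b).map (LinEntry.toPad G))).bind
        (padRun n k m C out) := by
    have := seqSample_map (LinEntry.toPad G) ((encKinds C).map (linEntryDist n k m η))
    rw [List.map_map] at this
    rw [← Function.comp_def (fun X : PMF (LinEntry n k m) => X.map (LinEntry.toPad G)), this,
      PMF.bind_map]
    rfl
  rw [← hε, e1, e2]
  refine Close.mono (close_seqSample (ε := ε) _ ?_) (by rw [List.length_map]; gcongr)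
  rw [List.forall₂_map_left_iff, List.forall₂_map_right_iff, List.forall₂_same]
  intro b _ pre post hl
  rw [List.length_map] at hl
  cases b with
  | false =>
    simp only [entryDist, linEntryDist, PMF.map_bind, PMF.pure_map, Entry.toPad, LinEntry.toPad]
    exact (Close.refl _).mono zero_le
  | true =>
    simp only [entryDist, linEntryDist, PMF.map_bind, PMF.pure_map, PMF.bind_bind, PMF.pure_bind,
      Entry.toPad, LinEntry.toPad]
    refine Close.bind fun sd => Close.bind fun e => ?_
    obtain ⟨D, hD, hans⟩ := exists_distinguisher (k := k) C out m 1 []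
      (pre.map AffPad.const ++ ((fun i => ((G *ᵥ sd + e) i, []), fun i : Fin m => (0, [(i : ℕ)])) ::
        post.map AffPad.const)) (by simp) (by
          have hconst : ∀ p : Bits n × Bits m, ∀ a ∈ (AffPad.const p).forms, a.2.length ≤ 1 ∧
              ∀ r ∈ a.2, r < m := by
            intro p a ha
            simp only [AffPad.forms, AffPad.const, List.mem_append, List.mem_ofFn] at ha
            rcases ha with ⟨i, rfl⟩ | ⟨i, rfl⟩ <;> simp
          intro p hp
          simp only [List.mem_append, List.mem_map, List.mem_cons] at hp
          rcases hp with ⟨p, -, rfl⟩ | rfl | ⟨p, -, rfl⟩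
          · exact hconst p
          · intro a ha
            simp only [AffPad.forms, List.mem_append, List.mem_ofFn] at ha
            rcases ha with ⟨i, rfl⟩ | ⟨i, rfl⟩ <;> simp
          · exact hconst p)
    have hDT : D.circuit.size ≤ T := by
      refine (hD.trans ?_).trans hT
      rw [List.length_nil, zero_add]
      refine reduction_size_le ?_ hs (by omega)
      simp only [List.length_append, List.length_map, List.length_cons]
      omega
    have hval : ∀ v : Bits m, D.answer (List.ofFn v) =
        padRun n k m C out (pre ++ (G *ᵥ sd + e, v) :: post) := by
      intro v
      rw [hans _ (by simp)]
      congr 1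
      simp only [List.map_append, List.map_cons, List.map_map, Function.comp_def,
        AffPad.eval_const, List.map_id', evals_nil]
      congr 2
      simp [AffPad.eval, affEval, inputRegs_ofFn]
      rfl
    have := close_distInSec (X := (unif (Bits k)).bind fun x => PMF.pure (List.ofFn (PRNG x)))
      (Y := (unif (Bits m)).bind fun u => PMF.pure (List.ofFn u)) D hDT
    simpa only [PMF.bind_bind, PMF.pure_bind, hval, ← hε] using this

/-- The affine forms of an entry when the bit `(i, j)` of the matrix is in the register
`i * q + (o + j)`. -/
def LinEntry.toAff (q o : ℕ) : LinEntry n k m → AffPad n m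
  | .inl (s, e, u) => (fun i => (e i, ((List.finRange k).filter fun j => s j = 1).map
      fun j : Fin k => (i : ℕ) * q + (o + j)), fun i => (u i, []))
  | .inr p => AffPad.const p

/-- With seed and noise hardwired, each bit of `G s + e` is a constant plus a parity of the entries
of one row of `G` selected by the seed. -/
theorem LinEntry.eval_toAff {q o : ℕ} {ρ : Registers} {G : Matrix (Fin n) (Fin k) Bit}
    (h : ∀ i j, ρ ((i : Fin n) * q + (o + (j : Fin k))) = G i j) (x : LinEntry n k m) :
    (x.toAff q o).eval ρ = x.toPad G := by
  rcases x with ⟨s, e, u⟩ | p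
  · refine Prod.ext (funext fun i => ?_) (funext fun i => ?_)
    · simp only [LinEntry.toAff, AffPad.eval, affEval, LinEntry.toPad, Pi.add_apply, List.map_map]
      rw [add_comm]
      congr 1
      have : (ρ ∘ fun j : Fin k => (i : ℕ) * q + (o + j)) = G i := funext fun j => h i j
      rw [this, Matrix.mulVec, dotProduct, ← List.sum_ofFn, List.ofFn_eq_map]
      induction List.finRange k with
      | nil => rfl
      | cons j l ih =>
        rw [List.map_cons, List.sum_cons, ← ih]
        rcases Bit.eq_zero_or_one (s j) with hj | hj <;> simp [hj]
    · simp [LinEntry.toAff, AffPad.eval, affEval, LinEntry.toPad]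
  · exact AffPad.eval_const ρ p

theorem LinEntry.forms_toAff {q o : ℕ} (hkq : o + k ≤ q) (x : LinEntry n k m) :
    ∀ a ∈ (x.toAff q o).forms, a.2.length ≤ k + 1 ∧ ∀ r ∈ a.2, r < n * q := by
  intro a ha
  rcases x with ⟨s, e, u⟩ | p
  · simp only [AffPad.forms, LinEntry.toAff, List.mem_append, List.mem_ofFn] at ha
    rcases ha with ⟨i, rfl⟩ | ⟨i, rfl⟩
    · simp only [List.length_map, List.mem_map]
      constructor
      · refine (List.length_filter_le _ _).trans ?_
        simp
      · rintro r ⟨j, -, rfl⟩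
        exact mul_add_lt i (⟨o + j, by omega⟩ : Fin q)
    · simp
  · simp only [AffPad.forms, LinEntry.toAff, AffPad.const, List.mem_append, List.mem_ofFn] at ha
    rcases ha with ⟨i, rfl⟩ | ⟨i, rfl⟩ <;> simp

/-- The game in which all pads are uniform. -/
def uniformGame (n k m : ℕ) (C : Circuit GameOracle) (out : ℕ) : PMF Bit :=
  (seqSample ((encKinds C).map fun _ => linEntryDist n k m 0 false)).bind fun ℓ =>
    padRun n k m C out (ℓ.map (LinEntry.toPad 0))

/-- Hybrid over the encryptions, which all share `G`. The LPN matrix plays the role of `G`, and the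
LPN vector supplies the first half of one pad; the remaining pads are affine in the matrix and are
computed from it by the circuit. -/
theorem close_uniformGame (C : Circuit GameOracle) (out : ℕ) (η : unitInterval) {s T : ℕ}
    (hs : C.size ≤ s) (hT : reductionSize n k m s ≤ T) :
    Close (s * ENNReal.ofReal (distInSec T (lpnReal n k η) (lpnIdeal n k)))
      (((unif (Matrix (Fin n) (Fin k) Bit)).bind fun G => linGame (m := m) C out η G) 1)
      (uniformGame n k m C out 1) := by
  obtain ⟨ε, hε⟩ : ∃ ε, ε = ENNReal.ofReal (distInSec T (lpnReal n k η) (lpnIdeal n k)) := ⟨_, rfl⟩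
  have hlen : (encKinds C).length ≤ s :=
    (length_encKinds_le C).trans ((length_le_size C).trans hs)
  obtain ⟨F, hF⟩ : ∃ F : List (LinEntry n k m) → PMF Bit,
    F = fun ℓ => (unif (Matrix (Fin n) (Fin k) Bit)).bind fun G =>
      padRun n k m C out (ℓ.map (LinEntry.toPad G)) := ⟨_, rfl⟩
  have e1 : ((unif (Matrix (Fin n) (Fin k) Bit)).bind fun G => linGame (m := m) C out η G) =
      (seqSample ((encKinds C).map (linEntryDist n k m η))).bind F := by
    rw [hF, PMF.bind_comm]
    rfl
  -- Uniform pads do not involve the matrix, so averaging over it is harmless and both ends of the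
  -- hybrid are expressed by the same `F`.
  have e2 : uniformGame n k m C out =
      (seqSample ((encKinds C).map fun _ => linEntryDist n k m 0 false)).bind F := by
    have h1 : ∀ G : Matrix (Fin n) (Fin k) Bit,
        (seqSample ((encKinds C).map fun _ => linEntryDist n k m 0 false)).map
          (List.map (LinEntry.toPad G)) =
        (seqSample ((encKinds C).map fun _ => linEntryDist n k m 0 false)).map
          (List.map (LinEntry.toPad 0)) := by
      intro G
      rw [← seqSample_map, ← seqSample_map, List.map_map, List.map_map]
      congr 2
      funext b
      simp [linEntryDist, PMF.map_bind, PMF.pure_map, LinEntry.toPad]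
    have h2 : ∀ G : Matrix (Fin n) (Fin k) Bit, ((seqSample ((encKinds C).map fun _ =>
        linEntryDist n k m 0 false)).bind fun ℓ => padRun n k m C out (ℓ.map (LinEntry.toPad G))) =
        uniformGame n k m C out := by
      intro G
      rw [uniformGame]
      have := congrArg (fun X => X.bind (padRun n k m C out)) (h1 G)
      simpa only [PMF.bind_map, Function.comp_def] using this
    rw [hF, PMF.bind_comm]
    simp only [h2, PMF.bind_const]
  rw [← hε, e1, e2]
  refine Close.mono (close_seqSample (ε := ε) _ ?_) (by rw [List.length_map]; gcongr)
  rw [List.forall₂_map_left_iff, List.forall₂_map_right_iff, List.forall₂_same]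
  intro b _ pre post hl
  rw [List.length_map] at hl
  cases b with
  | false => exact (Close.refl _).mono zero_le
  | true =>
    have hstep : ∀ u : Bits m, Close ε
        (((unif (Bits k)).bind fun sd => (noise n η).bind fun e =>
          F (pre ++ .inl (sd, e, u) :: post)) 1)
        (((unif (Bits n)).bind fun c => F (pre ++ .inr (c, u) :: post)) 1) := by
      intro u
      -- The LPN vector starts at register `n * k`, behind the matrix. The bound `k + 1` covers the
      -- row parities, of length at most `k`, and the single register of a challenge bit even when
      -- `k = 0`.
      obtain ⟨D, hD, hans⟩ := exists_distinguisher (k := k) C out (n * k + n) (k + 1) []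
        (pre.map (LinEntry.toAff k 0) ++ ((fun i : Fin n => ((0 : Bit), [n * k + (i : ℕ)]), fun i : Fin m => (u i, [])) ::
          post.map (LinEntry.toAff k 0))) (by simp) (by
            have haff : ∀ p : LinEntry n k m, ∀ a ∈ (p.toAff k 0).forms, a.2.length ≤ k + 1 ∧
                ∀ r ∈ a.2, r < n * k + n := by
              intro p a ha
              obtain ⟨h1, h2⟩ := LinEntry.forms_toAff (zero_add k).le p a ha
              exact ⟨h1, fun r hr => (h2 r hr).trans_le (Nat.le_add_right _ _)⟩
            intro p hp
            simp only [List.mem_append, List.mem_map, List.mem_cons] at hp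
            rcases hp with ⟨p, -, rfl⟩ | rfl | ⟨p, -, rfl⟩
            · exact haff p
            · intro a ha
              simp only [AffPad.forms, List.mem_append, List.mem_ofFn] at ha
              rcases ha with ⟨i, rfl⟩ | ⟨i, rfl⟩ <;> simp
            · exact haff p)
      have hDT : D.circuit.size ≤ T := by
        refine (hD.trans ?_).trans hT
        rw [List.length_nil, zero_add]
        refine reduction_size_le ?_ hs le_rfl
        simp only [List.length_append, List.length_map, List.length_cons]
        omega
      have hval : ∀ (A : Matrix (Fin n) (Fin k) Bit) (c : Bits n),
          D.answer (matrixBits A ++ List.ofFn c) =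
          padRun n k m C out (pre.map (LinEntry.toPad A) ++ (c, u) ::
            post.map (LinEntry.toPad A)) := by
        intro A c
        rw [hans _ (by simp [length_matrixBits])]
        have hA : ∀ (i : Fin n) (j : Fin k),
            inputRegs (matrixBits A ++ List.ofFn c) (i * k + (0 + j)) = A i j := by
          intro i j
          rw [zero_add, inputRegs_append_left, inputRegs_matrixBits]
          rw [length_matrixBits]
          exact mul_add_lt i j
        have hc : ∀ i : Fin n, inputRegs (matrixBits A ++ List.ofFn c) (n * k + i) = c i := by
          intro i
          rw [← length_matrixBits A, inputRegs_append_right, inputRegs_ofFn]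
        congr 1
        simp only [List.map_append, List.map_cons, List.map_map, Function.comp_def,
          LinEntry.eval_toAff hA, evals_nil]
        congr 2
        simp [AffPad.eval, affEval, hc]
      have := close_distInSec (X := lpnReal n k η) (Y := lpnIdeal n k) D hDT
      rw [← hε] at this
      simp only [lpnReal, lpnIdeal, PMF.bind_bind, PMF.pure_bind, hval] at this
      have h1 : ((unif (Bits k)).bind fun sd => (noise n η).bind fun e =>
          F (pre ++ .inl (sd, e, u) :: post)) =
          (unif (Matrix (Fin n) (Fin k) Bit)).bind fun A => (unif (Bits k)).bind fun sd =>
            (noise n η).bind fun e => padRun n k m C out (pre.map (LinEntry.toPad A) ++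
              (A *ᵥ sd + e, u) :: post.map (LinEntry.toPad A)) := by
        rw [hF]
        simp only [List.map_append, List.map_cons, LinEntry.toPad]
        rw [PMF.bind_comm (unif (Matrix (Fin n) (Fin k) Bit))]
        congr 1
        funext sd
        rw [PMF.bind_comm (unif (Matrix (Fin n) (Fin k) Bit))]
      have h2 : ((unif (Bits n)).bind fun c => F (pre ++ .inr (c, u) :: post)) =
          (unif (Matrix (Fin n) (Fin k) Bit)).bind fun A => (unif (Bits n)).bind fun c =>
            padRun n k m C out (pre.map (LinEntry.toPad A) ++ (c, u) ::
              post.map (LinEntry.toPad A)) := by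
        rw [hF]
        simp only [List.map_append, List.map_cons, LinEntry.toPad]
        rw [PMF.bind_comm]
      rw [h1, h2]
      exact this
    simp only [linEntryDist, PMF.bind_bind, PMF.pure_bind]
    -- The second half `u` is drawn first, so that it can be fixed in the reduction.
    have h1 : ((unif (Bits k)).bind fun sd => (noise n η).bind fun e => (unif (Bits m)).bind fun u =>
          F (pre ++ .inl (sd, e, u) :: post)) = (unif (Bits m)).bind fun u =>
          (unif (Bits k)).bind fun sd => (noise n η).bind fun e =>
            F (pre ++ .inl (sd, e, u) :: post) := by
      rw [PMF.bind_comm (unif (Bits m))]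
      congr 1
      funext sd
      rw [PMF.bind_comm (unif (Bits m))]
    rw [h1, PMF.bind_comm (unif (Bits n))]
    exact Close.bind hstep

end Reduction

/-! ### Uniform distributions on product sets and on kernels -/

theorem iid_apply {α : Type} (X : PMF α) (n : ℕ) (v : Fin n → α) :
    iid X n v = ∏ i, X (v i) := by
  classical
  induction n with
  | zero =>
    rw [iid, Fin.prod_univ_zero, PMF.pure_apply, if_pos (Subsingleton.elim _ _)]
  | succ n ih =>
    rw [iid, PMF.bind_apply, tsum_eq_single (v 0), PMF.bind_apply, tsum_eq_single (Fin.tail v),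
      ih, Fin.prod_univ_succ, PMF.pure_apply, if_pos (Fin.cons_self_tail v).symm, mul_one]
    · rfl
    · intro w hw
      rw [PMF.pure_apply, if_neg, mul_zero]
      exact fun h => hw ((congrArg Fin.tail h).trans (Fin.tail_cons _ _)).symm
    · intro a ha
      have : ((iid X n).bind fun w => PMF.pure (Fin.cons a w : Fin (n + 1) → α)) v = 0 := by
        rw [PMF.bind_apply]
        refine ENNReal.tsum_eq_zero.2 fun w => ?_
        rw [PMF.pure_apply, if_neg, mul_zero]
        rintro rfl
        exact ha rfl
      rw [this, mul_zero]

theorem iid_pure {α : Type} (a : α) (n : ℕ) : iid (PMF.pure a) n = PMF.pure fun _ => a := by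
  induction n with
  | zero => exact congrArg PMF.pure (Subsingleton.elim _ _)
  | succ n ih =>
    rw [iid, PMF.pure_bind, ih, PMF.pure_bind]
    congr 1
    funext i
    refine Fin.cases rfl (fun _ => rfl) i

theorem map_ofFn_iid {α : Type} (X : PMF α) (n : ℕ) :
    (iid X n).map List.ofFn = seqSample (List.replicate n X) := by
  induction n with
  | zero => simp [iid, PMF.pure_map, seqSample]
  | succ n ih =>
    rw [iid, List.replicate_succ, seqSample, ← ih]
    simp [PMF.map_bind, PMF.pure_map, PMF.bind_map, Function.comp_def]

theorem seqSample_append {α : Type} (Xs Ys : List (PMF α)) :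
    seqSample (Xs ++ Ys) = (seqSample Xs).bind fun u => (seqSample Ys).bind fun v =>
      PMF.pure (u ++ v) := by
  induction Xs with
  | nil => simp [seqSample]
  | cons X Xs ih => simp [seqSample, ih]

section UniformSubjectTo

variable {α β : Type} [Fintype α] [Zero α] [Fintype β] [Zero β]

theorem uniformSubjectTo_apply {p : α → Prop} [inst : DecidablePred p]
    (h : (Finset.univ.filter p).Nonempty) (a : α) :
    uniformSubjectTo p a = if p a then ((Finset.univ.filter p).card : ℝ≥0∞)⁻¹ else 0 := by
  have e : (fun a => Classical.propDecidable (p a)) = inst := Subsingleton.elim _ _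
  subst e
  rw [uniformSubjectTo, dif_pos h, PMF.uniformOfFinset_apply]
  classical
  by_cases ha : p a
  · rw [if_pos ha, if_pos (Finset.mem_filter.2 ⟨Finset.mem_univ a, ha⟩)]
  · rw [if_neg ha, if_neg fun h' => ha (Finset.mem_filter.1 h').2]

theorem uniformSubjectTo_of_empty {p : α → Prop} [inst : DecidablePred p]
    (h : ¬(Finset.univ.filter p).Nonempty) : uniformSubjectTo p = PMF.pure 0 := by
  have e : (fun a => Classical.propDecidable (p a)) = inst := Subsingleton.elim _ _
  subst e
  rw [uniformSubjectTo, dif_neg h]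

theorem expect_uniformSubjectTo {p : α → Prop} [DecidablePred p]
    (h : (Finset.univ.filter p).Nonempty) (f : α → ℝ≥0∞) : expect (uniformSubjectTo p) f =
      ((Finset.univ.filter p).card : ℝ≥0∞)⁻¹ * ∑ a ∈ Finset.univ.filter p, f a := by
  rw [expect, tsum_fintype, Finset.mul_sum, Finset.sum_filter]
  refine Finset.sum_congr rfl fun a _ => ?_
  rw [uniformSubjectTo_apply h]
  split_ifs <;> simp

theorem uniformSubjectTo_congr {p p' : α → Prop} (h : ∀ a, p a ↔ p' a) :
    uniformSubjectTo p = uniformSubjectTo p' := by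
  rw [show p = p' from funext fun a => propext (h a)]

/-- The condition `e 0 = 0` is needed for the fallback value when nothing satisfies the predicate.
-/
theorem map_uniformSubjectTo (e : α ≃ β) (h0 : e 0 = 0) {p : α → Prop} {p' : β → Prop}
    (h : ∀ a, p a ↔ p' (e a)) : (uniformSubjectTo p).map e = uniformSubjectTo p' := by
  classical
  have hcard : Finset.univ.filter p' = (Finset.univ.filter p).map e.toEmbedding := by
    ext b
    simp only [Finset.mem_filter, Finset.mem_univ, true_and, Finset.mem_map_equiv]
    rw [h, Equiv.apply_symm_apply]
  by_cases hne : (Finset.univ.filter p).Nonempty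
  · have hne' : (Finset.univ.filter p').Nonempty := by rw [hcard]; exact hne.map
    ext b
    rw [PMF.map_apply, tsum_eq_single (e.symm b), uniformSubjectTo_apply hne,
      uniformSubjectTo_apply hne', hcard, Finset.card_map]
    · simp [h]
    · intro a ha
      rw [if_neg]
      rintro rfl
      simp at ha
  · have hne' : ¬(Finset.univ.filter p').Nonempty := by
      rw [hcard, Finset.map_nonempty]; exact hne
    rw [uniformSubjectTo_of_empty hne, uniformSubjectTo_of_empty hne', PMF.pure_map, h0]

/-- The constraint is a product set, so its uniform law has independent coordinates. This makes the
rows of `P` independent. -/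
theorem uniformSubjectTo_forall (p : α → Prop) (n : ℕ) :
    (uniformSubjectTo fun v : Fin n → α => ∀ i, p (v i)) = iid (uniformSubjectTo p) n := by
  classical
  have hpi : (Finset.univ.filter fun v : Fin n → α => ∀ i, p (v i)) =
      Fintype.piFinset fun _ => Finset.univ.filter p := by
    ext v; simp
  by_cases hne : (Finset.univ.filter p).Nonempty
  · have hne' : (Finset.univ.filter fun v : Fin n → α => ∀ i, p (v i)).Nonempty := by
      rw [hpi, Fintype.piFinset_nonempty]
      exact fun _ => hne
    ext v
    rw [iid_apply, uniformSubjectTo_apply hne', hpi, Fintype.card_piFinset]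
    simp only [uniformSubjectTo_apply hne]
    by_cases hv : ∀ i, p (v i)
    · rw [if_pos hv, Finset.prod_congr rfl fun i _ => if_pos (hv i)]
      simp [ENNReal.inv_pow]
    · rw [if_neg hv]
      push Not at hv
      obtain ⟨i, hi⟩ := hv
      exact (Finset.prod_eq_zero (Finset.mem_univ i) (if_neg hi)).symm
  -- If no value is admissible, each coordinate falls back to `0` and so does the whole vector. For
  -- `n = 0` the vector condition is vacuous, but there is only one distribution on a point.
  · rw [uniformSubjectTo_of_empty hne, iid_pure]
    cases n with
    | zero =>
      have : ∀ X Y : PMF (Fin 0 → α), X = Y := by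
        intro X Y
        ext v
        have h1 : ∀ X : PMF (Fin 0 → α), X v = 1 := fun X => by
          rw [← X.tsum_coe, tsum_fintype, Fintype.sum_subsingleton _ v]
        rw [h1, h1]
      exact this _ _
    | succ n =>
      rw [uniformSubjectTo_of_empty]
      · rfl
      · rw [hpi, Fintype.piFinset_nonempty]
        exact fun h => hne (h 0)

end UniformSubjectTo

/-- The uniform distribution on the vectors orthogonal to the given ones. -/
def kernelDist (n : ℕ) (qs : List (Bits n)) : PMF (Bits n) :=
  uniformSubjectTo fun c => ∀ p ∈ qs, p ⬝ᵥ c = 0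

/-- The list of the columns of a matrix. -/
def colsList {n q : ℕ} (M : Matrix (Fin n) (Fin q) Bit) : List (Bits n) :=
  List.ofFn fun c i => M i c

/-- The matrix with the given columns. -/
def ofCols {n : ℕ} (k : ℕ) (L : List (Bits n)) : Matrix (Fin n) (Fin k) Bit :=
  fun i c => L.getD c 0 i

/-- The uniform distribution on the matrices whose columns are orthogonal to the given vectors. -/
def orthMatrixDist (n q : ℕ) (qs : List (Bits n)) : PMF (Matrix (Fin n) (Fin q) Bit) :=
  uniformSubjectTo fun M => ∀ p ∈ qs, p ᵥ* M = 0

/-- Orthogonality is a condition on each column separately, so the columns are independent and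
uniform on the kernel. -/
theorem map_colsList_orthMatrixDist (n q : ℕ) (qs : List (Bits n)) :
    (orthMatrixDist n q qs).map colsList = seqSample (List.replicate q (kernelDist n qs)) := by
  rw [← map_ofFn_iid, kernelDist, ← uniformSubjectTo_forall,
    ← map_uniformSubjectTo (p := fun M : Matrix (Fin n) (Fin q) Bit => ∀ p ∈ qs, p ᵥ* M = 0)
      (⟨Matrix.transpose, Matrix.transpose, fun _ => rfl, fun _ => rfl⟩ :
        Matrix (Fin n) (Fin q) Bit ≃ (Fin q → Bits n)) rfl ?_, PMF.map_comp]
  · rfl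
  · intro M
    constructor
    · intro h c p hp
      exact congrFun (h p hp) c
    · intro h p hp
      funext c
      exact h c p hp

theorem ofCols_append {n k : ℕ} {u v : List (Bits n)} (h : u.length = k) :
    ofCols k (u ++ v) = ofCols k u := by
  funext i c
  rw [ofCols, ofCols, List.getD_append]
  omega

theorem ofCols_colsList {n k : ℕ} (M : Matrix (Fin n) (Fin k) Bit) : ofCols k (colsList M) = M := by
  funext i c
  simp [ofCols, colsList]

/-- Independent surplus columns may be drawn and discarded. -/
theorem orthMatrixDist_eq (n k d : ℕ) (qs : List (Bits n)) :
    orthMatrixDist n k qs =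
      (seqSample (List.replicate (k + d) (kernelDist n qs))).map (ofCols k) := by
  rw [List.replicate_add, seqSample_append]
  have h : (orthMatrixDist n k qs) = ((orthMatrixDist n k qs).map colsList).map (ofCols k) := by
    rw [PMF.map_comp]
    simp only [Function.comp_def, ofCols_colsList]
    exact (PMF.map_id _).symm
  rw [h, map_colsList_orthMatrixDist, PMF.map_bind]
  simp only [PMF.map_bind, PMF.pure_map]
  ext M
  rw [PMF.map, bind_apply_eq_expect, bind_apply_eq_expect]
  have : ∀ u ∈ (seqSample (List.replicate k (kernelDist n qs))).support,
      ((seqSample (List.replicate d (kernelDist n qs))).bind fun v => PMF.pure (ofCols k (u ++ v))) =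
        PMF.pure (ofCols k u) := by
    intro u hu
    have hl := length_of_mem_support_seqSample hu
    rw [List.length_replicate] at hl
    simp only [ofCols_append hl, PMF.bind_const]
  exact le_antisymm (expect_mono fun u hu => by rw [this u hu]; rfl)
    (expect_mono fun u hu => by rw [this u hu]; rfl)

/-! ### Column elimination -/

/-- Use the first vector to make the other ones orthogonal to `p`: the transformed list. -/
def elimWith {n : ℕ} (p : Bits n) : Bits n → List (Bits n) → List (Bits n)
  | _, [] => []
  | w, c :: cs =>
      (c + (p ⬝ᵥ c) • (w + ((1 + p ⬝ᵥ w) * (p ⬝ᵥ c)) • c)) ::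
        elimWith p (w + ((1 + p ⬝ᵥ w) * (p ⬝ᵥ c)) • c) cs

/-- From a list of vectors, make a list of vectors that are orthogonal to `p`, one shorter. -/
def elimRow {n : ℕ} (p : Bits n) : List (Bits n) → List (Bits n)
  | [] => []
  | w :: cs => elimWith p w cs

section Elimination

variable {n : ℕ} (p : Bits n) (qs : List (Bits n))

/-- The vectors `c` that are orthogonal to `qs` and have `p ⬝ᵥ c = a`. -/
def fiber (a : Bit) : Finset (Bits n) :=
  Finset.univ.filter fun c => (∀ q ∈ qs, q ⬝ᵥ c = 0) ∧ p ⬝ᵥ c = a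

theorem mem_fiber {a : Bit} {c : Bits n} :
    c ∈ fiber p qs a ↔ (∀ q ∈ qs, q ⬝ᵥ c = 0) ∧ p ⬝ᵥ c = a := by
  simp [fiber]

theorem add_mem_fiber {a b : Bit} {c d : Bits n} (hc : c ∈ fiber p qs a) (hd : d ∈ fiber p qs b) :
    c + d ∈ fiber p qs (a + b) := by
  rw [mem_fiber] at *
  refine ⟨fun q hq => ?_, ?_⟩
  · rw [dotProduct_add, hc.1 q hq, hd.1 q hq, add_zero]
  · rw [dotProduct_add, hc.2, hd.2]

theorem add_mem_fiber_zero {c d : Bits n} (hc : c ∈ fiber p qs 1) (hd : d ∈ fiber p qs 1) :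
    c + d ∈ fiber p qs 0 := by
  have := add_mem_fiber p qs hc hd
  rwa [CharTwo.add_self_eq_zero] at this

theorem bits_add_self (c : Bits n) : c + c = 0 := by
  funext i
  exact CharTwo.add_self_eq_zero (c i)

theorem bits_add_cancel (c d : Bits n) : c + d + d = c := by
  rw [add_assoc, bits_add_self, add_zero]

/-- A column `c` off the kernel of `p` is used to give the carry the value `1`, then the carry is
added to `c`. For either value `a` of the old carry, this maps `(w, c)` bijectively onto pairs of a
kernel vector and a carry in the fiber over `1`. -/
theorem sum_fiber_one (a : Bit) (F : Bits n → Bits n → ℝ≥0∞) :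
    ∑ w ∈ fiber p qs a, ∑ c ∈ fiber p qs 1,
      F (c + (p ⬝ᵥ c) • (w + ((1 + p ⬝ᵥ w) * (p ⬝ᵥ c)) • c))
        (w + ((1 + p ⬝ᵥ w) * (p ⬝ᵥ c)) • c) =
    ∑ c ∈ fiber p qs 0, ∑ w ∈ fiber p qs 1, F c w := by
  rw [← Finset.sum_product', ← Finset.sum_product']
  have hsmul : ∀ {b b' : Bit} {c : Bits n}, c ∈ fiber p qs b → b' • c ∈ fiber p qs (b' * b) := by
    intro b b' c hc
    rw [mem_fiber] at *
    exact ⟨fun q hq => by rw [dotProduct_smul, hc.1 q hq, smul_zero], by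
      rw [dotProduct_smul, hc.2, smul_eq_mul]⟩
  have h1 : ∀ a : Bit, a + (1 + a) * 1 = 1 := by decide
  have h2 : ∀ a : Bit, 1 + (1 + a) * 1 = a := by decide
  refine Finset.sum_bij' (fun z _ => (z.2 + (z.1 + (1 + a) • z.2), z.1 + (1 + a) • z.2))
    (fun z _ => (z.2 + (1 + a) • (z.1 + z.2), z.1 + z.2)) ?_ ?_ ?_ ?_ ?_
  · rintro ⟨w, c⟩ hz
    rw [Finset.mem_product] at hz ⊢
    have hw' : w + (1 + a) • c ∈ fiber p qs 1 := by
      have := add_mem_fiber p qs hz.1 (hsmul (b' := 1 + a) hz.2)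
      rwa [h1] at this
    exact ⟨add_mem_fiber_zero p qs hz.2 hw', hw'⟩
  · rintro ⟨c, w⟩ hz
    rw [Finset.mem_product] at hz ⊢
    have hc' : c + w ∈ fiber p qs 1 := by
      have := add_mem_fiber p qs hz.1 hz.2
      rwa [zero_add] at this
    refine ⟨?_, hc'⟩
    have := add_mem_fiber p qs hz.2 (hsmul (b' := 1 + a) hc')
    rwa [h2] at this
  · rintro ⟨w, c⟩ _
    simp only [bits_add_cancel]
  · rintro ⟨c, w⟩ _
    simp only [bits_add_cancel]
  · rintro ⟨w, c⟩ hz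
    rw [Finset.mem_product] at hz
    rw [((mem_fiber p qs).1 hz.1).2, ((mem_fiber p qs).1 hz.2).2]
    simp

theorem sum_fiber_zero (a : Bit) (F : Bits n → Bits n → ℝ≥0∞) :
    ∑ w ∈ fiber p qs a, ∑ c ∈ fiber p qs 0,
      F (c + (p ⬝ᵥ c) • (w + ((1 + p ⬝ᵥ w) * (p ⬝ᵥ c)) • c))
        (w + ((1 + p ⬝ᵥ w) * (p ⬝ᵥ c)) • c) =
    ∑ c ∈ fiber p qs 0, ∑ w ∈ fiber p qs a, F c w := by
  rw [Finset.sum_comm]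
  refine Finset.sum_congr rfl fun c hc => Finset.sum_congr rfl fun w _ => ?_
  rw [((mem_fiber p qs).1 hc).2]
  simp

/-- A nonempty fiber over `1` is a translate of the fiber over `0`; it is empty when `p` already
vanishes on the kernel of `qs`. -/
theorem card_fiber_one : (fiber p qs 1).card = 0 ∨ (fiber p qs 1).card = (fiber p qs 0).card := by
  rcases (fiber p qs 1).eq_empty_or_nonempty with h | ⟨d, hd⟩
  · exact Or.inl (by rw [h]; rfl)
  · refine Or.inr (Finset.card_bij' (fun c _ => c + d) (fun c _ => c + d) ?_ ?_ ?_ ?_)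
    · exact fun c hc => add_mem_fiber_zero p qs hc hd
    · intro c hc; simpa using add_mem_fiber p qs hc hd
    · intro c _; exact bits_add_cancel c d
    · intro c _; exact bits_add_cancel c d

theorem fiber_zero_pos : 0 < (fiber p qs 0).card :=
  Finset.card_pos.2 ⟨0, by simp [mem_fiber]⟩

theorem expect_kernelDist (f : Bits n → ℝ≥0∞) : expect (kernelDist n qs) f =
    ((fiber p qs 0).card + (fiber p qs 1).card : ℝ≥0∞)⁻¹ *
      (∑ c ∈ fiber p qs 0, f c + ∑ c ∈ fiber p qs 1, f c) := by
  classical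
  have hdisj : Disjoint (fiber p qs 0) (fiber p qs 1) := by
    rw [Finset.disjoint_left]
    intro c h0 h1
    rw [mem_fiber] at h0 h1
    exact zero_ne_one (h0.2.symm.trans h1.2)
  have hun : (Finset.univ.filter fun c : Bits n => ∀ q ∈ qs, q ⬝ᵥ c = 0) =
      fiber p qs 0 ∪ fiber p qs 1 := by
    ext c
    simp only [Finset.mem_filter, Finset.mem_univ, true_and, Finset.mem_union, mem_fiber,
      ← and_or_left]
    exact (and_iff_left (Bit.eq_zero_or_one _)).symm
  rw [kernelDist, expect_uniformSubjectTo ⟨0, by simp⟩]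
  have hun' : ∀ inst, (@Finset.filter _ (fun c : Bits n => ∀ q ∈ qs, q ⬝ᵥ c = 0) inst
      Finset.univ) = fiber p qs 0 ∪ fiber p qs 1 := by
    intro inst
    rw [← hun]
    congr
  rw [hun', Finset.card_union_of_disjoint hdisj, Finset.sum_union hdisj]
  push_cast
  rfl

theorem expect_kernelDist_cons (f : Bits n → ℝ≥0∞) : expect (kernelDist n (p :: qs)) f =
    ((fiber p qs 0).card : ℝ≥0∞)⁻¹ * ∑ c ∈ fiber p qs 0, f c := by
  classical
  have hun : ∀ inst, (@Finset.filter _ (fun c : Bits n => ∀ q ∈ p :: qs, q ⬝ᵥ c = 0) inst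
      Finset.univ) = fiber p qs 0 := by
    intro inst
    ext c
    simp [mem_fiber, and_comm]
  rw [kernelDist, expect_uniformSubjectTo ⟨0, by simp⟩, hun]

/-- The invariant of the elimination: if the carry is uniform on a fiber, whichever it is, the
outputs are independent and uniform on the smaller kernel. An input column in the kernel of `p` is
passed on and keeps the carry; one off the kernel moves the carry to the fiber over `1`, where it is
again uniform and independent of the output. -/
theorem sum_expect_elimWith (j : ℕ) (a : Bit) (f : List (Bits n) → ℝ≥0∞) :
    ∑ w ∈ fiber p qs a, expect (seqSample (List.replicate j (kernelDist n qs)))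
        (fun L => f (elimWith p w L)) =
      (fiber p qs a).card * expect (seqSample (List.replicate j (kernelDist n (p :: qs)))) f := by
  induction j generalizing a f with
  | zero => simp [seqSample, expect_pure, elimWith]
  | succ j ih =>
    simp only [List.replicate_succ, seqSample, expect_bind, expect_pure, elimWith]
    simp only [expect_kernelDist p qs]
    rw [← Finset.mul_sum, Finset.sum_add_distrib, 
      sum_fiber_zero p qs a fun c w => expect (seqSample (List.replicate j (kernelDist n qs)))
        fun L => f (c :: elimWith p w L),
      sum_fiber_one p qs a fun c w => expect (seqSample (List.replicate j (kernelDist n qs)))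
        fun L => f (c :: elimWith p w L)]
    simp only [fun c : Bits n => fun a : Bit => ih a fun L => f (c :: L)]
    rw [← Finset.mul_sum, ← Finset.mul_sum, ← add_mul, expect_kernelDist_cons, ← mul_assoc,
      ← mul_assoc]
    congr 1
    have h0 := fiber_zero_pos p qs
    obtain ⟨A, hA⟩ : ∃ A, A = (fiber p qs 0).card := ⟨_, rfl⟩
    have hA0 : (A : ℝ≥0∞) ≠ 0 := by
      rw [hA]; exact_mod_cast h0.ne'
    have hAtop : (A : ℝ≥0∞) ≠ ∞ := ENNReal.natCast_ne_top A
    have hAA : (A : ℝ≥0∞) + A ≠ 0 := by simp [hA0]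
    -- With `F₀`, `F₁` the fiber sizes, what is left is `(F₀ + F₁)⁻¹ (Fₐ + F₁) = Fₐ F₀⁻¹`. For `a =
    -- 1` this uses that `F₁` is `0` or `F₀`.
    rcases Bit.eq_zero_or_one a with rfl | rfl
    · rw [ENNReal.inv_mul_cancel, ENNReal.mul_inv_cancel]
      · rwa [← hA]
      · rwa [← hA]
      · rw [← hA]; simp [hA0]
      · simp
    · rcases card_fiber_one p qs with h1 | h1
      · simp [h1]
      · rw [h1, ← hA, ENNReal.inv_mul_cancel hAA (by simp), ENNReal.mul_inv_cancel hA0 hAtop]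

/-- The first column serves as carry. It is a mixture of the uniform laws on the two fibers, and the
outcome is the same for both. -/
theorem expect_elimRow (j : ℕ) (f : List (Bits n) → ℝ≥0∞) :
    expect (seqSample (List.replicate (j + 1) (kernelDist n qs))) (fun L => f (elimRow p L)) =
      expect (seqSample (List.replicate j (kernelDist n (p :: qs)))) f := by
  rw [List.replicate_succ, seqSample]
  simp only [expect_bind, expect_pure, elimRow]
  rw [expect_kernelDist p qs, sum_expect_elimWith, sum_expect_elimWith, ← add_mul, ← mul_assoc,
    ENNReal.inv_mul_cancel, one_mul]
  · have := fiber_zero_pos p qs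
    simp only [ne_eq, add_eq_zero, Nat.cast_eq_zero]
    omega
  · simp

theorem map_elimRow_seqSample (j : ℕ) :
    (seqSample (List.replicate (j + 1) (kernelDist n qs))).map (elimRow p) =
      seqSample (List.replicate j (kernelDist n (p :: qs))) := by
  ext L
  rw [map_apply_eq_expect, expect_elimRow p qs j fun L' => if L' = L then 1 else 0,
    ← map_apply_eq_expect _ fun L' => L']
  exact congrFun (congrArg _ (PMF.map_id _)) L

/-- Elimination for several vectors. -/
def elimRows (ps : List (Bits n)) (L : List (Bits n)) : List (Bits n) :=
  ps.foldl (fun L p => elimRow p L) L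

theorem map_elimRows_seqSample (ps : List (Bits n)) (j : ℕ) :
    (seqSample (List.replicate (j + ps.length) (kernelDist n qs))).map (elimRows ps) =
      seqSample (List.replicate j (kernelDist n (ps.reverse ++ qs))) := by
  induction ps generalizing qs with
  | nil => exact PMF.map_id _
  | cons p ps ih =>
    have := ih (p :: qs)
    rw [← map_elimRow_seqSample, PMF.map_comp] at this
    simp only [List.length_cons, List.reverse_cons, List.append_assoc, List.singleton_append]
    exact this

/-- Each vector of `ps` costs one column, so `k + ps.length` columns leave the required `k`; any
further ones are ignored by `ofCols`. -/
theorem orthMatrixDist_bind_elimRows {γ : Type} (ps : List (Bits n)) {k q : ℕ}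
    (hq : k + ps.length ≤ q) (g : Matrix (Fin n) (Fin k) Bit → PMF γ) :
    ((orthMatrixDist n q qs).bind fun M => g (ofCols k (elimRows ps (colsList M)))) =
      (orthMatrixDist n k (qs ++ ps)).bind g := by
  obtain ⟨d, rfl⟩ : ∃ d, q = k + d + ps.length := ⟨q - k - ps.length, by omega⟩
  have h1 : orthMatrixDist n k (qs ++ ps) = orthMatrixDist n k (ps.reverse ++ qs) :=
    uniformSubjectTo_congr fun M => by simp [or_comm]
  rw [h1, orthMatrixDist_eq n k d, ← map_elimRows_seqSample, ← map_colsList_orthMatrixDist,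
    PMF.map_comp, PMF.map_comp, PMF.bind_map]
  rfl

end Elimination

/-! ### Column elimination by a circuit -/

section ElimCircuit

variable {n q : ℕ}

/-- The column `c` of the matrix stored in the registers. -/
def colReg (n q : ℕ) (ρ : Registers) (c : ℕ) : Bits n := fun i => ρ (i * q + c)

/-- Add the column `c` to the column `d` if the register `flag` holds `1`. -/
def addColOps (n q flag tmp c d : ℕ) : List Op :=
  (List.range n).flatMap fun i =>
    [.and tmp flag (i * q + c), .xor (i * q + d) (i * q + d) tmp]

theorem length_addColOps (flag tmp c d : ℕ) : (addColOps n q flag tmp c d).length = n * 2 := by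
  simp [addColOps, List.length_flatMap]

theorem dst_of_mem_addColOps {flag tmp c d : ℕ} {o : Op} (h : o ∈ addColOps n q flag tmp c d) :
    o.dst = tmp ∨ ∃ i < n, o.dst = i * q + d := by
  simp only [addColOps, List.mem_flatMap, List.mem_range, List.mem_cons, List.not_mem_nil,
    or_false] at h
  obtain ⟨i, hi, rfl | rfl⟩ := h
  · exact Or.inl rfl
  · exact Or.inr ⟨i, hi, rfl⟩

theorem mul_add_inj {i j c d : ℕ} (hc : c < q) (hd : d < q) (h : i * q + c = j * q + d) :
    i = j ∧ c = d := by
  have h1 := congrArg (· / q) h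
  have h2 := congrArg (· % q) h
  simp only [mul_comm _ q, Nat.mul_add_mod, Nat.mod_eq_of_lt hc, Nat.mod_eq_of_lt hd] at h2
  simp only [mul_comm _ q, Nat.mul_add_div (Nat.zero_lt_of_lt hc), Nat.div_eq_of_lt hc,
    Nat.div_eq_of_lt hd, add_zero] at h1
  exact ⟨h1, h2⟩

theorem mul_add_lt_of_lt {i c : ℕ} (hi : i < n) (hc : c < q) : i * q + c < n * q :=
  mul_add_lt (⟨i, hi⟩ : Fin n) (⟨c, hc⟩ : Fin q)

theorem evals_addColOps {flag tmp c d : ℕ} (hft : flag ≠ tmp) (hf : n * q ≤ flag)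
    (ht : n * q ≤ tmp) (hc : c < q) (hd : d < q) (hcd : c ≠ d) (ρ : Registers) :
    colReg n q (evals (addColOps n q flag tmp c d) ρ) d =
      colReg n q ρ d + ρ flag • colReg n q ρ c := by
  -- Invariant after the first `a` rows: exactly these have been updated, and flag and source column
  -- are intact.
  have main : ∀ a ≤ n, ∀ i, i < n → evals ((List.range a).flatMap fun i =>
      [.and tmp flag (i * q + c), .xor (i * q + d) (i * q + d) tmp]) ρ (i * q + d) =
      if i < a then ρ (i * q + d) + ρ flag * ρ (i * q + c) else ρ (i * q + d) := by
    intro a ha i hi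
    induction a generalizing i with
    | zero => simp
    | succ a ih =>
      have hframe : ∀ r, r ≠ tmp → (∀ i < n, r ≠ i * q + d) →
          evals ((List.range a).flatMap fun i =>
            [.and tmp flag (i * q + c), .xor (i * q + d) (i * q + d) tmp]) ρ r = ρ r := by
        intro r h1 h2
        refine evals_of_notMem fun o ho => ?_
        simp only [List.mem_flatMap, List.mem_range, List.mem_cons, List.not_mem_nil,
          or_false] at ho
        obtain ⟨i, hi, rfl | rfl⟩ := ho
        · exact h1
        · exact h2 i (by omega)
      have hlt : ∀ i < n, ∀ c < q, i * q + c < n * q := fun i hi c hc => mul_add_lt_of_lt hi hc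
      have hne : ∀ i < n, i * q + d ≠ tmp := fun i hi => by have := hlt i hi d hd; omega
      rw [List.range_succ, List.flatMap_append, evals_append]
      simp only [List.flatMap_cons, List.flatMap_nil, List.append_nil, evals_cons, evals_nil,
        Op.eval]
      have hflag := hframe flag hft fun j hj => by have := hlt j hj d hd; omega
      have hcol := hframe (a * q + c) (by have := hlt a ha c hc; omega)
        fun j hj h => hcd (mul_add_inj hc hd h).2
      by_cases hia : i = a
      · subst hia
        rw [Function.update_self, Function.update_of_ne (hne i hi), Function.update_self, hflag,
          hcol, ih (by omega) i hi]
        simp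
      · have : i * q + d ≠ a * q + d := fun h => hia (mul_add_inj hd hd h).1
        rw [Function.update_of_ne this, Function.update_of_ne (hne i hi), ih (by omega) i hi]
        have : i < a + 1 ↔ i < a := by omega
        simp only [this]
  funext i
  have := main n le_rfl i i.2
  rw [if_pos i.2] at this
  exact this

theorem evals_addColOps_of_ne {flag tmp c d r : ℕ} (ht : r ≠ tmp) (hr : ∀ i < n, r ≠ i * q + d)
    (ρ : Registers) : evals (addColOps n q flag tmp c d) ρ r = ρ r := by
  refine evals_of_notMem fun o ho => ?_
  rcases dst_of_mem_addColOps ho with h | ⟨i, hi, h⟩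
  · rw [h]; exact ht
  · rw [h]; exact hr i hi

theorem colReg_evals_addColOps_of_ne {flag tmp c d e : ℕ} (ht : n * q ≤ tmp) (hd : d < q)
    (he : e < q) (hed : e ≠ d) (ρ : Registers) :
    colReg n q (evals (addColOps n q flag tmp c d) ρ) e = colReg n q ρ e := by
  funext i
  refine evals_addColOps_of_ne ?_ (fun j hj h => hed (mul_add_inj he hd h).2) ρ
  have := mul_add_lt_of_lt i.2 he
  omega

/-- The entry of an affine block that computes `b` plus the product of `p` with the column `c`. -/
def dotEntry (q d : ℕ) (b : Bit) (p : Bits n) (c : ℕ) : ℕ × Bit × List ℕ :=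
  (d, b, ((List.finRange n).filter fun i => p i = 1).map fun i : Fin n => (i : ℕ) * q + c)

theorem affineValue_dotEntry (d : ℕ) (b : Bit) (p : Bits n) (c : ℕ) (ρ : Registers) :
    affineValue ρ (dotEntry q d b p c) = b + p ⬝ᵥ colReg n q ρ c := by
  simp only [affineValue, dotEntry, List.map_map]
  congr 1
  have : (ρ ∘ fun i : Fin n => (i : ℕ) * q + c) = colReg n q ρ c := rfl
  rw [this, dotProduct, ← List.sum_ofFn, List.ofFn_eq_map]
  induction List.finRange n with
  | nil => rfl
  | cons j l ih =>
    rw [List.map_cons, List.sum_cons, ← ih]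
    rcases Bit.eq_zero_or_one (p j) with hj | hj <;> simp [hj]

/-- One step of the elimination, with the carry in the column `w`. -/
def elimStepOps (q : ℕ) (p : Bits n) (w c : ℕ) : List Op :=
  affineBlock [dotEntry q (n * q) 1 p w, dotEntry q (n * q + 1) 0 p c] ++
  ([.and (n * q) (n * q) (n * q + 1)] ++
  (addColOps n q (n * q) (n * q + 2) c w ++ addColOps n q (n * q + 1) (n * q + 2) w c))

theorem length_elimStepOps_le (p : Bits n) (w c : ℕ) : (elimStepOps q p w c).length ≤ 6 * n + 3 := by
  simp only [elimStepOps, List.length_append, length_addColOps, List.length_singleton]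
  have := length_affineBlock_le (L := [dotEntry q (n * q) 1 p w, dotEntry q (n * q + 1) 0 p c])
    (c := n) (by
      intro e he
      have h : ∀ d b c, (dotEntry q d b p c).2.2.length ≤ n := by
        intro d b c
        simp only [dotEntry, List.length_map]
        exact (List.length_filter_le _ _).trans (by simp)
      simp only [List.mem_cons, List.not_mem_nil, or_false] at he
      rcases he with rfl | rfl <;> exact h _ _ _)
  simp only [List.length_cons, List.length_nil] at this
  omega

theorem dst_of_mem_elimStepOps {p : Bits n} {w c : ℕ} (hw : w < q) (hc : c < q) {o : Op}
    (h : o ∈ elimStepOps q p w c) : o.dst < n * q + 3 := by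
  simp only [elimStepOps, List.mem_append] at h
  rcases h with h | h | h | h
  · have := dst_of_mem_affineBlock h
    simp only [dotEntry, List.map_cons, List.map_nil, List.mem_cons, List.not_mem_nil,
      or_false] at this
    omega
  · simp only [List.mem_singleton] at h
    subst h
    simp [Op.dst]
  · rcases dst_of_mem_addColOps h with h | ⟨i, hi, h⟩
    · omega
    · have := mul_add_lt_of_lt hi hw; omega
  · rcases dst_of_mem_addColOps h with h | ⟨i, hi, h⟩
    · omega
    · have := mul_add_lt_of_lt hi hc; omega

/-- Both flags are computed before any column changes: register `n * q` decides whether `c` is added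
to the carry, register `n * q + 1` whether the new carry is added to `c`. This is one unfolding of
`elimWith`. -/
theorem evals_elimStepOps {p : Bits n} {w c : ℕ} (hw : w < q) (hc : c < q) (hwc : w ≠ c)
    (ρ : Registers) :
    colReg n q (evals (elimStepOps q p w c) ρ) w = colReg n q ρ w +
        ((1 + p ⬝ᵥ colReg n q ρ w) * (p ⬝ᵥ colReg n q ρ c)) • colReg n q ρ c ∧
      colReg n q (evals (elimStepOps q p w c) ρ) c = colReg n q ρ c +
        (p ⬝ᵥ colReg n q ρ c) • (colReg n q ρ w +
          ((1 + p ⬝ᵥ colReg n q ρ w) * (p ⬝ᵥ colReg n q ρ c)) • colReg n q ρ c) ∧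
      ∀ e < q, e ≠ w → e ≠ c → colReg n q (evals (elimStepOps q p w c) ρ) e = colReg n q ρ e := by
  obtain ⟨ρ₁, hρ₁⟩ : ∃ ρ₁, ρ₁ =
    evals (affineBlock [dotEntry q (n * q) 1 p w, dotEntry q (n * q + 1) 0 p c]) ρ := ⟨_, rfl⟩
  have h1 : ρ₁ = writeBits [n * q, n * q + 1]
      [1 + p ⬝ᵥ colReg n q ρ w, 0 + p ⬝ᵥ colReg n q ρ c] ρ := by
    rw [hρ₁, evals_affineBlock]
    · simp only [List.map_cons, List.map_nil, affineValue_dotEntry]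
      rfl
    · intro e he e' he'
      have hd : ∀ d b c, c < q → ∀ r ∈ (dotEntry q d b p c).2.2, r < n * q := by
        intro d b c hc r hr
        simp only [dotEntry, List.mem_map] at hr
        obtain ⟨i, -, rfl⟩ := hr
        exact mul_add_lt_of_lt i.2 hc
      have hge : n * q ≤ e.1 := by
        simp only [List.mem_cons, List.not_mem_nil, or_false] at he
        rcases he with rfl | rfl <;> simp [dotEntry]
      simp only [List.mem_cons, List.not_mem_nil, or_false] at he'
      intro h
      rcases he' with rfl | rfl
      · exact absurd (hd _ _ _ hw _ h) (by omega)
      · exact absurd (hd _ _ _ hc _ h) (by omega)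
  obtain ⟨ρ₂, hρ₂⟩ : ∃ ρ₂, ρ₂ = evals [.and (n * q) (n * q) (n * q + 1)] ρ₁ := ⟨_, rfl⟩
  have ha : ρ₂ (n * q) = (1 + p ⬝ᵥ colReg n q ρ w) * (p ⬝ᵥ colReg n q ρ c) := by
    rw [hρ₂, h1]
    simp [Op.eval, writeBits]
  have hb : ρ₂ (n * q + 1) = p ⬝ᵥ colReg n q ρ c := by
    rw [hρ₂, h1]
    simp [Op.eval, writeBits]
  have hcol : ∀ e < q, colReg n q ρ₂ e = colReg n q ρ e := by
    intro e he
    funext i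
    have := mul_add_lt_of_lt i.2 he
    simp only [colReg, hρ₂, h1]
    rw [evals_of_notMem, writeBits_of_notMem]
    · simp only [List.mem_cons, List.not_mem_nil, or_false]
      omega
    · intro o ho
      simp only [List.mem_singleton] at ho
      subst ho
      simp only [Op.dst]
      omega
  obtain ⟨ρ₃, hρ₃⟩ : ∃ ρ₃, ρ₃ = evals (addColOps n q (n * q) (n * q + 2) c w) ρ₂ := ⟨_, rfl⟩
  have hw₃ : colReg n q ρ₃ w = colReg n q ρ w +
      ((1 + p ⬝ᵥ colReg n q ρ w) * (p ⬝ᵥ colReg n q ρ c)) • colReg n q ρ c := by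
    rw [hρ₃, evals_addColOps (by omega) le_rfl (by omega) hc hw hwc.symm, ha, hcol w hw, hcol c hc]
  have hne₃ : ∀ e < q, e ≠ w → colReg n q ρ₃ e = colReg n q ρ e := by
    intro e he hew
    rw [hρ₃, colReg_evals_addColOps_of_ne (by omega) hw he hew, hcol e he]
  have hb₃ : ρ₃ (n * q + 1) = p ⬝ᵥ colReg n q ρ c := by
    rw [hρ₃, evals_addColOps_of_ne (by omega), hb]
    intro i hi
    have := mul_add_lt_of_lt hi hw
    omega
  have hfin : evals (elimStepOps q p w c) ρ =
      evals (addColOps n q (n * q + 1) (n * q + 2) w c) ρ₃ := by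
    rw [elimStepOps, evals_append, ← hρ₁, evals_append, ← hρ₂, evals_append, ← hρ₃]
  rw [hfin]
  refine ⟨?_, ?_, fun e he hew hec => ?_⟩
  · rw [colReg_evals_addColOps_of_ne (by omega) hc hw hwc, hw₃]
  · rw [evals_addColOps (by omega) (by omega) (by omega) hw hc hwc, hb₃, hw₃, hne₃ c hc hwc.symm]
  · rw [colReg_evals_addColOps_of_ne (by omega) hc he hec, hne₃ e he hew]

/-- The elimination with the carry in the column `w` for a list of columns. -/
def elimWithOps (q : ℕ) (p : Bits n) (w : ℕ) (cs : List ℕ) : List Op :=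
  cs.flatMap (elimStepOps q p w)

theorem evals_elimWithOps {p : Bits n} {w : ℕ} (hw : w < q) {cs : List ℕ} (hcs : ∀ c ∈ cs, c < q)
    (hwcs : w ∉ cs) (hnd : cs.Nodup) (ρ : Registers) :
    cs.map (colReg n q (evals (elimWithOps q p w cs) ρ)) =
        elimWith p (colReg n q ρ w) (cs.map (colReg n q ρ)) ∧
      ∀ e < q, e ≠ w → e ∉ cs →
        colReg n q (evals (elimWithOps q p w cs) ρ) e = colReg n q ρ e := by
  induction cs generalizing ρ with
  | nil => exact ⟨rfl, fun _ _ _ _ => rfl⟩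
  | cons c cs ih =>
    rw [List.mem_cons, not_or] at hwcs
    rw [List.nodup_cons] at hnd
    obtain ⟨h1, h2, h3⟩ := evals_elimStepOps (p := p) hw (hcs c List.mem_cons_self) hwcs.1 ρ
    obtain ⟨g1, g2⟩ := ih (fun c hc => hcs c (List.mem_cons_of_mem _ hc)) hwcs.2 hnd.2
      (evals (elimStepOps q p w c) ρ)
    have e1 : cs.map (colReg n q (evals (elimStepOps q p w c) ρ)) = cs.map (colReg n q ρ) := by
      refine List.map_congr_left fun e he => h3 e (hcs e (List.mem_cons_of_mem _ he)) ?_ ?_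
      · rintro rfl; exact hwcs.2 he
      · rintro rfl; exact hnd.1 he
    have e2 : evals (elimWithOps q p w (c :: cs)) ρ =
        evals (elimWithOps q p w cs) (evals (elimStepOps q p w c) ρ) := by
      rw [elimWithOps, List.flatMap_cons, evals_append]
      rfl
    rw [e2]
    constructor
    · rw [List.map_cons, g1, g2 c (hcs c List.mem_cons_self) (Ne.symm hwcs.1) hnd.1, h2, e1, h1,
        List.map_cons, elimWith]
    · intro e he hew hec
      rw [List.mem_cons, not_or] at hec
      rw [g2 e he hew hec.2, h3 e he hew hec.1]

/-- The elimination for a list of vectors, starting with the carry in the column `j`. -/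
def elimRowsOps (q : ℕ) : List (Bits n) → ℕ → List Op
  | [], _ => []
  | p :: ps, j => elimWithOps q p j (List.range' (j + 1) (q - (j + 1))) ++ elimRowsOps q ps (j + 1)

/-- Each vector sacrifices the leftmost remaining column as its carry, so the result starts
`ps.length` columns further right. -/
theorem evals_elimRowsOps (ps : List (Bits n)) {j : ℕ} (hj : j + ps.length ≤ q) (ρ : Registers) :
    (List.range' (j + ps.length) (q - (j + ps.length))).map
        (colReg n q (evals (elimRowsOps q ps j) ρ)) =
      elimRows ps ((List.range' j (q - j)).map (colReg n q ρ)) := by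
  induction ps generalizing j ρ with
  | nil => rfl
  | cons p ps ih =>
    rw [List.length_cons] at hj
    have h1 : q - j = (q - (j + 1)) + 1 := by omega
    rw [elimRowsOps, evals_append, List.length_cons,
      show j + (ps.length + 1) = j + 1 + ps.length by omega, ih (by omega), h1, List.range'_succ,
      List.map_cons, elimRows, elimRows, List.foldl_cons, elimRow]
    rw [(evals_elimWithOps (by omega) (fun c hc => by rw [List.mem_range'_1] at hc; omega)
      (fun h => by rw [List.mem_range'_1] at h; omega) List.nodup_range' ρ).1]

theorem dst_of_mem_elimRowsOps {ps : List (Bits n)} {j : ℕ} (hj : j + ps.length ≤ q) {o : Op}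
    (h : o ∈ elimRowsOps q ps j) : o.dst < n * q + 3 := by
  induction ps generalizing j with
  | nil => simp [elimRowsOps] at h
  | cons p ps ih =>
    rw [List.length_cons] at hj
    rw [elimRowsOps, List.mem_append] at h
    rcases h with h | h
    · obtain ⟨c, hc, h⟩ := List.mem_flatMap.1 h
      rw [List.mem_range'_1] at hc
      exact dst_of_mem_elimStepOps (by omega) (by omega) h
    · exact ih (by omega) h

theorem length_elimRowsOps_le (ps : List (Bits n)) (j : ℕ) :
    (elimRowsOps q ps j).length ≤ ps.length * (q * (6 * n + 3)) := by
  induction ps generalizing j with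
  | nil => simp [elimRowsOps]
  | cons p ps ih =>
    rw [elimRowsOps, List.length_append, List.length_cons, add_mul, one_mul, add_comm]
    refine add_le_add (ih _) ?_
    rw [elimWithOps, List.length_flatMap]
    refine (List.sum_le_card_nsmul _ (6 * n + 3) ?_).trans ?_
    · intro x hx
      obtain ⟨c, -, rfl⟩ := List.mem_map.1 hx
      exact length_elimStepOps_le _ _ _
    · rw [List.length_map, List.length_range', smul_eq_mul]
      exact Nat.mul_le_mul_right _ (Nat.sub_le _ _)

end ElimCircuit

/-! ### Replacing the key by a uniform matrix, under the planted XOR assumption -/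

section PlantedXOR

variable {n k m : ℕ}

/-- The distribution of a row of the parity check matrix. -/
def rowDist (n t : ℕ) : PMF (Bits n) := uniformSubjectTo fun s : Bits n => hammingNorm s = t

/-- The rows of `P` are independent, and `G` depends on `P` only through the orthogonality
conditions; this prepares adding rows one by one. -/
theorem keyGen_bind {γ : Type} (t r : ℕ) (f : Matrix (Fin n) (Fin k) Bit → PMF γ) :
    ((keyGen n k t r).bind fun key => f key.2) =
      (iid (rowDist n t) r).bind fun P => (orthMatrixDist n k (List.ofFn P)).bind f := by
  rw [rowDist, ← uniformSubjectTo_forall, keyGen]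
  simp only [PMF.bind_bind, PMF.pure_bind]
  have h : ∀ P : Matrix (Fin r) (Fin n) Bit,
      (uniformSubjectTo fun G : Matrix (Fin n) (Fin k) Bit => P * G = 0) =
        orthMatrixDist n k (List.ofFn P) := by
    intro P
    refine uniformSubjectTo_congr fun G => ?_
    constructor
    · intro h p hp
      obtain ⟨i, rfl⟩ := List.mem_ofFn.1 hp
      rw [← Matrix.mul_apply_eq_vecMul, h]
      rfl
    · intro h
      funext i
      rw [Matrix.mul_apply_eq_vecMul]
      exact h _ (List.mem_ofFn.2 ⟨i, rfl⟩)
  simp only [h]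
  rfl

theorem orthMatrixDist_nil : orthMatrixDist n k [] = unif (Matrix (Fin n) (Fin k) Bit) := by
  classical
  ext G
  rw [orthMatrixDist, uniformSubjectTo_apply ⟨0, by simp⟩, unif_apply]
  simp [Finset.card_univ]

/-- A bound for the size of the reduction to the planted XOR problem. -/
def xorReductionSize (n k m r s : ℕ) : ℕ :=
  r * ((k + r) * (6 * n + 3)) + reductionSize n k m s

/-- The instance is a matrix with `k + r` columns whose planted relation, if there is one, is the
new row `p`. Eliminating with the known rows `ps` yields `k` columns that are uniform subject to `p
:: ps` in the planted case and to `ps` in the uniform case. -/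
theorem close_orthMatrixDist_cons (C : Circuit GameOracle) (out : ℕ) (η : unitInterval)
    {s t r T : ℕ} (hs : C.size ≤ s) (hT : xorReductionSize n k m r s ≤ T) (ps : List (Bits n))
    (hps : ps.length ≤ r) :
    Close (ENNReal.ofReal (distInSec T (xorPlanted n (k + r) t) (xorUniform n (k + r))))
      (((rowDist n t).bind fun p => (orthMatrixDist n k (p :: ps)).bind
        fun G => linGame (m := m) C out η G) 1)
      (((orthMatrixDist n k ps).bind fun G => linGame (m := m) C out η G) 1) := by
  obtain ⟨ε, hε⟩ : ∃ ε, ε = ENNReal.ofReal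
    (distInSec T (xorPlanted n (k + r) t) (xorUniform n (k + r))) := ⟨_, rfl⟩
  obtain ⟨q, hq⟩ : ∃ q, q = k + r := ⟨_, rfl⟩
  rw [← hε]
  have hcomm : ∀ X : PMF (Matrix (Fin n) (Fin k) Bit),
      (X.bind fun G => linGame (m := m) C out η G) =
      (seqSample ((encKinds C).map (linEntryDist n k m η))).bind fun ℓ =>
        X.bind fun G => padRun n k m C out (ℓ.map (LinEntry.toPad G)) := by
    intro X
    rw [PMF.bind_comm]
    rfl
  simp only [hcomm]
  rw [PMF.bind_comm]
  refine Close.bind_of_mem_support fun ℓ hℓ => ?_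
  have hlen : ℓ.length ≤ s := by
    rw [length_of_mem_support_seqSample hℓ, List.length_map]
    exact (length_encKinds_le C).trans ((length_le_size C).trans hs)
  -- The elimination needs three scratch registers behind the matrix, and its result begins at
  -- column `ps.length`.
  obtain ⟨D, hD, hans⟩ := exists_distinguisher (k := k) C out (n * q + 3) (k + 1)
    (elimRowsOps q ps 0) (ℓ.map (LinEntry.toAff q ps.length))
    (fun o ho => dst_of_mem_elimRowsOps (by omega) ho) (by
      intro p hp a ha
      obtain ⟨x, -, rfl⟩ := List.mem_map.1 hp
      obtain ⟨h1, h2⟩ := LinEntry.forms_toAff (by omega) x a ha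
      exact ⟨h1, fun r hr => (h2 r hr).trans_le (Nat.le_add_right _ _)⟩)
  have hDT : D.circuit.size ≤ T := by
    refine (hD.trans ?_).trans hT
    rw [xorReductionSize, add_assoc]
    refine add_le_add ((length_elimRowsOps_le _ _).trans ?_)
      (reduction_size_le (by rwa [List.length_map]) hs le_rfl)
    rw [hq]
    gcongr
  have hval : ∀ M : Matrix (Fin n) (Fin q) Bit, D.answer (matrixBits M) =
      padRun n k m C out (ℓ.map (LinEntry.toPad (ofCols k (elimRows ps (colsList M))))) := by
    intro M
    rw [hans _ (by simp [length_matrixBits]), List.map_map]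
    congr 1
    refine List.map_congr_left fun x _ => LinEntry.eval_toAff (fun i j => ?_) x
    have hcols : (List.range' 0 (q - 0)).map (colReg n q (inputRegs (matrixBits M))) =
        colsList M := by
      rw [Nat.sub_zero, List.range'_eq_map_range, List.map_map, colsList, List.ofFn_eq_map,
        ← List.map_coe_finRange_eq_range, List.map_map]
      refine List.map_congr_left fun c _ => funext fun i => ?_
      simp only [Function.comp_apply, colReg, zero_add]
      exact inputRegs_matrixBits M i c
    have h := evals_elimRowsOps (q := q) ps (j := 0) (by omega) (inputRegs (matrixBits M))
    rw [hcols] at h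
    rw [ofCols, ← h, List.getD_eq_getElem?_getD, List.getElem?_map, List.getElem?_range' (by omega)]
    simp [colReg]
  have hplanted : xorPlanted n q t = (rowDist n t).bind fun p =>
      (orthMatrixDist n q [p]).bind fun M => PMF.pure (matrixBits M) := by
    have h : ∀ p : Bits n, (uniformSubjectTo fun G : Matrix (Fin n) (Fin q) Bit => p ᵥ* G = 0) =
        orthMatrixDist n q [p] := fun p => uniformSubjectTo_congr fun G => by simp
    rw [xorPlanted]
    simp only [h]
    rfl
  have huniform : xorUniform n q = (orthMatrixDist n q []).bind fun M => PMF.pure (matrixBits M) := by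
    rw [orthMatrixDist_nil]
    rfl
  have := close_distInSec (X := xorPlanted n q t) (Y := xorUniform n q) D hDT
  rw [hq, ← hε, ← hq, hplanted, huniform] at this
  simp only [PMF.bind_bind, PMF.pure_bind, hval] at this
  have helim : ∀ qs, ((orthMatrixDist n q qs).bind fun M => padRun n k m C out
      (ℓ.map (LinEntry.toPad (ofCols k (elimRows ps (colsList M)))))) =
      (orthMatrixDist n k (qs ++ ps)).bind fun G => padRun n k m C out
        (ℓ.map (LinEntry.toPad G)) := fun qs =>
    orthMatrixDist_bind_elimRows qs ps (by omega) fun G => padRun n k m C out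
      (ℓ.map (LinEntry.toPad G))
  simpa only [helim, List.nil_append, List.singleton_append] using this

/-- Hybrid over the number of rows: with no row the matrix is uniform, with `r` rows it is the key.
-/
theorem close_keyGen_planted (C : Circuit GameOracle) (out : ℕ) (η : unitInterval)
    {s t r T : ℕ} (hs : C.size ≤ s) (hT : xorReductionSize n k m r s ≤ T) :
    Close (r * ENNReal.ofReal (distInSec T (xorPlanted n (k + r) t) (xorUniform n (k + r))))
      (((keyGen n k t r).bind fun key => linGame (m := m) C out η key.2) 1)
      (((unif (Matrix (Fin n) (Fin k) Bit)).bind fun G => linGame (m := m) C out η G) 1) := by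
  have main : ∀ j ≤ r, Close
      (j * ENNReal.ofReal (distInSec T (xorPlanted n (k + r) t) (xorUniform n (k + r))))
      (((iid (rowDist n t) j).bind fun P => (orthMatrixDist n k (List.ofFn P)).bind
        fun G => linGame (m := m) C out η G) 1)
      (((unif (Matrix (Fin n) (Fin k) Bit)).bind fun G => linGame (m := m) C out η G) 1) := by
    intro j hj
    induction j with
    | zero =>
      simp only [iid, PMF.pure_bind, List.ofFn_zero, orthMatrixDist_nil, Nat.cast_zero, zero_mul]
      exact Close.refl _
    | succ j ih =>
      have h1 := ih (by omega)
      have h2 : Close (ENNReal.ofReal (distInSec T (xorPlanted n (k + r) t) (xorUniform n (k + r))))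
          (((iid (rowDist n t) (j + 1)).bind fun P => (orthMatrixDist n k (List.ofFn P)).bind
            fun G => linGame (m := m) C out η G) 1)
          (((iid (rowDist n t) j).bind fun P => (orthMatrixDist n k (List.ofFn P)).bind
            fun G => linGame (m := m) C out η G) 1) := by
        rw [iid]
        simp only [PMF.bind_bind, PMF.pure_bind]
        rw [PMF.bind_comm]
        refine Close.bind fun P => ?_
        simp only [List.ofFn_cons]
        exact close_orthMatrixDist_cons C out η hs hT _ (by simp; omega)
      refine (h2.trans h1).mono ?_
      push_cast
      rw [add_mul, one_mul, add_comm]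
  rw [keyGen_bind t r fun G => linGame (m := m) C out η G]
  exact main r le_rfl

end PlantedXOR

/-! ### Characters of the space of bit strings -/

/-- The sign `(-1) ^ a`. -/
def sgn (a : Bit) : ℝ := if a = 0 then 1 else -1

theorem sgn_zero : sgn 0 = 1 := if_pos rfl

theorem sgn_one : sgn 1 = -1 := if_neg (by decide)

theorem sgn_add (a b : Bit) : sgn (a + b) = sgn a * sgn b := by
  rcases Bit.eq_zero_or_one a with rfl | rfl <;> rcases Bit.eq_zero_or_one b with rfl | rfl <;>
    simp [sgn, show (1 : Bit) + 1 = 0 by decide]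

theorem sgn_sum {ι : Type} (s : Finset ι) (f : ι → Bit) :
    sgn (∑ i ∈ s, f i) = ∏ i ∈ s, sgn (f i) := by
  classical
  induction s using Finset.induction_on with
  | empty => simp [sgn_zero]
  | insert a s ha ih => rw [Finset.sum_insert ha, Finset.prod_insert ha, sgn_add, ih]

theorem sgn_mul_self (a : Bit) : sgn a * sgn a = 1 := by
  rcases Bit.eq_zero_or_one a with rfl | rfl <;> simp [sgn]

theorem abs_sgn (a : Bit) : |sgn a| = 1 := by
  rcases Bit.eq_zero_or_one a with rfl | rfl <;> simp [sgn]

theorem one_add_sgn (a : Bit) : 1 + sgn a = if a = 0 then 2 else 0 := by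
  rcases Bit.eq_zero_or_one a with rfl | rfl <;> norm_num [sgn]

section Orthogonal

variable {n : ℕ}

/-- The vectors orthogonal to the given ones. -/
def orthSet (ps : List (Bits n)) : Finset (Bits n) :=
  Finset.univ.filter fun c => ∀ p ∈ ps, p ⬝ᵥ c = 0

theorem mem_orthSet {ps : List (Bits n)} {c : Bits n} : c ∈ orthSet ps ↔ ∀ p ∈ ps, p ⬝ᵥ c = 0 := by
  simp [orthSet]

/-- The sum of the character of `q` over the vectors orthogonal to `ps`. -/
def orthSum (ps : List (Bits n)) (q : Bits n) : ℝ := ∑ c ∈ orthSet ps, sgn (q ⬝ᵥ c)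

theorem card_orthSet_pos (ps : List (Bits n)) : 0 < ((orthSet ps).card : ℝ) := by
  have : (0 : Bits n) ∈ orthSet ps := mem_orthSet.2 fun p _ => dotProduct_zero p
  exact_mod_cast Finset.card_pos.2 ⟨0, this⟩

/-- A character of a group is trivial or sums to zero, as translation by an element where it is `-1`
shows. -/
theorem orthSum_eq_or (ps : List (Bits n)) (q : Bits n) :
    (∀ c ∈ orthSet ps, q ⬝ᵥ c = 0) ∧ orthSum ps q = (orthSet ps).card ∨ orthSum ps q = 0 := by
  by_cases h : ∀ c ∈ orthSet ps, q ⬝ᵥ c = 0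
  · left
    refine ⟨h, ?_⟩
    rw [orthSum, Finset.sum_congr rfl fun c hc => by rw [h c hc, sgn_zero]]
    simp
  · right
    push Not at h
    obtain ⟨d, hd, hqd⟩ := h
    have hqd' : q ⬝ᵥ d = 1 := (Bit.eq_zero_or_one _).resolve_left hqd
    have hadd : ∀ c ∈ orthSet ps, c + d ∈ orthSet ps := fun c hc => mem_orthSet.2 fun p hp => by
      rw [dotProduct_add, mem_orthSet.1 hc p hp, mem_orthSet.1 hd p hp, add_zero]
    have : orthSum ps q = -orthSum ps q := by
      rw [orthSum, ← Finset.sum_neg_distrib]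
      refine Finset.sum_bij' (fun c _ => c + d) (fun c _ => c + d) hadd hadd
        (fun c _ => bits_add_cancel c d) (fun c _ => bits_add_cancel c d) fun c _ => ?_
      rw [dotProduct_add, sgn_add, hqd', sgn_one]
      ring
    linarith

theorem orthSum_nonneg (ps : List (Bits n)) (q : Bits n) : 0 ≤ orthSum ps q := by
  rcases orthSum_eq_or ps q with h | h
  · rw [h.2]; positivity
  · rw [h]

theorem card_orthSet_cons (p : Bits n) (ps : List (Bits n)) :
    ((orthSet (p :: ps)).card : ℝ) = ((orthSet ps).card + orthSum ps p) / 2 := by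
  have h : orthSet (p :: ps) = (orthSet ps).filter fun c => p ⬝ᵥ c = 0 := by
    ext c
    simp [mem_orthSet, and_comm]
  have h2 : ((orthSet ps).card : ℝ) + orthSum ps p = ∑ c ∈ orthSet ps, (1 + sgn (p ⬝ᵥ c)) := by
    rw [Finset.sum_add_distrib]
    simp [orthSum]
  rw [h2, h, Finset.card_filter]
  simp only [one_add_sgn, Nat.cast_sum, Nat.cast_ite, Nat.cast_one, Nat.cast_zero]
  rw [Finset.sum_div]
  refine Finset.sum_congr rfl fun c _ => ?_
  split_ifs <;> norm_num

theorem orthSum_cons (p q : Bits n) (ps : List (Bits n)) :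
    orthSum (p :: ps) q = (orthSum ps q + orthSum ps (p + q)) / 2 := by
  have h : orthSet (p :: ps) = (orthSet ps).filter fun c => p ⬝ᵥ c = 0 := by
    ext c
    simp [mem_orthSet, and_comm]
  rw [orthSum, h, Finset.sum_filter, orthSum, orthSum, ← Finset.sum_add_distrib, Finset.sum_div]
  refine Finset.sum_congr rfl fun c _ => ?_
  rw [add_dotProduct, sgn_add]
  rcases Bit.eq_zero_or_one (p ⬝ᵥ c) with h | h <;> simp [h, sgn_zero, sgn_one]

/-- Each linear condition at most halves the space. -/
theorem two_pow_le_card_orthSet (ps : List (Bits n)) :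
    (2 : ℝ) ^ n ≤ 2 ^ ps.length * (orthSet ps).card := by
  induction ps with
  | nil =>
    have : (orthSet ([] : List (Bits n))).card = 2 ^ n := by
      rw [← card_bits n, ← Finset.card_univ]
      congr 1
      ext c
      simp [mem_orthSet]
    rw [this]
    simp
  | cons p ps ih =>
    rw [card_orthSet_cons, List.length_cons, pow_succ]
    have := mul_nonneg (pow_nonneg zero_le_two ps.length : (0 : ℝ) ≤ 2 ^ ps.length)
      (orthSum_nonneg ps p)
    linarith

/-- With `A` the size of the kernel and `a`, `b`, `d` the character sums at `p`, `p'`, `p + p'`,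
each `0` or `A`, this reads `A (A + a + b + d) ≤ (1 + d / A) (A + a) (A + b)`. If `d = A` then `a =
b`; if `d = 0` then `a` and `b` are not both `A`, so `a b = 0` and equality holds. -/
theorem card_mul_card_orthSet_le (p p' : Bits n) (ps : List (Bits n)) :
    ((orthSet ps).card : ℝ) * (orthSet (p :: p' :: ps)).card ≤
      (1 + orthSum ps (p + p') / (orthSet ps).card) *
        ((orthSet (p :: ps)).card * (orthSet (p' :: ps)).card) := by
  have hA := card_orthSet_pos ps
  rw [card_orthSet_cons p (p' :: ps), card_orthSet_cons p ps, card_orthSet_cons p' ps, orthSum_cons,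
    add_comm p' p]
  obtain ⟨A, hAdef⟩ : ∃ A : ℝ, A = (orthSet ps).card := ⟨_, rfl⟩
  rw [← hAdef] at hA ⊢
  have hd : (∀ c ∈ orthSet ps, p ⬝ᵥ c = p' ⬝ᵥ c) ∧ orthSum ps (p + p') = A ∨
      orthSum ps (p + p') = 0 := by
    rcases orthSum_eq_or ps (p + p') with h | h
    · refine Or.inl ⟨fun c hc => ?_, h.2.trans hAdef.symm⟩
      have := h.1 c hc
      rw [add_dotProduct] at this
      exact CharTwo.add_eq_zero.1 this
    · exact Or.inr h
  rcases hd with ⟨h, hd⟩ | hd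
  · have hab : orthSum ps p' = orthSum ps p := by
      rw [orthSum, orthSum]
      exact Finset.sum_congr rfl fun c hc => by rw [h c hc]
    have ha := orthSum_nonneg ps p
    rw [hd, hab, div_self hA.ne']
    nlinarith
  · rw [hd]
    rcases orthSum_eq_or ps p with h | h
    · rcases orthSum_eq_or ps p' with h' | h'
      · exfalso
        have : orthSum ps (p + p') = A := by
          rw [hAdef, orthSum, Finset.sum_congr rfl fun c hc => by
            rw [add_dotProduct, h.1 c hc, h'.1 c hc, add_zero, sgn_zero]]
          simp
        rw [hd] at this
        exact hA.ne this
      · rw [h']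
        exact le_of_eq (by ring)
    · rw [h]
      exact le_of_eq (by ring)

/-- The quotient is the indicator that `q` vanishes on the kernel, hence `0` or `1`. -/
theorem one_add_pow_le (ps : List (Bits n)) (q : Bits n) (k : ℕ) :
    (1 + orthSum ps q / (orthSet ps).card) ^ k ≤
      1 + 2 ^ k * (orthSum ps q / (orthSet ps).card) := by
  rcases orthSum_eq_or ps q with h | h
  · rw [h.2, div_self (card_orthSet_pos ps).ne']
    norm_num
  · rw [h]; simp

/-- The product of the factors `1 + sgn` is `2 ^ ps.length` times the indicator of the kernel, whose
size is at least `2 ^ (n - ps.length)`. The bound is then averaged over random `ps`. -/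
theorem orthSum_div_card_le (ps : List (Bits n)) (q : Bits n) :
    orthSum ps q / (orthSet ps).card ≤
      (2 ^ n)⁻¹ * ∑ c : Bits n, (ps.map fun p => 1 + sgn (p ⬝ᵥ c)).prod * sgn (q ⬝ᵥ c) := by
  have h : ∀ c : Bits n, (ps.map fun p => 1 + sgn (p ⬝ᵥ c)).prod =
      if c ∈ orthSet ps then 2 ^ ps.length else 0 := by
    intro c
    induction ps with
    | nil => simp [mem_orthSet]
    | cons p ps ih =>
      rw [List.map_cons, List.prod_cons, ih, one_add_sgn]
      by_cases hp : p ⬝ᵥ c = 0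
      · simp [mem_orthSet, hp, pow_succ, mul_comm]
      · simp [mem_orthSet, hp]
  simp only [h, ite_mul, zero_mul]
  rw [Finset.sum_ite_mem, Finset.univ_inter, ← Finset.mul_sum, div_le_iff₀ (card_orthSet_pos ps)]
  have h1 := two_pow_le_card_orthSet ps
  have h2 := orthSum_nonneg ps q
  change orthSum ps q ≤ (2 ^ n)⁻¹ * (2 ^ ps.length * orthSum ps q) * _
  rw [inv_mul_eq_div, div_mul_eq_mul_div, le_div_iff₀ (by positivity)]
  nlinarith

end Orthogonal

/-! ### Distributions close to uniform in the second moment -/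

theorem sum_toReal_eq_one {α : Type} [Fintype α] (D : PMF α) : ∑ a, (D a).toReal = 1 := by
  rw [← ENNReal.toReal_sum fun a _ => D.apply_ne_top a, ← tsum_fintype (L := .unconditional α),
    D.tsum_coe, ENNReal.toReal_one]

theorem toReal_bind_apply {α β : Type} [Fintype α] (D : PMF α) (f : α → PMF β) (b : β) :
    ((D.bind f) b).toReal = ∑ a, (D a).toReal * (f a b).toReal := by
  rw [PMF.bind_apply, tsum_fintype, ENNReal.toReal_sum fun a _ =>
    ENNReal.mul_ne_top (D.apply_ne_top a) ((f a).apply_ne_top b)]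
  simp only [ENNReal.toReal_mul]

theorem toReal_apply_le_one {β : Type} (D : PMF β) (b : β) : (D b).toReal ≤ 1 :=
  ENNReal.toReal_le_of_le_ofReal zero_le_one (by simpa using D.coe_le_one b)

theorem close_bind_of_sum_abs {α β : Type} [Fintype α] {D U : PMF α} (f : α → PMF β) (b : β)
    {ε : ℝ} (h : ∑ a, |(D a).toReal - (U a).toReal| ≤ ε) :
    Close (ENNReal.ofReal ε) ((D.bind f) b) ((U.bind f) b) := by
  refine close_of_abs_toReal_sub_le (PMF.apply_ne_top _ _) (PMF.apply_ne_top _ _) (le_trans ?_ h)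
  rw [toReal_bind_apply, toReal_bind_apply, ← Finset.sum_sub_distrib]
  refine (Finset.abs_sum_le_sum_abs _ _).trans (Finset.sum_le_sum fun a _ => ?_)
  rw [← sub_mul, abs_mul, abs_of_nonneg ENNReal.toReal_nonneg]
  exact mul_le_of_le_one_right (abs_nonneg _) (toReal_apply_le_one _ _)

/-- A distribution on `X` with small second moment is close to the uniform distribution on `X`. -/
theorem close_bind_of_sum_sq {α β : Type} [Fintype α] [DecidableEq α] {D U : PMF α} {X : Finset α}
    (hX : X.Nonempty) (hD : ∀ a ∉ X, D a = 0)
    (hU : ∀ a, (U a).toReal = if a ∈ X then (X.card : ℝ)⁻¹ else 0) {lam ε : ℝ} (hlam : 0 < lam)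
    (h : X.card * ∑ a, (D a).toReal ^ 2 ≤ 1 + ε) (f : α → PMF β) (b : β) :
    Close (ENNReal.ofReal (lam + ε / lam)) ((D.bind f) b) ((U.bind f) b) := by
  refine close_bind_of_sum_abs f b ?_
  have hM : (0 : ℝ) < X.card := by exact_mod_cast Finset.card_pos.2 hX
  obtain ⟨M, hMdef⟩ : ∃ M : ℝ, M = X.card := ⟨_, rfl⟩
  rw [← hMdef] at hM h
  simp only [← hMdef] at hU
  -- On `X` the bracket is `M x²` with `x` the deviation from `1 / M`, and `|x| ≤ lam / M + M x² /
  -- lam` by the inequality of means. Off `X` both laws vanish. Summing gives `lam + (M ∑ D² - 1) /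
  -- lam`.
  have key : ∀ a, |(D a).toReal - (U a).toReal| ≤
      lam * (U a).toReal + (M * (D a).toReal ^ 2 - 2 * (D a).toReal + (U a).toReal) / lam := by
    intro a
    by_cases ha : a ∈ X
    · rw [hU a, if_pos ha]
      obtain ⟨x, hx⟩ : ∃ x, x = (D a).toReal - M⁻¹ := ⟨_, rfl⟩
      have e : M * (D a).toReal ^ 2 - 2 * (D a).toReal + M⁻¹ = M * x ^ 2 := by
        rw [hx]; field_simp; ring
      rw [e, ← hx, ← sq_abs x]
      have h0 := abs_nonneg x
      obtain ⟨y, hy⟩ : ∃ y, y = |x| := ⟨_, rfl⟩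
      rw [← hy] at h0 ⊢
      have : lam * M⁻¹ + M * y ^ 2 / lam - y = (lam ^ 2 - lam * M * y + M ^ 2 * y ^ 2) / (lam * M) := by
        field_simp
        ring
      have h2 : 0 ≤ lam * M⁻¹ + M * y ^ 2 / lam - y := by
        rw [this]
        refine div_nonneg ?_ (by positivity)
        nlinarith [sq_nonneg (lam - M * y), mul_nonneg (mul_nonneg hlam.le hM.le) h0]
      linarith
    · rw [hU a, if_neg ha, hD a ha]
      simp
  refine (Finset.sum_le_sum fun a _ => key a).trans ?_
  rw [Finset.sum_add_distrib, ← Finset.mul_sum, ← Finset.sum_div, Finset.sum_add_distrib,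
    Finset.sum_sub_distrib, ← Finset.mul_sum, ← Finset.mul_sum, sum_toReal_eq_one,
    sum_toReal_eq_one]
  rw [mul_one, mul_one]
  gcongr
  linarith

/-! ### Adding a random row to the parity check matrix -/

section AddRow

variable {n k : ℕ}

theorem card_filter_vecMul (ps : List (Bits n)) :
    (Finset.univ.filter fun M : Matrix (Fin n) (Fin k) Bit => ∀ p ∈ ps, p ᵥ* M = 0).card =
      (orthSet ps).card ^ k := by
  have h : (Fintype.piFinset fun _ : Fin k => orthSet ps).card = (orthSet ps).card ^ k := by
    rw [Fintype.card_piFinset]; simp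
  rw [← h]
  refine Finset.card_bij' (fun M _ => fun c i => M i c) (fun v _ => fun i c => v c i) ?_ ?_
    (fun _ _ => rfl) (fun _ _ => rfl)
  · intro M hM
    rw [Finset.mem_filter] at hM
    rw [Fintype.mem_piFinset]
    exact fun c => mem_orthSet.2 fun p hp => congrFun (hM.2 p hp) c
  · intro v hv
    rw [Fintype.mem_piFinset] at hv
    exact Finset.mem_filter.2 ⟨Finset.mem_univ _, fun p hp => funext fun c => mem_orthSet.1 (hv c) p hp⟩

theorem orthMatrixDist_apply (ps : List (Bits n)) (G : Matrix (Fin n) (Fin k) Bit) :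
    (orthMatrixDist n k ps G).toReal =
      if ∀ p ∈ ps, p ᵥ* G = 0 then (((orthSet ps).card : ℝ) ^ k)⁻¹ else 0 := by
  rw [orthMatrixDist, uniformSubjectTo_apply ⟨0, by simp⟩, card_filter_vecMul]
  split_ifs <;> simp

/-- The second moment of a mixture is an average over two independent rows. For fixed rows it is the
`k`-th power, one factor per column, of a ratio of kernel sizes that is at most `2`, and at most `1`
unless the rows agree modulo the span of `ps`. -/
theorem card_mul_sum_sq_le (X : PMF (Bits n)) (ps : List (Bits n)) :
    ((orthSet ps).card : ℝ) ^ k *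
      ∑ G : Matrix (Fin n) (Fin k) Bit,
        ((X.bind fun p => orthMatrixDist n k (p :: ps)) G).toReal ^ 2 ≤
      1 + 2 ^ k * ∑ p, ∑ p', (X p).toReal * (X p').toReal *
        (orthSum ps (p + p') / (orthSet ps).card) := by
  have e1 : ∑ G : Matrix (Fin n) (Fin k) Bit,
        ((X.bind fun p => orthMatrixDist n k (p :: ps)) G).toReal ^ 2 =
      ∑ p, ∑ p', (X p).toReal * (X p').toReal *
        ∑ G, (orthMatrixDist n k (p :: ps) G).toReal * (orthMatrixDist n k (p' :: ps) G).toReal := by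
    simp only [toReal_bind_apply, sq, Finset.sum_mul_sum]
    rw [Finset.sum_comm]
    refine Finset.sum_congr rfl fun p _ => ?_
    rw [Finset.sum_comm]
    refine Finset.sum_congr rfl fun p' _ => ?_
    rw [Finset.mul_sum]
    refine Finset.sum_congr rfl fun G _ => ?_
    ring
  have e2 : ∀ p p' : Bits n, ((orthSet ps).card : ℝ) ^ k *
      ∑ G : Matrix (Fin n) (Fin k) Bit, (orthMatrixDist n k (p :: ps) G).toReal *
        (orthMatrixDist n k (p' :: ps) G).toReal ≤
      1 + 2 ^ k * (orthSum ps (p + p') / (orthSet ps).card) := by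
    intro p p'
    refine le_trans (le_of_eq ?_) ((one_add_pow_le ps (p + p') k).trans' (pow_le_pow_left₀
      (by have := card_orthSet_pos ps; have := card_orthSet_pos (p :: ps)
          have := card_orthSet_pos (p' :: ps); positivity)
      ((div_le_iff₀ (mul_pos (card_orthSet_pos (p :: ps)) (card_orthSet_pos (p' :: ps)))).2
        (card_mul_card_orthSet_le p p' ps)) k))
    have h : ∀ G : Matrix (Fin n) (Fin k) Bit, (orthMatrixDist n k (p :: ps) G).toReal *
        (orthMatrixDist n k (p' :: ps) G).toReal =
        if ∀ q ∈ p :: p' :: ps, q ᵥ* G = 0 then (((orthSet (p :: ps)).card : ℝ) ^ k)⁻¹ *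
          (((orthSet (p' :: ps)).card : ℝ) ^ k)⁻¹ else 0 := by
      intro G
      rw [orthMatrixDist_apply, orthMatrixDist_apply]
      by_cases h1 : ∀ q ∈ p :: ps, q ᵥ* G = 0 <;> by_cases h2 : ∀ q ∈ p' :: ps, q ᵥ* G = 0
      · rw [if_pos h1, if_pos h2, if_pos]
        exact List.forall_mem_cons.2 ⟨h1 p (by simp), h2⟩
      · rw [if_neg h2, mul_zero, if_neg]
        exact fun h => h2 fun q hq => h q (List.mem_cons_of_mem _ hq)
      · rw [if_neg h1, zero_mul, if_neg]
        rw [List.forall_mem_cons] at h1 ⊢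
        rw [List.forall_mem_cons]
        exact fun h => h1 ⟨h.1, h.2.2⟩
      · rw [if_neg h1, zero_mul, if_neg]
        exact fun h => h2 fun q hq => h q (List.mem_cons_of_mem _ hq)
    simp only [h]
    rw [← Finset.sum_filter, Finset.sum_const, card_filter_vecMul, nsmul_eq_mul, Nat.cast_pow,
      div_pow, mul_pow, mul_pow]
    field_simp
  rw [e1, Finset.mul_sum]
  have e3 : (1 : ℝ) = ∑ p, ∑ p', (X p).toReal * (X p').toReal := by
    rw [← Finset.sum_mul_sum, sum_toReal_eq_one, one_mul]
  conv_rhs => rw [e3]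
  rw [Finset.mul_sum, ← Finset.sum_add_distrib]
  refine Finset.sum_le_sum fun p _ => ?_
  rw [Finset.mul_sum, Finset.mul_sum, ← Finset.sum_add_distrib]
  refine Finset.sum_le_sum fun p' _ => ?_
  have := mul_le_mul_of_nonneg_left (e2 p p')
    (mul_nonneg ENNReal.toReal_nonneg ENNReal.toReal_nonneg : 0 ≤ (X p).toReal * (X p').toReal)
  linarith

end AddRow

/-! ### The generator matrix is close to uniform -/

theorem close_bind_average {α β : Type} [Fintype α] {D : PMF α} {f g : α → PMF β} {b : β}
    {ε : α → ℝ} (hε : ∀ a, 0 ≤ ε a) (h : ∀ a, Close (ENNReal.ofReal (ε a)) (f a b) (g a b)) :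
    Close (ENNReal.ofReal (∑ a, (D a).toReal * ε a)) ((D.bind f) b) ((D.bind g) b) := by
  refine close_of_abs_toReal_sub_le (PMF.apply_ne_top _ _) (PMF.apply_ne_top _ _) ?_
  rw [toReal_bind_apply, toReal_bind_apply, ← Finset.sum_sub_distrib]
  refine (Finset.abs_sum_le_sum_abs _ _).trans (Finset.sum_le_sum fun a _ => ?_)
  rw [← mul_sub, abs_mul, abs_of_nonneg ENNReal.toReal_nonneg]
  refine mul_le_mul_of_nonneg_left ?_ ENNReal.toReal_nonneg
  have := (h a).abs_toReal_sub_le ENNReal.ofReal_ne_top (PMF.apply_ne_top _ _)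
    (PMF.apply_ne_top _ _)
  rwa [ENNReal.toReal_ofReal (hε a)] at this

section UniformKey

variable {n k : ℕ}

/-- The mean of the character of `c`. -/
def charMean (X : PMF (Bits n)) (c : Bits n) : ℝ := ∑ p, (X p).toReal * sgn (p ⬝ᵥ c)

/-- The average over `c` of `φ² (1 + |φ|) ^ r`, where `φ` is the mean of the character of `c`. -/
def charMoment (X : PMF (Bits n)) (r : ℕ) : ℝ :=
  (2 ^ n)⁻¹ * ∑ c, charMean X c ^ 2 * (1 + |charMean X c|) ^ r

theorem charMoment_nonneg (X : PMF (Bits n)) (r : ℕ) : 0 ≤ charMoment X r := by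
  unfold charMoment
  positivity

theorem abs_charMean_le_one (X : PMF (Bits n)) (c : Bits n) : |charMean X c| ≤ 1 := by
  refine (Finset.abs_sum_le_sum_abs _ _).trans ?_
  rw [← sum_toReal_eq_one X]
  refine le_of_eq (Finset.sum_congr rfl fun p _ => ?_)
  rw [abs_mul, abs_sgn, mul_one, abs_of_nonneg ENNReal.toReal_nonneg]

/-- The character of `p + p'` factors, so independence of the two rows turns it into the square of
the character mean. -/
theorem sum_orthSum_div_card_le (X : PMF (Bits n)) (ps : List (Bits n)) :
    ∑ p, ∑ p', (X p).toReal * (X p').toReal * (orthSum ps (p + p') / (orthSet ps).card) ≤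
      (2 ^ n)⁻¹ * ∑ c, charMean X c ^ 2 * (ps.map fun p => 1 + sgn (p ⬝ᵥ c)).prod := by
  calc _ ≤ ∑ p, ∑ p', (X p).toReal * (X p').toReal * ((2 ^ n)⁻¹ *
        ∑ c : Bits n, (ps.map fun p => 1 + sgn (p ⬝ᵥ c)).prod * sgn ((p + p') ⬝ᵥ c)) := by
        refine Finset.sum_le_sum fun p _ => Finset.sum_le_sum fun p' _ =>
          mul_le_mul_of_nonneg_left (orthSum_div_card_le ps (p + p')) ?_
        exact mul_nonneg ENNReal.toReal_nonneg ENNReal.toReal_nonneg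
    _ = ∑ p, ∑ p', ∑ c : Bits n, (2 ^ n)⁻¹ * ((X p).toReal * sgn (p ⬝ᵥ c) *
        ((X p').toReal * sgn (p' ⬝ᵥ c)) * (ps.map fun p => 1 + sgn (p ⬝ᵥ c)).prod) := by
        refine Finset.sum_congr rfl fun p _ => Finset.sum_congr rfl fun p' _ => ?_
        rw [Finset.mul_sum, Finset.mul_sum]
        refine Finset.sum_congr rfl fun c _ => ?_
        rw [add_dotProduct, sgn_add]
        ring
    _ = _ := by
        have : ∀ p : Bits n, ∑ p', ∑ c : Bits n, (2 ^ n)⁻¹ * ((X p).toReal * sgn (p ⬝ᵥ c) *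
            ((X p').toReal * sgn (p' ⬝ᵥ c)) * (ps.map fun p => 1 + sgn (p ⬝ᵥ c)).prod) =
            ∑ c : Bits n, ∑ p', (2 ^ n)⁻¹ * ((X p).toReal * sgn (p ⬝ᵥ c) *
            ((X p').toReal * sgn (p' ⬝ᵥ c)) * (ps.map fun p => 1 + sgn (p ⬝ᵥ c)).prod) :=
          fun p => Finset.sum_comm
        rw [Finset.sum_congr rfl fun p _ => this p, Finset.sum_comm, Finset.mul_sum]
        refine Finset.sum_congr rfl fun c _ => ?_
        rw [charMean, sq, Finset.sum_mul_sum, Finset.sum_mul, Finset.mul_sum]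
        refine Finset.sum_congr rfl fun p _ => ?_
        rw [Finset.sum_mul, Finset.mul_sum]

/-- Second-moment comparison with the uniform law on the matrices orthogonal to `ps`; `lam` is left
free to balance the two terms. -/
theorem close_orthMatrixDist_add {β : Type} (X : PMF (Bits n)) (ps : List (Bits n)) {lam : ℝ}
    (hlam : 0 < lam) (f : Matrix (Fin n) (Fin k) Bit → PMF β) (b : β) :
    Close (ENNReal.ofReal (lam + 2 ^ k * ((2 ^ n)⁻¹ *
        ∑ c, charMean X c ^ 2 * (ps.map fun p => 1 + sgn (p ⬝ᵥ c)).prod) / lam))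
      ((X.bind fun p => (orthMatrixDist n k (p :: ps)).bind f) b)
      (((orthMatrixDist n k ps).bind f) b) := by
  classical
  rw [← PMF.bind_bind]
  refine close_bind_of_sum_sq (X := Finset.univ.filter fun M => ∀ p ∈ ps, p ᵥ* M = 0)
    ⟨0, by simp⟩ ?_ ?_ hlam ?_ f b
  · intro G hG
    have hG' : ¬∀ p ∈ ps, p ᵥ* G = 0 := fun h => hG (Finset.mem_filter.2 ⟨Finset.mem_univ _, h⟩)
    have : (((X.bind fun p => orthMatrixDist n k (p :: ps)) G)).toReal = 0 := by
      rw [toReal_bind_apply]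
      refine Finset.sum_eq_zero fun p _ => ?_
      rw [orthMatrixDist_apply, if_neg, mul_zero]
      exact fun h => hG' fun q hq => h q (List.mem_cons_of_mem _ hq)
    exact ((ENNReal.toReal_eq_zero_iff _).1 this).resolve_right (PMF.apply_ne_top _ _)
  · intro G
    rw [orthMatrixDist_apply]
    have := card_filter_vecMul (k := k) ps
    by_cases h : ∀ p ∈ ps, p ᵥ* G = 0
    · rw [if_pos h, if_pos (Finset.mem_filter.2 ⟨Finset.mem_univ _, h⟩), ← Nat.cast_pow, ← this]
    · rw [if_neg h, if_neg fun h' => h (Finset.mem_filter.1 h').2]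
  · have h1 := card_mul_sum_sq_le (k := k) X ps
    have h2 := mul_le_mul_of_nonneg_left (sum_orthSum_div_card_le X ps)
      (by positivity : (0 : ℝ) ≤ 2 ^ k)
    rw [← Nat.cast_pow, ← card_filter_vecMul (k := k) ps] at h1
    refine le_trans (le_of_eq ?_) (h1.trans (add_le_add_right h2 1))
    congr!

/-- Independence of the rows: the mean of a product of `j` factors is the `j`-th power of the mean.
-/
theorem sum_iid_prod (X : PMF (Bits n)) (j : ℕ) (c : Bits n) :
    ∑ P, (iid X j P).toReal * ((List.ofFn P).map fun p => 1 + sgn (p ⬝ᵥ c)).prod =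
      (1 + charMean X c) ^ j := by
  have h : 1 + charMean X c = ∑ p, (X p).toReal * (1 + sgn (p ⬝ᵥ c)) := by
    simp only [mul_add, mul_one, Finset.sum_add_distrib, sum_toReal_eq_one, charMean]
  rw [h, Fintype.sum_pow]
  refine Finset.sum_congr rfl fun P _ => ?_
  rw [iid_apply, ENNReal.toReal_prod, List.map_ofFn, List.prod_ofFn, ← Finset.prod_mul_distrib]
  rfl

/-- Hybrid over the rows. Averaging the bound for one more row over the `j` rows already present
produces `(1 + φ) ^ j`, at most `(1 + |φ|) ^ r`, so each of the `r` steps costs the same. -/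
theorem close_keyGen_uniform {β : Type} (t r : ℕ) {lam : ℝ} (hlam : 0 < lam)
    (f : Matrix (Fin n) (Fin k) Bit → PMF β) (b : β) :
    Close (ENNReal.ofReal (r * (lam + 2 ^ k * charMoment (rowDist n t) r / lam)))
      (((keyGen n k t r).bind fun key => f key.2) b)
      (((unif (Matrix (Fin n) (Fin k) Bit)).bind f) b) := by
  obtain ⟨X, hX⟩ : ∃ X, X = rowDist n t := ⟨_, rfl⟩
  have hδ : 0 ≤ lam + 2 ^ k * charMoment X r / lam := by
    have := charMoment_nonneg X r
    positivity
  have hprod : ∀ (ps : List (Bits n)) (c : Bits n),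
      0 ≤ (ps.map fun p => 1 + sgn (p ⬝ᵥ c)).prod := by
    intro ps c
    refine List.prod_nonneg fun x hx => ?_
    obtain ⟨p, -, rfl⟩ := List.mem_map.1 hx
    rw [one_add_sgn]
    split_ifs <;> norm_num
  have main : ∀ j ≤ r, Close (ENNReal.ofReal (j * (lam + 2 ^ k * charMoment X r / lam)))
      (((iid X j).bind fun P => (orthMatrixDist n k (List.ofFn P)).bind f) b)
      (((unif (Matrix (Fin n) (Fin k) Bit)).bind f) b) := by
    intro j hj
    induction j with
    | zero =>
      simp only [iid, PMF.pure_bind, List.ofFn_zero, orthMatrixDist_nil, Nat.cast_zero, zero_mul,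
        ENNReal.ofReal_zero]
      exact Close.refl _
    | succ j ih =>
      have h1 := ih (by omega)
      have h2 : Close (ENNReal.ofReal (lam + 2 ^ k * charMoment X r / lam))
          (((iid X (j + 1)).bind fun P => (orthMatrixDist n k (List.ofFn P)).bind f) b)
          (((iid X j).bind fun P => (orthMatrixDist n k (List.ofFn P)).bind f) b) := by
        rw [iid]
        simp only [PMF.bind_bind, PMF.pure_bind]
        rw [PMF.bind_comm]
        simp only [List.ofFn_cons]
        refine (close_bind_average (D := iid X j) (fun P => ?_) fun P =>
          close_orthMatrixDist_add X (List.ofFn P) hlam f b).mono (ENNReal.ofReal_le_ofReal ?_)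
        · have := Finset.sum_nonneg fun c (_ : c ∈ Finset.univ) =>
            mul_nonneg (sq_nonneg (charMean X c)) (hprod (List.ofFn P) c)
          positivity
        · have e : ∑ P, (iid X j P).toReal * (lam + 2 ^ k * ((2 ^ n)⁻¹ *
              ∑ c, charMean X c ^ 2 * ((List.ofFn P).map fun p => 1 + sgn (p ⬝ᵥ c)).prod) / lam) =
              lam + 2 ^ k * ((2 ^ n)⁻¹ * ∑ c, charMean X c ^ 2 * (1 + charMean X c) ^ j) / lam := by
            simp only [mul_add, Finset.sum_add_distrib, ← Finset.sum_mul, sum_toReal_eq_one, one_mul,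
              ← sum_iid_prod]
            congr 1
            simp only [Finset.mul_sum, Finset.sum_div]
            rw [Finset.sum_comm]
            refine Finset.sum_congr rfl fun c _ => Finset.sum_congr rfl fun P _ => ?_
            ring
          rw [e, charMoment]
          gcongr with c
          have h0 := abs_le.1 (abs_charMean_le_one X c)
          calc (1 + charMean X c) ^ j ≤ (1 + |charMean X c|) ^ j :=
                pow_le_pow_left₀ (by linarith) (by linarith [le_abs_self (charMean X c)]) _
            _ ≤ (1 + |charMean X c|) ^ r :=
                pow_le_pow_right₀ (by linarith [abs_nonneg (charMean X c)]) (by omega)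
      refine (h2.trans h1).mono ?_
      rw [← ENNReal.ofReal_add hδ (by positivity)]
      refine ENNReal.ofReal_le_ofReal ?_
      push_cast
      linarith
  rw [keyGen_bind t r f, ← hX]
  exact main r le_rfl

end UniformKey

/-! ### Elementary symmetric sums of signs -/

section Esum

variable {ι : Type}

/-- The elementary symmetric sum of degree `t` of the numbers `x i`, `i ∈ s`. -/
def esum (x : ι → ℝ) (s : Finset ι) (t : ℕ) : ℝ := ∑ T ∈ s.powersetCard t, ∏ i ∈ T, x i

theorem esum_zero (x : ι → ℝ) (s : Finset ι) : esum x s 0 = 1 := by simp [esum]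

theorem esum_insert [DecidableEq ι] (x : ι → ℝ) {s : Finset ι} {a : ι} (ha : a ∉ s) (t : ℕ) :
    esum x (insert a s) (t + 1) = esum x s (t + 1) + x a * esum x s t := by
  have hmem : ∀ {j : ℕ} {T : Finset ι}, T ∈ s.powersetCard j → a ∉ T := fun hT h =>
    ha ((Finset.mem_powersetCard.1 hT).1 h)
  rw [esum, Finset.powersetCard_succ_insert ha, Finset.sum_union, Finset.sum_image, esum, esum,
    Finset.mul_sum]
  · congr 1
    exact Finset.sum_congr rfl fun T hT => Finset.prod_insert (hmem hT)
  · intro T hT T' hT' h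
    rw [← Finset.erase_insert (hmem hT), ← Finset.erase_insert (hmem hT')]
    exact congrArg (fun U => Finset.erase U a) h
  · rw [Finset.disjoint_left]
    intro T hT hT'
    obtain ⟨U, -, rfl⟩ := Finset.mem_image.1 hT'
    exact hmem hT (Finset.mem_insert_self a U)

theorem esum_one (x : ι → ℝ) (s : Finset ι) : esum x s 1 = ∑ i ∈ s, x i := by
  rw [esum, Finset.powersetCard_one, Finset.sum_map]
  simp

/-- The three-term recurrence of the Krawtchouk polynomials. -/
theorem esum_recurrence [DecidableEq ι] {x : ι → ℝ} (hx : ∀ i, x i * x i = 1) (s : Finset ι) (t : ℕ) :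
    (t + 2) * esum x s (t + 2) = (∑ i ∈ s, x i) * esum x s (t + 1) - (s.card - t) * esum x s t := by
  induction s using Finset.induction_on generalizing t with
  | empty =>
    have h : ∀ j, esum x ∅ (j + 1) = 0 := fun j => by
      rw [esum, Finset.powersetCard_eq_empty.2 (by simp)]; simp
    rw [h, h]
    cases t with
    | zero => simp
    | succ t => rw [h]; simp
  | insert a s ha ih =>
    rw [esum_insert x ha, esum_insert x ha, Finset.sum_insert ha, Finset.card_insert_of_notMem ha]
    have h1 := ih t
    have hxa := hx a
    cases t with
    | zero =>
      rw [esum_zero, esum_zero] at *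
      rw [esum_one]
      push_cast at *
      linear_combination h1 - hxa + (∑ i ∈ s, x i) * esum_one x s
    | succ t =>
      rw [esum_insert x ha]
      have h2 := ih t
      push_cast at *
      linear_combination h1 + x a * h2 - esum x s (t + 1) * hxa

/-- The normalised sums `t! |e_t|` satisfy a two-step recurrence with coefficients at most `|∑ x|`
and `T * s.card`. The base `β = |∑ x| + √(s.card * T)` is chosen so that `|∑ x| β + T * s.card ≤
β²`, which propagates `t! |e_t| ≤ β ^ t`. -/
theorem factorial_mul_abs_esum_le [DecidableEq ι] {x : ι → ℝ} (hx : ∀ i, x i * x i = 1) (s : Finset ι) {T : ℕ}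
    (hT : T ≤ s.card) :
    T.factorial * |esum x s T| ≤ (|∑ i ∈ s, x i| + Real.sqrt (s.card * T)) ^ T := by
  obtain ⟨β, hβ⟩ : ∃ β, β = |∑ i ∈ s, x i| + Real.sqrt (s.card * T) := ⟨_, rfl⟩
  have hβ0 : 0 ≤ β := by rw [hβ]; positivity
  have hβ2 : |∑ i ∈ s, x i| * β + T * s.card ≤ β ^ 2 := by
    have h := Real.mul_self_sqrt (by positivity : (0 : ℝ) ≤ s.card * T)
    have h1 := mul_nonneg (abs_nonneg (∑ i ∈ s, x i)) (Real.sqrt_nonneg ((s.card : ℝ) * T))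
    rw [hβ]
    nlinarith
  rw [← hβ]
  have main : ∀ t, t + 1 ≤ T → t.factorial * |esum x s t| ≤ β ^ t ∧
      (t + 1).factorial * |esum x s (t + 1)| ≤ β ^ (t + 1) := by
    intro t ht
    induction t with
    | zero =>
      rw [esum_zero, zero_add, esum_one]
      refine ⟨by simp, ?_⟩
      have := Real.sqrt_nonneg ((s.card : ℝ) * T)
      simp only [Nat.factorial_one, Nat.cast_one, one_mul, pow_one]
      linarith
    | succ t ih =>
      obtain ⟨ih1, ih2⟩ := ih (by omega)
      refine ⟨ih2, ?_⟩
      have hrec := esum_recurrence hx s t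
      have htT : (t : ℝ) + 2 ≤ T := by exact_mod_cast ht
      have hTs : (T : ℝ) ≤ s.card := by exact_mod_cast hT
      have h1 : ((t + 1 + 1).factorial : ℝ) * |esum x s (t + 1 + 1)| =
          (t + 1).factorial * |(t + 2) * esum x s (t + 2)| := by
        rw [Nat.factorial_succ (t + 1), abs_mul, abs_of_nonneg (by positivity : (0 : ℝ) ≤ t + 2)]
        push_cast
        ring
      rw [h1, hrec]
      have h2 : |(∑ i ∈ s, x i) * esum x s (t + 1) - (s.card - t) * esum x s t| ≤
          |∑ i ∈ s, x i| * |esum x s (t + 1)| + (s.card - t) * |esum x s t| := by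
        refine (abs_sub _ _).trans ?_
        rw [abs_mul, abs_mul, abs_of_nonneg (by linarith : (0 : ℝ) ≤ s.card - t)]
      calc ((t + 1).factorial : ℝ) *
            |(∑ i ∈ s, x i) * esum x s (t + 1) - (s.card - t) * esum x s t|
          ≤ (t + 1).factorial *
            (|∑ i ∈ s, x i| * |esum x s (t + 1)| + (s.card - t) * |esum x s t|) := by gcongr
        _ = |∑ i ∈ s, x i| * ((t + 1).factorial * |esum x s (t + 1)|) +
            ((t + 1) * (s.card - t)) * (t.factorial * |esum x s t|) := by
            rw [Nat.factorial_succ]; push_cast; ring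
        _ ≤ |∑ i ∈ s, x i| * β ^ (t + 1) + (T * s.card) * β ^ t := by
            have : ((t : ℝ) + 1) * (s.card - t) ≤ T * s.card := by
              refine mul_le_mul (by linarith) (by linarith [(Nat.cast_nonneg t : (0 : ℝ) ≤ t)])
                (by linarith) (by positivity)
            have h0 : (0 : ℝ) ≤ (t.factorial : ℝ) * |esum x s t| := by positivity
            refine add_le_add (mul_le_mul_of_nonneg_left ih2 (abs_nonneg _))
              (mul_le_mul this ih1 h0 (by positivity))
        _ = (|∑ i ∈ s, x i| * β + T * s.card) * β ^ t := by ring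
        _ ≤ β ^ 2 * β ^ t := by gcongr
        _ = β ^ (t + 1 + 1) := by ring
  cases T with
  | zero => simp [esum_zero]
  | succ T => exact (main T le_rfl).2

end Esum

/-! ### Sparse vectors -/

section Sparse

variable {n : ℕ}

theorem sum_hammingNorm_eq {M : Type} [AddCommMonoid M] (t : ℕ) (F : Bits n → M) :
    ∑ p ∈ Finset.univ.filter (fun p : Bits n => hammingNorm p = t), F p =
      ∑ T ∈ Finset.univ.powersetCard t, F fun i => if i ∈ T then 1 else 0 := by
  refine Finset.sum_bij' (fun p _ => Finset.univ.filter fun i => p i ≠ 0)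
    (fun T _ i => if i ∈ T then 1 else 0) ?_ ?_ ?_ ?_ ?_
  · intro p hp
    exact Finset.mem_powersetCard.2 ⟨Finset.subset_univ _, (Finset.mem_filter.1 hp).2⟩
  · intro T hT
    refine Finset.mem_filter.2 ⟨Finset.mem_univ _, ?_⟩
    rw [← (Finset.mem_powersetCard.1 hT).2, hammingNorm]
    congr 1
    ext i
    simp
  · intro p _
    funext i
    rcases Bit.eq_zero_or_one (p i) with h | h <;> simp [h]
  · intro T _
    ext i
    simp
  · intro p _
    congr 1
    funext i
    rcases Bit.eq_zero_or_one (p i) with h | h <;> simp [h]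

theorem card_hammingNorm_eq (t : ℕ) :
    (Finset.univ.filter (fun p : Bits n => hammingNorm p = t)).card = n.choose t := by
  rw [Finset.card_eq_sum_ones, sum_hammingNorm_eq]
  simp

theorem rowDist_apply {t : ℕ} (ht : t ≤ n) (p : Bits n) :
    (rowDist n t p).toReal = if hammingNorm p = t then ((n.choose t : ℝ))⁻¹ else 0 := by
  rw [rowDist, uniformSubjectTo_apply (Finset.card_pos.1 (by
    rw [card_hammingNorm_eq]; exact Nat.choose_pos ht)), card_hammingNorm_eq]
  split_ifs <;> simp

/-- The sum of the signs of the entries of a bit string. -/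
def signSum (c : Bits n) : ℝ := ∑ i, sgn (c i)

theorem charMean_rowDist {t : ℕ} (ht : t ≤ n) (c : Bits n) :
    charMean (rowDist n t) c =
      (n.choose t : ℝ)⁻¹ * esum (fun i => sgn (c i)) Finset.univ t := by
  simp only [charMean, rowDist_apply ht, ite_mul, zero_mul]
  rw [← Finset.sum_filter, ← Finset.mul_sum, sum_hammingNorm_eq, esum]
  congr 1
  refine Finset.sum_congr rfl fun T _ => ?_
  rw [← sgn_sum]
  congr 1
  simp [dotProduct]

/-- The numerator is `factorial_mul_abs_esum_le` divided by `n ^ t`, with `√(n t) ≤ τ n`. The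
denominator comes from `t! C(n, t) ≥ (n - t + 1) ^ t ≥ (n (1 - τ)) ^ t`. -/
theorem abs_charMean_rowDist_le {t : ℕ} {τ : ℝ} (hτ : 0 < τ) (hτ1 : τ < 1) (hn : 0 < n)
    (ht : (t : ℝ) ≤ τ ^ 2 * n) (c : Bits n) :
    |charMean (rowDist n t) c| ≤ ((|signSum c| / n + τ) / (1 - τ)) ^ t := by
  have hn' : (0 : ℝ) < n := by exact_mod_cast hn
  have htn' : (t : ℝ) ≤ n := ht.trans (mul_le_of_le_one_left hn'.le (by nlinarith))
  have htn : t ≤ n := by exact_mod_cast htn'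
  have hch : (0 : ℝ) < n.choose t := by exact_mod_cast Nat.choose_pos htn
  have h1 := factorial_mul_abs_esum_le (x := fun i => sgn (c i)) (fun i => sgn_mul_self _)
    Finset.univ (T := t) (by simpa using htn)
  rw [charMean_rowDist htn, abs_mul, abs_of_pos (inv_pos.2 hch), div_add' _ _ _ hn'.ne', div_div,
    div_pow, le_div_iff₀ (by have : 0 < 1 - τ := by linarith
                             positivity)]
  have h2 : ((n : ℝ) * (1 - τ)) ^ t ≤ t.factorial * n.choose t := by
    have h := Nat.pow_sub_le_descFactorial n t
    rw [Nat.descFactorial_eq_factorial_mul_choose] at h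
    have h' : ((n + 1 - t : ℕ) : ℝ) ^ t ≤ t.factorial * n.choose t := by exact_mod_cast h
    refine le_trans (pow_le_pow_left₀ (mul_nonneg hn'.le (by linarith)) ?_ t) h'
    rw [Nat.cast_sub (by omega)]
    push_cast
    nlinarith [mul_nonneg hτ.le hn'.le, mul_nonneg (mul_nonneg hτ.le hn'.le) (sub_nonneg.2 hτ1.le)]
  have h3 : Real.sqrt (n * t) ≤ τ * n := by
    rw [show τ * n = Real.sqrt ((τ * n) ^ 2) from (Real.sqrt_sq (by positivity)).symm]
    refine Real.sqrt_le_sqrt ?_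
    nlinarith
  calc ((n.choose t : ℝ))⁻¹ * |esum (fun i => sgn (c i)) Finset.univ t| * (n * (1 - τ)) ^ t
      ≤ ((n.choose t : ℝ))⁻¹ * |esum (fun i => sgn (c i)) Finset.univ t| *
        (t.factorial * n.choose t) := by gcongr
    _ = t.factorial * |esum (fun i => sgn (c i)) Finset.univ t| := by field_simp
    _ ≤ _ := h1
    _ ≤ (|signSum c| + τ * n) ^ t := by
      rw [Finset.card_univ, Fintype.card_fin]
      change (|signSum c| + _) ^ t ≤ _
      gcongr

theorem sum_sgn_dotProduct (q : Bits n) :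
    ∑ c : Bits n, sgn (q ⬝ᵥ c) = if q = 0 then 2 ^ n else 0 := by
  have hs : orthSet ([] : List (Bits n)) = Finset.univ := by
    ext c; simp [mem_orthSet]
  have h := orthSum_eq_or [] q
  rw [orthSum, hs, Finset.card_univ, card_bits] at h
  by_cases hq : q = 0
  · simp [hq, sgn_zero]
  · rw [if_neg hq]
    refine h.resolve_left fun h' => hq (funext fun i => ?_)
    have := h'.1 (Pi.single i 1) (Finset.mem_univ _)
    simpa using this

/-- Parseval: by orthogonality of characters only the pairs `p = p'` survive, leaving the collision
probability. -/
theorem sum_charMean_sq (X : PMF (Bits n)) :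
    (2 ^ n)⁻¹ * ∑ c, charMean X c ^ 2 = ∑ p, (X p).toReal ^ 2 := by
  have e : ∑ c, charMean X c ^ 2 = ∑ p, ∑ p', (X p).toReal * (X p').toReal *
      ∑ c : Bits n, sgn ((p + p') ⬝ᵥ c) := by
    simp only [charMean, sq, Finset.sum_mul_sum]
    rw [Finset.sum_comm]
    refine Finset.sum_congr rfl fun p _ => ?_
    rw [Finset.sum_comm]
    refine Finset.sum_congr rfl fun p' _ => ?_
    rw [Finset.mul_sum]
    refine Finset.sum_congr rfl fun c _ => ?_
    rw [add_dotProduct, sgn_add]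
    ring
  rw [e, Finset.mul_sum]
  refine Finset.sum_congr rfl fun p _ => ?_
  rw [Finset.sum_eq_single p]
  · rw [sum_sgn_dotProduct, if_pos (bits_add_self p)]
    field_simp
  · intro p' _ hp
    rw [sum_sgn_dotProduct, if_neg, mul_zero]
    intro h
    apply hp
    rw [← bits_add_cancel p' p, add_comm p', h, zero_add]
  · simp

theorem sum_charMean_rowDist_sq {t : ℕ} (ht : t ≤ n) :
    (2 ^ n)⁻¹ * ∑ c, charMean (rowDist n t) c ^ 2 = (n.choose t : ℝ)⁻¹ := by
  rw [sum_charMean_sq]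
  simp only [rowDist_apply ht, ite_pow]
  rw [zero_pow two_ne_zero, ← Finset.sum_filter, Finset.sum_const, card_hammingNorm_eq, nsmul_eq_mul]
  have : (n.choose t : ℝ) ≠ 0 := by exact_mod_cast (Nat.choose_pos ht).ne'
  field_simp

/-- The signs of a uniform string are independent, so the moment generating function factors. -/
theorem sum_exp_signSum (lam : ℝ) :
    (2 ^ n)⁻¹ * ∑ c : Bits n, Real.exp (lam * signSum c) = Real.cosh lam ^ n := by
  have h : ∀ c : Bits n, Real.exp (lam * signSum c) = ∏ i, Real.exp (lam * sgn (c i)) := fun c => by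
    rw [signSum, Finset.mul_sum, Real.exp_sum]
  simp only [h]
  rw [← Fintype.sum_pow (fun b : Bit => Real.exp (lam * sgn b)) n]
  have h2 : ∑ b : Bit, Real.exp (lam * sgn b) = 2 * Real.cosh lam := by
    rw [show (Finset.univ : Finset Bit) = {0, 1} by decide, Finset.sum_pair (by decide), sgn_zero,
      sgn_one, Real.cosh_eq]
    ring_nf
  rw [h2, mul_pow, inv_mul_cancel_left₀ (by positivity)]

/-- Chernoff bound with parameter `lam`; the factor `2` accounts for the two tails. -/
theorem card_le_abs_signSum (a : ℝ) {lam : ℝ} (hlam : 0 ≤ lam) :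
    (2 ^ n)⁻¹ * ∑ c : Bits n, (if a * n ≤ |signSum c| then (1 : ℝ) else 0) ≤
      2 * (Real.exp (-(lam * a)) * Real.cosh lam) ^ n := by
  have key : ∀ c : Bits n, (if a * n ≤ |signSum c| then (1 : ℝ) else 0) ≤
      Real.exp (-(lam * a)) ^ n *
        (Real.exp (lam * signSum c) + Real.exp ((-lam) * signSum c)) := by
    intro c
    split_ifs with h
    · have h1 : Real.exp (lam * |signSum c|) ≤
          Real.exp (lam * signSum c) + Real.exp ((-lam) * signSum c) := by
        rcases abs_cases (signSum c) with ⟨h, -⟩ | ⟨h, -⟩ <;> rw [h]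
        · linarith [Real.exp_pos ((-lam) * signSum c)]
        · rw [mul_neg, ← neg_mul]
          linarith [Real.exp_pos (lam * signSum c)]
      refine le_trans ?_ (mul_le_mul_of_nonneg_left h1 (by positivity))
      rw [← Real.exp_nat_mul, ← Real.exp_add, Real.one_le_exp_iff]
      nlinarith [mul_le_mul_of_nonneg_left h hlam]
    · positivity
  refine (mul_le_mul_of_nonneg_left (Finset.sum_le_sum fun c _ => key c)
    (by positivity)).trans (le_of_eq ?_)
  rw [← Finset.mul_sum, Finset.sum_add_distrib, mul_left_comm, mul_add, sum_exp_signSum,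
    sum_exp_signSum, Real.cosh_neg, mul_pow]
  ring

end Sparse

/-! ### Chernoff estimates for the two ranges of imbalance, and the moment bound. -/

theorem exp_neg_mul_cosh_le {a : ℝ} : Real.exp (-(a * a)) * Real.cosh a ≤ Real.exp (-(a ^ 2 / 2)) := by
  refine (mul_le_mul_of_nonneg_left (Real.cosh_le_exp_half_sq a) (Real.exp_pos _).le).trans ?_
  rw [← Real.exp_add]
  refine Real.exp_le_exp.2 (by nlinarith)

/-- The Chernoff parameter `4 / δ` is large because nearly constant strings are counted. The
exponential times `cosh` equals `½ e^(δ/8) (1 + e^(-8/δ)) ≤ ½ e^(δ/4)`, while `2 ^ (1 - δ) ≤ 2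
e^(-δ/2)` because `log 2 ≥ 1/2`. -/
theorem two_rpow_mul_cosh_le {δ : ℝ} (hδ : 0 < δ) :
    (2 : ℝ) ^ (1 - δ) * (Real.exp (-(4 / δ * (1 - δ ^ 2 / 32))) * Real.cosh (4 / δ)) ≤
      Real.exp (-(δ / 4)) := by
  have h1 : Real.exp (-(4 / δ * (1 - δ ^ 2 / 32))) * Real.cosh (4 / δ) =
      2⁻¹ * (Real.exp (δ / 8) * (1 + Real.exp (-(8 / δ)))) := by
    have e1 : Real.exp (-(4 / δ * (1 - δ ^ 2 / 32))) = Real.exp (δ / 8) * Real.exp (-(4 / δ)) := by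
      rw [← Real.exp_add]
      congr 1
      field_simp
      ring
    have e2 : Real.exp (-(8 / δ)) = Real.exp (-(4 / δ)) * Real.exp (-(4 / δ)) := by
      rw [← Real.exp_add]
      congr 1
      ring
    have e3 : Real.exp (-(4 / δ)) * Real.exp (4 / δ) = 1 := by rw [← Real.exp_add]; simp
    rw [e1, e2, Real.cosh_eq]
    linear_combination Real.exp (δ / 8) / 2 * e3
  have h2 : 1 + Real.exp (-(8 / δ)) ≤ Real.exp (δ / 8) := by
    have e1 : 8 / δ + 1 ≤ Real.exp (8 / δ) := Real.add_one_le_exp _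
    have e2 : Real.exp (-(8 / δ)) ≤ δ / 8 := by
      rw [Real.exp_neg, inv_le_comm₀ (Real.exp_pos _) (by positivity), inv_div]
      linarith
    linarith [Real.add_one_le_exp (δ / 8)]
  have h3 : (2 : ℝ) ^ (1 - δ) ≤ 2 * Real.exp (-(δ / 2)) := by
    rw [Real.rpow_sub zero_lt_two, Real.rpow_one, div_eq_mul_inv, ← Real.rpow_neg zero_le_two,
      Real.rpow_def_of_pos zero_lt_two]
    gcongr
    have := Real.log_two_gt_d9
    nlinarith
  rw [h1]
  calc (2 : ℝ) ^ (1 - δ) * (2⁻¹ * (Real.exp (δ / 8) * (1 + Real.exp (-(8 / δ)))))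
      ≤ (2 * Real.exp (-(δ / 2))) * (2⁻¹ * (Real.exp (δ / 8) * Real.exp (δ / 8))) := by gcongr
    _ = Real.exp (-(δ / 4)) := by
      have : Real.exp (-(δ / 4)) = Real.exp (-(δ / 2)) * (Real.exp (δ / 8) * Real.exp (δ / 8)) := by
        rw [← Real.exp_add, ← Real.exp_add]
        congr 1
        ring
      rw [this]
      ring

theorem one_add_pow_le_exp {x : ℝ} (hx : 0 ≤ x) (r : ℕ) : (1 + x) ^ r ≤ Real.exp (r * x) := by
  rw [Real.exp_nat_mul]
  exact pow_le_pow_left₀ (by linarith) (by linarith [Real.add_one_le_exp x]) r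

/-- The moment is governed by the probability `1 / C(n, t)` of a coincidence of two rows, up to an
exponentially small contribution of strings with a large imbalance of zeros and ones. -/
theorem charMoment_rowDist_le {n t r : ℕ} {δ κ τ : ℝ} (hn : 0 < n) (hδ : 0 < δ) (hδ1 : δ ≤ 1)
    (hκ : 0 < κ) (hκ1 : κ ≤ 1) (hτ : 0 < τ) (hτκ : τ ≤ κ / 4) (hτδ : τ ≤ δ ^ 2 / 128)
    (ht : (t : ℝ) ≤ τ ^ 2 * n) (hr : (r : ℝ) ≤ (1 - δ) * n) (hκt : κ ^ t * n ≤ 1)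
    (hδt : (1 - δ ^ 2 / 64) ^ t ≤ κ ^ 2 / 16) :
    charMoment (rowDist n t) r ≤ 3 * (n.choose t : ℝ)⁻¹ + 2 * Real.exp (-(κ ^ 2 / 16) * n) +
      2 * Real.exp (-(δ / 4) * n) := by
  have hn' : (0 : ℝ) < n := by exact_mod_cast hn
  have hτ1 : τ < 1 := by linarith
  have htn : t ≤ n := by
    have : (t : ℝ) ≤ n := ht.trans (mul_le_of_le_one_left hn'.le (by nlinarith))
    exact_mod_cast this
  have hrn : (r : ℝ) ≤ n := hr.trans (mul_le_of_le_one_left hn'.le (by linarith))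
  -- Three ranges of the imbalance. Below `κ n / 2`, `|φ| ≤ κ ^ t ≤ 1 / n`, so the power is at most
  -- `e < 3`. Up to `(1 - δ² / 32) n`, `|φ| ≤ κ² / 16`, so the power is at most `exp (κ² n / 16)`.
  -- Beyond that the trivial bound `2 ^ r` is used.
  have key : ∀ c : Bits n, charMean (rowDist n t) c ^ 2 * (1 + |charMean (rowDist n t) c|) ^ r ≤
      3 * charMean (rowDist n t) c ^ 2 +
      Real.exp (κ ^ 2 / 16 * n) * (if κ / 2 * n ≤ |signSum c| then 1 else 0) +
      2 ^ r * (if (1 - δ ^ 2 / 32) * n ≤ |signSum c| then 1 else 0) := by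
    intro c
    obtain ⟨φ, hφ⟩ : ∃ φ, φ = charMean (rowDist n t) c := ⟨_, rfl⟩
    obtain ⟨z, hz⟩ : ∃ z, z = |signSum c| := ⟨_, rfl⟩
    have hle := abs_charMean_rowDist_le hτ hτ1 hn ht c
    have hle1 := abs_charMean_le_one (rowDist n t) c
    rw [← hφ, ← hz] at hle
    rw [← hφ] at hle1
    rw [← hφ, ← hz]
    have hz0 : 0 ≤ z := by rw [hz]; positivity
    have hsq : φ ^ 2 ≤ 1 := by rw [← sq_abs]; nlinarith [abs_nonneg φ]
    have hexp := one_add_pow_le_exp (abs_nonneg φ) r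
    have hB0 : 0 ≤ (z / n + τ) / (1 - τ) := div_nonneg (by positivity) (by linarith)
    by_cases h1 : κ / 2 * n ≤ z
    · by_cases h2 : (1 - δ ^ 2 / 32) * n ≤ z
      · rw [if_pos h2]
        have : φ ^ 2 * (1 + |φ|) ^ r ≤ 1 * 2 ^ r := by
          gcongr
          linarith
        have h3 : 0 ≤ Real.exp (κ ^ 2 / 16 * n) * (if κ / 2 * n ≤ z then (1 : ℝ) else 0) := by
          positivity
        nlinarith [sq_nonneg φ]
      · rw [if_pos h1, if_neg h2]
        push Not at h2
        have hB : (z / n + τ) / (1 - τ) ≤ 1 - δ ^ 2 / 64 := by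
          rw [div_le_iff₀ (by linarith)]
          have : z / n ≤ 1 - δ ^ 2 / 32 := by rw [div_le_iff₀ hn']; exact h2.le
          nlinarith [mul_nonneg hτ.le (sq_nonneg δ)]
        have hφ' : |φ| ≤ κ ^ 2 / 16 := hle.trans ((pow_le_pow_left₀ hB0 hB t).trans hδt)
        have : φ ^ 2 * (1 + |φ|) ^ r ≤ 1 * Real.exp (κ ^ 2 / 16 * n) := by
          refine mul_le_mul hsq (hexp.trans (Real.exp_le_exp.2 ?_)) (by positivity) zero_le_one
          rw [mul_comm]
          exact mul_le_mul hφ' hrn (Nat.cast_nonneg r) (by positivity)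
        nlinarith [sq_nonneg φ]
    · push Not at h1
      have hB : (z / n + τ) / (1 - τ) ≤ κ := by
        rw [div_le_iff₀ (by linarith)]
        have : z / n ≤ κ / 2 := by rw [div_le_iff₀ hn']; exact h1.le
        nlinarith
      have hφ' : |φ| ≤ κ ^ t := hle.trans (pow_le_pow_left₀ hB0 hB t)
      have hrφ : r * |φ| ≤ 1 := by
        refine le_trans ?_ hκt
        rw [mul_comm]
        exact mul_le_mul hφ' hrn (Nat.cast_nonneg r) (by positivity)
      have h3 : (1 + |φ|) ^ r ≤ 3 :=
        hexp.trans ((Real.exp_le_exp.2 hrφ).trans Real.exp_one_lt_three.le)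
      have h4 : φ ^ 2 * (1 + |φ|) ^ r ≤ φ ^ 2 * 3 := by gcongr
      have h5 : 0 ≤ Real.exp (κ ^ 2 / 16 * n) * (if κ / 2 * n ≤ z then (1 : ℝ) else 0) := by
        positivity
      have h6 : 0 ≤ (2 : ℝ) ^ r * (if (1 - δ ^ 2 / 32) * n ≤ z then (1 : ℝ) else 0) := by
        positivity
      linarith
  have hsum := mul_le_mul_of_nonneg_left (Finset.sum_le_sum fun c (_ : c ∈ Finset.univ) => key c)
    (by positivity : (0 : ℝ) ≤ (2 ^ n)⁻¹)
  refine hsum.trans ?_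
  rw [Finset.sum_add_distrib, Finset.sum_add_distrib, ← Finset.mul_sum, ← Finset.mul_sum,
    ← Finset.mul_sum, mul_add, mul_add, mul_left_comm, mul_left_comm _ (Real.exp _),
    mul_left_comm _ ((2 : ℝ) ^ r), sum_charMean_rowDist_sq htn]
  -- Chernoff with parameter `κ / 2` bounds the tail by `2 exp (-κ² n / 8)`; half of this exponent
  -- pays for the growth of the power.
  have t1 : Real.exp (κ ^ 2 / 16 * n) * ((2 ^ n)⁻¹ *
      ∑ c : Bits n, (if κ / 2 * n ≤ |signSum c| then (1 : ℝ) else 0)) ≤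
      2 * Real.exp (-(κ ^ 2 / 16) * n) := by
    calc _ ≤ Real.exp (κ ^ 2 / 16 * n) *
          (2 * (Real.exp (-(κ / 2 * (κ / 2))) * Real.cosh (κ / 2)) ^ n) := by
          exact mul_le_mul_of_nonneg_left (card_le_abs_signSum _ (by positivity)) (by positivity)
      _ ≤ Real.exp (κ ^ 2 / 16 * n) * (2 * Real.exp (-((κ / 2) ^ 2 / 2)) ^ n) := by
          have := Real.cosh_pos (κ / 2)
          gcongr
          exact exp_neg_mul_cosh_le
      _ = 2 * Real.exp (-(κ ^ 2 / 16) * n) := by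
          rw [← Real.exp_nat_mul, mul_left_comm, ← Real.exp_add]
          congr 2
          ring
  -- Here the rate enters: `2 ^ r ≤ 2 ^ ((1 - δ) n)` is beaten by the rarity of nearly constant
  -- strings.
  have t2 : 2 ^ r * ((2 ^ n)⁻¹ *
      ∑ c : Bits n, (if (1 - δ ^ 2 / 32) * n ≤ |signSum c| then (1 : ℝ) else 0)) ≤
      2 * Real.exp (-(δ / 4) * n) := by
    have hr2 : (2 : ℝ) ^ r ≤ ((2 : ℝ) ^ (1 - δ)) ^ n := by
      rw [← Real.rpow_natCast, ← Real.rpow_natCast, ← Real.rpow_mul zero_le_two]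
      exact Real.rpow_le_rpow_of_exponent_le one_le_two hr
    have hc := Real.cosh_pos (4 / δ)
    calc _ ≤ ((2 : ℝ) ^ (1 - δ)) ^ n *
          (2 * (Real.exp (-(4 / δ * (1 - δ ^ 2 / 32))) * Real.cosh (4 / δ)) ^ n) := by
          exact mul_le_mul hr2 (card_le_abs_signSum _ (by positivity)) (by positivity)
            (by positivity)
      _ = 2 * ((2 : ℝ) ^ (1 - δ) *
          (Real.exp (-(4 / δ * (1 - δ ^ 2 / 32))) * Real.cosh (4 / δ))) ^ n := by
          rw [mul_pow]; ring
      _ ≤ 2 * Real.exp (-(δ / 4)) ^ n := by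
          gcongr
          exact two_rpow_mul_cosh_le hδ
      _ = 2 * Real.exp (-(δ / 4) * n) := by
          rw [← Real.exp_nat_mul]
          congr 2
          ring
  linarith

/-! ### The advantage of an attacker -/

theorem length_encKinds_append (C D : Circuit GameOracle) :
    (encKinds (C ++ D)).length = (encKinds C).length + (encKinds D).length := by
  induction C with
  | nil => simp [encKinds]
  | cons G C ih =>
    rcases G with _ | _ | _ | _ | ⟨_ | _ | _, src, dst⟩ <;>
      simp only [encKinds, List.cons_append, List.length_cons, ih] <;> omega

/-- With prepared pads the oracles `enc` and `rnd` act identically, and both circuits use the same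
number of pads, all uniform. -/
theorem uniformGame_gameCircuit (n k m : ℕ) (A : CPAAdversary) (out : ℕ) :
    uniformGame n k m (gameCircuit A true) out = uniformGame n k m (gameCircuit A false) out := by
  have h1 : (encKinds (gameCircuit A true)).length = (encKinds (gameCircuit A false)).length := by
    rw [gameCircuit, gameCircuit, length_encKinds_append, length_encKinds_append]
    rfl
  have h2 : ∀ ℓ, padRun n k m (gameCircuit A true) out ℓ =
      padRun n k m (gameCircuit A false) out ℓ := by
    intro ℓ
    rw [padRun, padRun, gameCircuit, gameCircuit, run_append, run_append]
    rfl
  rw [uniformGame, uniformGame, List.map_const', List.map_const', h1]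
  simp only [h2]

section Advantage

variable {n k m : ℕ} (t r : ℕ) (η : unitInterval) (PRNG : Bits k → Bits m)

/-- The bound for the advantage that results from the sequence of games: `dPRNG` and `dLPN` bound
the insecurity of the generator and of LPN, `dKey` the effect of making the key uniform. -/
def advBound (k s : ℕ) (dPRNG dKey dLPN : ℝ) : ℝ :=
  2 * ((s + s * s) * (2 ^ k)⁻¹ + s * dPRNG + dKey + s * dLPN)

/-- The chain of games: fresh hash values, uniform strings for the generator, uniform key, LPN. The
argument for the key is a parameter, being the only place where the two parts of the theorem differ.
-/
theorem close_cpaGame_uniformGame (A : CPAAdversary) (b : Bool) {s T : ℕ} {dKey : ℝ}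
    (hdKey : 0 ≤ dKey) (hs : A.time + 1 ≤ s) (hT : reductionSize n k m s ≤ T)
    (hkey : ∀ C : Circuit GameOracle, C.size ≤ s → Close (ENNReal.ofReal dKey)
      (((keyGen n k t r).bind fun key => linGame (m := m) C A.out η key.2) 1)
      (((unif (Matrix (Fin n) (Fin k) Bit)).bind fun G => linGame (m := m) C A.out η G) 1)) :
    Close (ENNReal.ofReal ((s + s * s) * (2 ^ k)⁻¹ +
        s * distInSec T ((unif (Bits k)).bind fun x => PMF.pure (List.ofFn (PRNG x)))
          ((unif (Bits m)).bind fun u => PMF.pure (List.ofFn u)) +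
        dKey + s * distInSec T (lpnReal n k η) (lpnIdeal n k)))
      (cpaGame n k t r η PRNG A b 1) (uniformGame n k m (gameCircuit A b) A.out 1) := by
  have hC : (gameCircuit A b).size ≤ s := (size_gameCircuit A b).trans_le hs
  have hlen := (length_le_size (gameCircuit A b)).trans hC
  obtain ⟨C, hCdef⟩ : ∃ C, C = gameCircuit A b := ⟨_, rfl⟩
  rw [← hCdef] at hC hlen ⊢
  rw [cpaGame_eq, ← hCdef]
  have h1 := distInSec_nonneg T ((unif (Bits k)).bind fun x => PMF.pure (List.ofFn (PRNG x)))
    ((unif (Bits m)).bind fun u => PMF.pure (List.ofFn u))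
  have h2 := distInSec_nonneg T (lpnReal n k η) (lpnIdeal n k)
  have hhyb : Close (((s : ℝ≥0∞) + s * s) * (2 ^ k)⁻¹ +
      s * ENNReal.ofReal (distInSec T ((unif (Bits k)).bind fun x => PMF.pure (List.ofFn (PRNG x)))
          ((unif (Bits m)).bind fun u => PMF.pure (List.ofFn u))))
      (((keyGen n k t r).bind fun key => (unif (Bits k)).bind fun sk =>
        (Circuit.run (gameOracles η PRNG key.2 sk) C
          (fun _ => 0, fun _ => none)).map fun z => z.1 A.out) 1)
      (((keyGen n k t r).bind fun key => linGame (m := m) C A.out η key.2) 1) := by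
    refine Close.bind fun key => Close.trans ((close_game_padRun η PRNG key.2 C A.out).mono ?_)
      (close_linGame C A.out η PRNG key.2 hC hT)
    gcongr
  refine (hhyb.trans ((hkey C hC).trans (close_uniformGame C A.out η hC hT))).mono (le_of_eq ?_)
  rw [add_assoc (_ + _ : ℝ), ENNReal.ofReal_add (by positivity) (by positivity),
    ENNReal.ofReal_add (by positivity) (by positivity),
    ENNReal.ofReal_add (p := dKey) hdKey (by positivity),
    ENNReal.ofReal_mul (by positivity), ENNReal.ofReal_mul (by positivity),
    ENNReal.ofReal_mul (by positivity), ENNReal.ofReal_natCast,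
    ENNReal.ofReal_inv_of_pos (by positivity), ENNReal.ofReal_pow zero_le_two,
    ENNReal.ofReal_ofNat]
  congr 3
  rw [show ((s : ℝ) + s * s) = ((s + s * s : ℕ) : ℝ) by push_cast; ring, ENNReal.ofReal_natCast]
  push_cast
  ring

/-- Both values of the challenge bit lead to the same uniform game, whence the factor `2` in
`advBound`. -/
theorem abs_cpaInSec_le {s T L T' : ℕ} {dKey : ℝ} (hdKey : 0 ≤ dKey) (hs : T + 1 ≤ s)
    (hT : reductionSize n k m s ≤ T')
    (hkey : ∀ (C : Circuit GameOracle) (out : ℕ), C.size ≤ s → Close (ENNReal.ofReal dKey)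
      (((keyGen n k t r).bind fun key => linGame (m := m) C out η key.2) 1)
      (((unif (Matrix (Fin n) (Fin k) Bit)).bind fun G => linGame (m := m) C out η G) 1)) :
    |cpaInSec n k t r η PRNG T L| ≤ advBound k s
      (distInSec T' ((unif (Bits k)).bind fun x => PMF.pure (List.ofFn (PRNG x)))
        ((unif (Bits m)).bind fun u => PMF.pure (List.ofFn u))) dKey
      (distInSec T' (lpnReal n k η) (lpnIdeal n k)) := by
  rw [abs_of_nonneg (show 0 ≤ cpaInSec n k t r η PRNG T L from
    Real.iSup_nonneg fun _ => abs_nonneg _)]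
  have : Nonempty {A : CPAAdversary // A.time ≤ T ∧ A.queryBits ≤ L} :=
    ⟨⟨[], [], [], [], 0⟩, Nat.zero_le _, Nat.zero_le _⟩
  refine ciSup_le fun A => ?_
  have h1 := distInSec_nonneg T' ((unif (Bits k)).bind fun x => PMF.pure (List.ofFn (PRNG x)))
    ((unif (Bits m)).bind fun u => PMF.pure (List.ofFn u))
  have h2 := distInSec_nonneg T' (lpnReal n k η) (lpnIdeal n k)
  have hA : A.1.time + 1 ≤ s := (Nat.add_le_add_right A.2.1 1).trans hs
  have hb := fun b => close_cpaGame_uniformGame t r η PRNG A.1 b hdKey hA hT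
    fun C hC => hkey C A.1.out hC
  have h3 := hb true
  rw [uniformGame_gameCircuit] at h3
  have h := ((hb false).trans h3.symm).abs_toReal_sub_le (by finiteness)
    (PMF.apply_ne_top _ _) (PMF.apply_ne_top _ _)
  refine h.trans (le_of_eq ?_)
  rw [← ENNReal.ofReal_add (by positivity) (by positivity), ENNReal.toReal_ofReal (by positivity),
    advBound]
  ring

end Advantage

/-! ### Growth rates -/

section Growth

variable {σ T U : ℕ → ℕ} {f g : ℕ → ℝ}

/-- The base `σ + 2` is at least `2` everywhere and so absorbs additive constants and small values
of `σ`, which makes sums and products immediate. -/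
theorem polyIn_iff : PolyIn σ T ↔ ∃ c, ∀ k, T k ≤ (σ k + 2) ^ c := by
  constructor
  · rintro ⟨c, h⟩
    refine ⟨c + 1, fun k => (h k).trans ?_⟩
    have h1 : σ k ^ c ≤ (σ k + 2) ^ c := Nat.pow_le_pow_left (by omega) c
    have h2 : c ≤ (σ k + 2) ^ c := (Nat.lt_pow_self (by omega : 1 < σ k + 2)).le
    calc σ k ^ c + c ≤ (σ k + 2) ^ c * 2 := by omega
      _ ≤ (σ k + 2) ^ c * (σ k + 2) := by gcongr; omega
  · rintro ⟨c, h⟩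
    refine ⟨2 * c + 3 ^ c, fun k => (h k).trans ?_⟩
    rcases Nat.lt_or_ge (σ k) 2 with hσ | hσ
    · have : (σ k + 2) ^ c ≤ 3 ^ c := Nat.pow_le_pow_left (by omega) c
      omega
    · calc (σ k + 2) ^ c ≤ (σ k ^ 2) ^ c := Nat.pow_le_pow_left (by nlinarith) c
        _ = σ k ^ (2 * c) := (pow_mul _ _ _).symm
        _ ≤ σ k ^ (2 * c + 3 ^ c) := Nat.pow_le_pow_right (by omega) (Nat.le_add_right _ _)
        _ ≤ _ := Nat.le_add_right _ _

theorem PolyIn.mul (hT : PolyIn σ T) (hU : PolyIn σ U) : PolyIn σ fun k => T k * U k := by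
  rw [polyIn_iff] at *
  obtain ⟨a, ha⟩ := hT
  obtain ⟨b, hb⟩ := hU
  exact ⟨a + b, fun k => (Nat.mul_le_mul (ha k) (hb k)).trans_eq (pow_add _ _ _).symm⟩

theorem PolyIn.add (hT : PolyIn σ T) (hU : PolyIn σ U) : PolyIn σ fun k => T k + U k := by
  rw [polyIn_iff] at *
  obtain ⟨a, ha⟩ := hT
  obtain ⟨b, hb⟩ := hU
  refine ⟨a + b + 1, fun k => ?_⟩
  have h1 : (σ k + 2) ^ a ≤ (σ k + 2) ^ (a + b) := Nat.pow_le_pow_right (by omega) (by omega)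
  have h2 : (σ k + 2) ^ b ≤ (σ k + 2) ^ (a + b) := Nat.pow_le_pow_right (by omega) (by omega)
  have h3 : (σ k + 2) ^ (a + b) * 2 ≤ (σ k + 2) ^ (a + b) * (σ k + 2) := by gcongr; omega
  rw [pow_succ]
  have := ha k
  have := hb k
  omega

theorem polyIn_const (c : ℕ) : PolyIn σ fun _ => c := ⟨c, fun _ => Nat.le_add_left _ _⟩

theorem PolyIn.reductionSize {n m s : ℕ → ℕ} (hk : PolyIn σ fun k => k) (hn : PolyIn σ n)
    (hm : PolyIn σ m) (hs : PolyIn σ s) :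
    PolyIn σ fun k => GSPlus.reductionSize (n k) k (m k) (s k) :=
  ((hs.mul (hn.add hm)).mul ((polyIn_const 2).add hk)).add
    (hs.mul (((hs.add (polyIn_const 4)).mul ((polyIn_const 4).add ((polyIn_const 3).mul hk))).add
      ((hn.add hm).mul (polyIn_const 3))))

theorem PolyIn.xorReductionSize {n m r s : ℕ → ℕ} (hk : PolyIn σ fun k => k) (hn : PolyIn σ n)
    (hm : PolyIn σ m) (hr : PolyIn σ r) (hs : PolyIn σ s) :
    PolyIn σ fun k => GSPlus.xorReductionSize (n k) k (m k) (r k) (s k) :=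
  (hr.mul ((hk.add hr).mul (((polyIn_const 6).mul hn).add (polyIn_const 3)))).add
    (PolyIn.reductionSize hk hn hm hs)

theorem NegligibleIn.mono (hg : NegligibleIn σ g) (h : ∀ᶠ k in atTop, |f k| ≤ |g k|) :
    NegligibleIn σ f := fun c => by
  filter_upwards [hg c, h] with k h1 h2 using h2.trans h1

theorem NegligibleIn.natCast_mul (hσ : ∀ᶠ k in atTop, 2 ≤ σ k) (hT : PolyIn σ T)
    (hf : NegligibleIn σ f) : NegligibleIn σ fun k => (T k : ℝ) * f k := by
  obtain ⟨a, ha⟩ := polyIn_iff.1 hT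
  intro c
  filter_upwards [hσ, hf (2 * a + c)] with k h2 hk
  have hσ0 : (0 : ℝ) < σ k := by exact_mod_cast (by omega : 0 < σ k)
  have h3 : (T k : ℝ) ≤ (σ k : ℝ) ^ (2 * a) := by
    have : T k ≤ σ k ^ (2 * a) := by
      rw [pow_mul]
      exact (ha k).trans (Nat.pow_le_pow_left (by nlinarith) a)
    exact_mod_cast this
  rw [abs_mul, Nat.abs_cast]
  calc (T k : ℝ) * |f k| ≤ (σ k : ℝ) ^ (2 * a) * ((σ k : ℝ) ^ (2 * a + c))⁻¹ := by gcongr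
    _ = ((σ k : ℝ) ^ c)⁻¹ := by rw [pow_add]; field_simp

theorem NegligibleIn.add (hσ : ∀ᶠ k in atTop, 2 ≤ σ k) (hf : NegligibleIn σ f)
    (hg : NegligibleIn σ g) : NegligibleIn σ fun k => f k + g k := by
  intro c
  filter_upwards [hσ, hf (c + 1), hg (c + 1)] with k h2 h3 h4
  have h2' : (2 : ℝ) ≤ σ k := by exact_mod_cast h2
  refine (abs_add_le _ _).trans ((add_le_add h3 h4).trans ?_)
  rw [pow_succ, mul_inv]
  have h5 : (σ k : ℝ)⁻¹ ≤ 2⁻¹ := inv_anti₀ two_pos h2'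
  have h6 : 0 ≤ ((σ k : ℝ) ^ c)⁻¹ := by positivity
  nlinarith [mul_le_mul_of_nonneg_left h5 h6]

theorem NegligibleIn.sqrt (hf : NegligibleIn σ f) : NegligibleIn σ fun k => Real.sqrt (f k) := by
  intro c
  filter_upwards [hf (c * 2)] with k hk
  rw [abs_of_nonneg (Real.sqrt_nonneg _)]
  refine Real.sqrt_le_iff.2 ⟨by positivity, (le_abs_self _).trans (hk.trans_eq ?_)⟩
  rw [pow_mul, inv_pow]

theorem negligibleIn_polyScale_two_pow : NegligibleIn polyScale fun k => ((2 : ℝ) ^ k)⁻¹ := by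
  intro c
  have h := (isLittleO_pow_const_const_pow_of_one_lt (R := ℝ) c (one_lt_two)).bound one_pos
  filter_upwards [h, eventually_gt_atTop 0] with k hk h0
  rw [one_mul, Real.norm_of_nonneg (by positivity), Real.norm_of_nonneg (by positivity)] at hk
  rw [abs_of_nonneg (by positivity)]
  have : (0 : ℝ) < k := by exact_mod_cast h0
  exact inv_anti₀ (by rw [polyScale]; positivity) hk

/-- `2 ≤ e` and `⌊√k⌋ ≤ √k` give `σ k ^ c ≤ exp (c √k)`. -/
theorem negligibleIn_subexpScale (h : ∀ C : ℝ, ∀ᶠ k in atTop, |f k| ≤ Real.exp (-(C * Real.sqrt k))) :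
    NegligibleIn subexpScale f := by
  intro c
  filter_upwards [h c] with k hk
  refine hk.trans ?_
  rw [Real.exp_neg]
  refine inv_anti₀ (by rw [subexpScale]; positivity) ?_
  rw [subexpScale, Nat.cast_pow, ← pow_mul, Nat.cast_ofNat]
  have h1 : (2 : ℝ) ≤ Real.exp 1 := by linarith [Real.add_one_le_exp (1 : ℝ)]
  calc (2 : ℝ) ^ (Nat.sqrt k * c) ≤ Real.exp 1 ^ (Nat.sqrt k * c) := pow_le_pow_left₀ zero_le_two h1 _
    _ = Real.exp (c * Nat.sqrt k) := by rw [← Real.exp_nat_mul]; congr 1; push_cast; ring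
    _ ≤ _ := by
      gcongr
      exact Real.nat_sqrt_le_real_sqrt

theorem two_le_subexpScale : ∀ᶠ k in atTop, 2 ≤ subexpScale k := by
  filter_upwards [eventually_ge_atTop 1] with k hk
  have : 1 ≤ Nat.sqrt k := Nat.le_sqrt.2 (by omega)
  rw [subexpScale]
  exact (pow_one 2).symm.trans_le (Nat.pow_le_pow_right (by omega) this)

theorem polyIn_subexpScale_id : PolyIn subexpScale fun k => k := by
  refine ⟨2, fun k => ?_⟩
  have h1 := Nat.lt_succ_sqrt' k
  have h2 : Nat.sqrt k < 2 ^ Nat.sqrt k := Nat.lt_two_pow_self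
  have h3 : (Nat.sqrt k + 1) ^ 2 ≤ (2 ^ Nat.sqrt k) ^ 2 := Nat.pow_le_pow_left h2 2
  change k ≤ (2 ^ Nat.sqrt k) ^ 2 + 2
  simp only [Nat.succ_eq_add_one] at h1
  omega

end Growth

theorem negligibleIn_advBound {σ s : ℕ → ℕ} {dPRNG dKey dLPN : ℕ → ℝ}
    (hσ : ∀ᶠ k in atTop, 2 ≤ σ k) (hs : PolyIn σ s)
    (h2 : NegligibleIn σ fun k => ((2 : ℝ) ^ k)⁻¹) (hPRNG : NegligibleIn σ dPRNG)
    (hKey : NegligibleIn σ dKey) (hLPN : NegligibleIn σ dLPN) :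
    NegligibleIn σ fun k => advBound k (s k) (dPRNG k) (dKey k) (dLPN k) := by
  have h := ((((h2.natCast_mul hσ (hs.add (hs.mul hs))).add hσ
    (hPRNG.natCast_mul hσ hs)).add hσ hKey).add hσ (hLPN.natCast_mul hσ hs)).natCast_mul hσ
      (polyIn_const 2)
  simpa [advBound] using h

/-! ### The distance of the key from uniform at the subexponential scale -/

/-- The code length is quasi-exponential in the square root of the security parameter when the
number of sparse vectors exceeds the number of seeds. -/
theorem eventually_choose_bounds {l t : ℕ → ℕ} {ε c : ℝ} (hε : 0 < ε)
    (hN : ∀ᶠ k in atTop, (2 : ℝ) ^ k ≤ ((l k).choose (t k) : ℝ) ^ (1 - ε))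
    (ht : ∀ᶠ k in atTop, (t k : ℝ) ≤ c * Real.log (l k)) :
    ∀ᶠ k : ℕ in atTop, 0 < l k ∧ (2 : ℝ) ^ k ≤ Real.exp (c * Real.log (l k) ^ 2) ∧
      2 ^ k * ((l k).choose (t k) : ℝ)⁻¹ ≤ Real.exp (-(ε / 2 * k)) := by
  filter_upwards [hN, ht, eventually_ge_atTop 1] with k hN ht hk
  have h1 : (1 : ℝ) < 2 ^ k := one_lt_pow₀ one_lt_two (by omega)
  have hlt := h1.trans_le hN
  -- A vanishing binomial coefficient is excluded because a real power of `0` is at most `1`, even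
  -- for exponents `1 - ε ≤ 0`.
  have hN1 : (1 : ℝ) ≤ (l k).choose (t k) := by
    rcases Nat.eq_zero_or_pos ((l k).choose (t k)) with h | h
    · rw [h, Nat.cast_zero] at hlt
      exact absurd (Real.zero_rpow_le_one _) (not_le.2 hlt)
    · exact_mod_cast h
  have hN0 : (0 : ℝ) < (l k).choose (t k) := by linarith
  have hle : (2 : ℝ) ^ k ≤ (l k).choose (t k) :=
    hN.trans ((Real.rpow_le_rpow_of_exponent_le hN1 (by linarith : 1 - ε ≤ 1)).trans_eq
      (Real.rpow_one _))
  have hl : 0 < l k := by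
    rcases Nat.eq_zero_or_pos (l k) with h | h
    · exfalso
      rw [h] at hle
      have : (Nat.choose 0 (t k)) ≤ 1 := by cases t k <;> simp
      have : ((Nat.choose 0 (t k) : ℕ) : ℝ) ≤ 1 := by exact_mod_cast this
      linarith
    · exact h
  have hl' : (0 : ℝ) < l k := by exact_mod_cast hl
  have hL : 0 ≤ Real.log (l k) := Real.log_natCast_nonneg _
  refine ⟨hl, hle.trans ?_, ?_⟩
  · calc ((l k).choose (t k) : ℝ) ≤ (l k : ℝ) ^ t k := by exact_mod_cast Nat.choose_le_pow _ _
      _ = Real.exp (t k * Real.log (l k)) := by rw [Real.exp_nat_mul, Real.exp_log hl']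
      _ ≤ _ := by
        refine Real.exp_le_exp.2 ?_
        nlinarith
  · have hlog : Real.log (2 ^ k) ≤ Real.log ((l k).choose (t k)) := Real.log_le_log (by positivity) hle
    have hlog2 := Real.log_le_log (by positivity) hN
    rw [Real.log_rpow hN0] at hlog2
    rw [Real.log_pow] at hlog hlog2
    have h2 := Real.log_two_gt_d9
    have e : 2 ^ k * ((l k).choose (t k) : ℝ)⁻¹ =
        Real.exp (k * Real.log 2 - Real.log ((l k).choose (t k))) := by
      rw [Real.exp_sub, Real.exp_nat_mul, Real.exp_log two_pos, Real.exp_log hN0, div_eq_mul_inv]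
    rw [e]
    refine Real.exp_le_exp.2 ?_
    have h3 : ε * (k * Real.log 2) ≤ ε * Real.log ((l k).choose (t k)) := by gcongr
    have h4 : ε / 2 * k ≤ ε * (k * Real.log 2) := by
      have : (0 : ℝ) ≤ ε * k := by positivity
      nlinarith
    nlinarith

theorem eventually_quadratic_le_exp (a : ℝ) (ha : 0 < a) (b c d : ℝ) :
    ∀ᶠ x : ℝ in atTop, b * x ^ 2 + c * x + d ≤ a * Real.exp x := by
  have h := (Real.isLittleO_pow_exp_atTop (n := 2)).bound
    (by positivity : 0 < a / (|b| + |c| + |d| + 1))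
  filter_upwards [h, eventually_ge_atTop 1] with x hx h1
  rw [Real.norm_of_nonneg (by positivity), Real.norm_of_nonneg (Real.exp_pos _).le,
    div_mul_eq_mul_div, le_div_iff₀ (by positivity)] at hx
  have h2 : x ≤ x ^ 2 := by nlinarith
  have h3 : 1 ≤ x ^ 2 := by nlinarith
  have b1 : b * x ^ 2 ≤ |b| * x ^ 2 := mul_le_mul_of_nonneg_right (le_abs_self b) (by positivity)
  have c1 : c * x ≤ |c| * x ^ 2 := (mul_le_mul_of_nonneg_right (le_abs_self c) (by positivity)).trans
    (mul_le_mul_of_nonneg_left h2 (abs_nonneg c))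
  have d1 : d ≤ |d| * x ^ 2 := (le_abs_self d).trans (le_mul_of_one_le_right (abs_nonneg d) h3)
  nlinarith

/-- The hypothesis on `C(l, t)` gives `2 ^ k ≤ exp (c₁ log² l)`, so `log l` is at least of order
`√k` and `l`, `t` tend to infinity. The term with `1 / C(l, t)` becomes `exp (-Ω(k))`. In the other
two, the factor `exp (-a l)` overwhelms both `2 ^ k` and any `exp (C √k)`. -/
theorem negligibleIn_charMoment {l t r : ℕ → ℕ} {δ ε : ℝ}
    (ht : (fun k => (t k : ℝ)) =Θ[atTop] fun k => Real.log (l k)) (hδ : 0 < δ)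
    (hr : ∀ᶠ k in atTop, (r k : ℝ) ≤ (1 - δ) * l k) (hε : 0 < ε)
    (hN : ∀ᶠ k in atTop, (2 : ℝ) ^ k ≤ ((l k).choose (t k) : ℝ) ^ (1 - ε)) :
    NegligibleIn subexpScale fun k => 2 ^ k * charMoment (rowDist (l k) (t k)) (r k) := by
  obtain ⟨c₁, hc₁, hu⟩ := ht.1.exists_pos
  obtain ⟨c₂, hc₂, hlow⟩ := ht.2.exists_pos
  have hL0 : ∀ k, 0 ≤ Real.log (l k) := fun k => Real.log_natCast_nonneg _
  have hu' : ∀ᶠ k in atTop, (t k : ℝ) ≤ c₁ * Real.log (l k) := by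
    filter_upwards [hu.bound] with k hk
    rwa [Real.norm_of_nonneg (Nat.cast_nonneg _), Real.norm_of_nonneg (hL0 k)] at hk
  have hlow' : ∀ᶠ k in atTop, Real.log (l k) ≤ c₂ * t k := by
    filter_upwards [hlow.bound] with k hk
    rwa [Real.norm_of_nonneg (Nat.cast_nonneg (t k)), Real.norm_of_nonneg (hL0 k)] at hk
  have hch := eventually_choose_bounds hε hN hu'
  have hsqrt : ∀ᶠ k : ℕ in atTop, Real.sqrt k ≤ Real.sqrt (2 * c₁) * Real.log (l k) := by
    filter_upwards [hch] with k hk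
    rw [← Real.sqrt_sq (hL0 k), ← Real.sqrt_mul (by positivity)]
    refine Real.sqrt_le_sqrt ?_
    have h1 := Real.log_le_log (by positivity) hk.2.1
    rw [Real.log_exp, Real.log_pow] at h1
    have h2 := Real.log_two_gt_d9
    have h3 : (0 : ℝ) ≤ k := Nat.cast_nonneg k
    nlinarith
  have hsqrt_top : Tendsto (fun k : ℕ => Real.sqrt k) atTop atTop :=
    Real.tendsto_sqrt_atTop.comp tendsto_natCast_atTop_atTop
  have hLtop : Tendsto (fun k => Real.log (l k)) atTop atTop := by
    have hc : 0 < Real.sqrt (2 * c₁) := by positivity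
    refine tendsto_atTop_mono' _ ?_ (hsqrt_top.atTop_div_const hc)
    filter_upwards [hsqrt] with k hk
    rw [div_le_iff₀ hc]
    linarith
  have htTop : Tendsto t atTop atTop := by
    rw [← tendsto_natCast_atTop_iff (R := ℝ)]
    refine tendsto_atTop_mono' _ ?_ (hLtop.atTop_div_const hc₂)
    filter_upwards [hlow'] with k hk
    rw [div_le_iff₀ hc₂]
    linarith
  -- The moment bound needs a rate gap of at most `1`; shrinking `δ` preserves the hypothesis on
  -- `r`.
  obtain ⟨d, hd⟩ : ∃ d, d = min δ 1 := ⟨_, rfl⟩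
  have hd0 : 0 < d := by rw [hd]; positivity
  have hd1 : d ≤ 1 := by rw [hd]; exact min_le_right _ _
  have hdδ : d ≤ δ := by rw [hd]; exact min_le_left _ _
  -- With `log l ≤ c₂ t` this choice gives `κ ^ t * l ≤ 1`.
  obtain ⟨κ, hκ⟩ : ∃ κ, κ = Real.exp (-c₂) := ⟨_, rfl⟩
  have hκ0 : 0 < κ := by rw [hκ]; positivity
  have hκ1 : κ ≤ 1 := by rw [hκ]; exact Real.exp_le_one_iff.2 (by linarith)
  obtain ⟨τ, hτ⟩ : ∃ τ, τ = min (κ / 4) (d ^ 2 / 128) := ⟨_, rfl⟩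
  have hτ0 : 0 < τ := by rw [hτ]; positivity
  have hτκ : τ ≤ κ / 4 := by rw [hτ]; exact min_le_left _ _
  have hτd : τ ≤ d ^ 2 / 128 := by rw [hτ]; exact min_le_right _ _
  have hpow : ∀ᶠ k in atTop, (1 - d ^ 2 / 64) ^ t k ≤ κ ^ 2 / 16 :=
    ((tendsto_pow_atTop_nhds_zero_of_lt_one (by nlinarith) (by nlinarith [sq_pos_of_pos hd0])).comp
      htTop).eventually_le_const (by positivity)
  -- Read at `x = log l`, this is `c₁ log l ≤ τ² l`, hence `t ≤ τ² l`.
  have hquad := hLtop.eventually (eventually_quadratic_le_exp (τ ^ 2) (by positivity) 0 c₁ 0)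
  have hbound : ∀ᶠ k in atTop, |2 ^ k * charMoment (rowDist (l k) (t k)) (r k)| ≤
      |3 * Real.exp (-(ε / 2 * k)) +
        2 * Real.exp (c₁ * Real.log (l k) ^ 2 - κ ^ 2 / 16 * Real.exp (Real.log (l k))) +
        2 * Real.exp (c₁ * Real.log (l k) ^ 2 - d / 4 * Real.exp (Real.log (l k)))| := by
    filter_upwards [hch, hu', hlow', hpow, hquad, hr] with k hk hu hlow hpow hquad hr
    obtain ⟨hl, hk2, hk3⟩ := hk
    have hl' : (0 : ℝ) < l k := by exact_mod_cast hl
    rw [Real.exp_log hl'] at hquad ⊢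
    rw [abs_of_nonneg (mul_nonneg (by positivity) (charMoment_nonneg _ _)),
      abs_of_nonneg (by positivity)]
    have hr' : (r k : ℝ) ≤ (1 - d) * l k := hr.trans (by gcongr)
    have hκt : κ ^ t k * l k ≤ 1 := by
      rw [hκ, ← Real.exp_nat_mul]
      conv_lhs => arg 2; rw [← Real.exp_log hl']
      rw [← Real.exp_add]
      exact Real.exp_le_one_iff.2 (by linarith)
    have hM := charMoment_rowDist_le hl hd0 hd1 hκ0 hκ1 hτ0 hτκ hτd (by linarith) hr' hκt hpow
    have he : ∀ a : ℝ, 2 ^ k * Real.exp (-a * l k) ≤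
        Real.exp (c₁ * Real.log (l k) ^ 2 - a * l k) := by
      intro a
      rw [sub_eq_add_neg, Real.exp_add, ← neg_mul]
      gcongr
    have h1 := he (κ ^ 2 / 16)
    have h2 := he (d / 4)
    calc 2 ^ k * charMoment (rowDist (l k) (t k)) (r k)
        ≤ 2 ^ k * (3 * ((l k).choose (t k) : ℝ)⁻¹ + 2 * Real.exp (-(κ ^ 2 / 16) * l k) +
          2 * Real.exp (-(d / 4) * l k)) := by gcongr
      _ ≤ _ := by linarith
  have hfirst : NegligibleIn subexpScale fun k => 3 * Real.exp (-(ε / 2 * k)) := by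
    refine negligibleIn_subexpScale fun C => ?_
    filter_upwards [hsqrt_top.eventually_ge_atTop (max 1 (2 * (|C| + 2) / ε))] with k hk
    obtain ⟨hy1, hy2⟩ := max_le_iff.1 hk
    rw [div_le_iff₀ hε] at hy2
    have hsq := Real.mul_self_sqrt (Nat.cast_nonneg k : (0 : ℝ) ≤ k)
    have h3 : (3 : ℝ) ≤ Real.exp 2 := by linarith [Real.add_one_le_exp (2 : ℝ)]
    rw [abs_of_nonneg (by positivity)]
    calc 3 * Real.exp (-(ε / 2 * k)) ≤ Real.exp 2 * Real.exp (-(ε / 2 * k)) := by gcongr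
      _ = Real.exp (2 + -(ε / 2 * k)) := (Real.exp_add _ _).symm
      _ ≤ _ := by
        refine Real.exp_le_exp.2 ?_
        obtain ⟨y, hy⟩ : ∃ y, y = Real.sqrt k := ⟨_, rfl⟩
        rw [← hy] at hy1 hy2 hsq ⊢
        rw [← hsq]
        nlinarith [le_abs_self C, mul_le_mul_of_nonneg_right hy2 (by linarith : (0 : ℝ) ≤ y),
          mul_le_mul_of_nonneg_right (le_abs_self C) (by linarith : (0 : ℝ) ≤ y)]
  have hsecond : ∀ a : ℝ, 0 < a → NegligibleIn subexpScale fun k =>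
      2 * Real.exp (c₁ * Real.log (l k) ^ 2 - a * Real.exp (Real.log (l k))) := by
    intro a ha
    refine negligibleIn_subexpScale fun C => ?_
    filter_upwards [hsqrt, hLtop.eventually (eventually_quadratic_le_exp a ha c₁
      (|C| * Real.sqrt (2 * c₁)) 1)] with k hk1 hk2
    have h2 : (2 : ℝ) ≤ Real.exp 1 := by linarith [Real.add_one_le_exp (1 : ℝ)]
    rw [abs_of_nonneg (by positivity)]
    refine (mul_le_mul_of_nonneg_right h2 (Real.exp_pos _).le).trans ?_
    rw [← Real.exp_add]
    refine Real.exp_le_exp.2 ?_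
    have h3 : C * Real.sqrt k ≤ |C| * (Real.sqrt (2 * c₁) * Real.log (l k)) :=
      (mul_le_mul_of_nonneg_right (le_abs_self C) (Real.sqrt_nonneg _)).trans
        (mul_le_mul_of_nonneg_left hk1 (abs_nonneg C))
    linarith
  exact (((hfirst.add two_le_subexpScale (hsecond _ (by positivity))).add two_le_subexpScale
    (hsecond _ (by positivity)))).mono hbound

theorem negligibleIn_subexpScale_two_pow : NegligibleIn subexpScale fun k => ((2 : ℝ) ^ k)⁻¹ := by
  intro c
  filter_upwards [eventually_ge_atTop (c * c)] with k hk
  rw [abs_of_nonneg (by positivity), subexpScale, Nat.cast_pow, ← pow_mul, Nat.cast_ofNat]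
  refine inv_anti₀ (by positivity) (pow_le_pow_right₀ one_le_two ?_)
  have h1 : c ≤ Nat.sqrt k := Nat.le_sqrt.2 hk
  exact (Nat.mul_le_mul_left _ h1).trans (Nat.sqrt_le k)

/-! ### The two parts of the theorem -/

/-- The size of the XOR reduction contains that of the other two, so one bound `T'` serves all three
assumptions. -/
theorem indCPA_of_plantedXOR {l t r m : ℕ → ℕ} {η : unitInterval}
    {PRNG : (k : ℕ) → Bits k → Bits (m k)} {σ : ℕ → ℕ} (hσ : ∀ᶠ k in atTop, 2 ≤ σ k)
    (hid : PolyIn σ fun k => k) (h2 : NegligibleIn σ fun k => ((2 : ℝ) ^ k)⁻¹)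
    (hl : PolyIn σ l) (hr : PolyIn σ r) (hm : PolyIn σ m) (hPRNG : PseudorandomGenerator σ m PRNG)
    (hLPN : LPNHard σ l η) (hXOR : PlantedXORHard σ l (fun k => k + r k) t) :
    INDCPA σ l t r m η PRNG := by
  intro T L hT _
  have hs : PolyIn σ fun k => T k + 1 := hT.add (polyIn_const 1)
  have hT' := PolyIn.xorReductionSize hid hl hm hr hs
  refine (negligibleIn_advBound hσ hs h2 (hPRNG _ hT') ((hXOR _ hT').natCast_mul hσ hr)
    (hLPN _ hT')).mono (Eventually.of_forall fun k => ?_)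
  refine (abs_cpaInSec_le (t k) (r k) η (PRNG k)
    (mul_nonneg (Nat.cast_nonneg _) (distInSec_nonneg _ _ _)) le_rfl (Nat.le_add_left _ _)
    fun C out hC => ?_).trans (le_abs_self _)
  have := close_keyGen_planted (n := l k) (k := k) (m := m k) (t := t k) (r := r k) C out η hC le_rfl
  rwa [ENNReal.ofReal_mul (Nat.cast_nonneg _), ENNReal.ofReal_natCast]

/-- Taking `lam = √q` with `q` just above `2 ^ k` times the moment makes the distance of the key
from uniform at most `2 r √q`; `r ≤ l` keeps the factor polynomial in `σ`. -/
theorem indCPA_of_uniform_key {l t r m : ℕ → ℕ} {η : unitInterval}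
    {PRNG : (k : ℕ) → Bits k → Bits (m k)} {σ : ℕ → ℕ} (hσ : ∀ᶠ k in atTop, 2 ≤ σ k)
    (hid : PolyIn σ fun k => k) (h2 : NegligibleIn σ fun k => ((2 : ℝ) ^ k)⁻¹)
    (hl : PolyIn σ l) (hr : ∀ᶠ k in atTop, r k ≤ l k) (hm : PolyIn σ m)
    (hPRNG : PseudorandomGenerator σ m PRNG) (hLPN : LPNHard σ l η)
    (hKey : NegligibleIn σ fun k => 2 ^ k * charMoment (rowDist (l k) (t k)) (r k)) :
    INDCPA σ l t r m η PRNG := by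
  intro T L hT _
  have hs : PolyIn σ fun k => T k + 1 := hT.add (polyIn_const 1)
  have hT' := PolyIn.reductionSize hid hl hm hs
  -- The summand `2 ^ (-k)` is negligible and only ensures that `lam = √q` is positive.
  obtain ⟨q, hq⟩ : ∃ q : ℕ → ℝ,
      q = fun k => 2 ^ k * charMoment (rowDist (l k) (t k)) (r k) + ((2 : ℝ) ^ k)⁻¹ := ⟨_, rfl⟩
  have hM0 : ∀ k, 0 ≤ 2 ^ k * charMoment (rowDist (l k) (t k)) (r k) := fun k =>
    mul_nonneg (by positivity) (charMoment_nonneg _ _)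
  have hq0 : ∀ k, 0 < q k := fun k => by
    rw [hq]
    exact add_pos_of_nonneg_of_pos (hM0 k) (by positivity)
  have hdKey0 : ∀ k, 0 ≤ (r k : ℝ) * (Real.sqrt (q k) +
      2 ^ k * charMoment (rowDist (l k) (t k)) (r k) / Real.sqrt (q k)) := fun k =>
    mul_nonneg (Nat.cast_nonneg _) (add_nonneg (Real.sqrt_nonneg _)
      (div_nonneg (hM0 k) (Real.sqrt_nonneg _)))
  have hdKey : NegligibleIn σ fun k => (r k : ℝ) * (Real.sqrt (q k) +
      2 ^ k * charMoment (rowDist (l k) (t k)) (r k) / Real.sqrt (q k)) := by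
    have hqn : NegligibleIn σ q := by
      rw [hq]
      exact hKey.add hσ h2
    refine (hqn.sqrt.natCast_mul hσ (hl.mul (polyIn_const 2))).mono ?_
    filter_upwards [hr] with k hk
    have hk' : (r k : ℝ) ≤ l k := by exact_mod_cast hk
    have hs0 : 0 < Real.sqrt (q k) := Real.sqrt_pos.2 (hq0 k)
    have h1 : 2 ^ k * charMoment (rowDist (l k) (t k)) (r k) / Real.sqrt (q k) ≤
        Real.sqrt (q k) := by
      rw [div_le_iff₀ hs0, Real.mul_self_sqrt (hq0 k).le, hq]
      exact le_add_of_nonneg_right (by positivity)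
    rw [abs_of_nonneg (hdKey0 k), abs_of_nonneg (by positivity)]
    push_cast
    rw [mul_assoc]
    refine mul_le_mul hk' (by linarith) (add_nonneg (Real.sqrt_nonneg _)
      (div_nonneg (hM0 k) (Real.sqrt_nonneg _))) (Nat.cast_nonneg _)
  refine (negligibleIn_advBound hσ hs h2 (hPRNG _ hT') hdKey (hLPN _ hT')).mono
    (Eventually.of_forall fun k => ?_)
  exact (abs_cpaInSec_le (t k) (r k) η (PRNG k) (hdKey0 k) le_rfl le_rfl fun C out _ =>
    close_keyGen_uniform (t k) (r k) (Real.sqrt_pos.2 (hq0 k)) _ 1).trans (le_abs_self _)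

end GSPlus

end

theorem theorem1 (l t r m : ℕ → ℕ) (η : unitInterval)
    (PRNG : (k : ℕ) → GSPlus.Bits k → GSPlus.Bits (m k))
    (ht : (fun k => (t k : ℝ)) =Θ[atTop] fun k => Real.log (l k)) :
    (GSPlus.PolyIn GSPlus.polyScale l → GSPlus.PolyIn GSPlus.polyScale r →
      GSPlus.PolyIn GSPlus.polyScale m →
      GSPlus.PseudorandomGenerator GSPlus.polyScale m PRNG →
      GSPlus.LPNHard GSPlus.polyScale l η →
      GSPlus.PlantedXORHard GSPlus.polyScale l (fun k => k + r k) t →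
      GSPlus.INDCPA GSPlus.polyScale l t r m η PRNG) ∧
    (GSPlus.PolyIn GSPlus.subexpScale l →
      (∃ δ : ℝ, 0 < δ ∧ ∀ᶠ k in atTop, (r k : ℝ) ≤ (1 - δ) * l k) →
      (∃ ε : ℝ, 0 < ε ∧ ∀ᶠ k in atTop, (2 : ℝ) ^ k ≤ ((l k).choose (t k) : ℝ) ^ (1 - ε)) →
      GSPlus.PolyIn GSPlus.subexpScale m →
      GSPlus.PseudorandomGenerator GSPlus.subexpScale m PRNG →
      GSPlus.LPNHard GSPlus.subexpScale l η →
      GSPlus.INDCPA GSPlus.subexpScale l t r m η PRNG) := by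
  constructor
  · intro hl hr hm hPRNG hLPN hXOR
    exact GSPlus.indCPA_of_plantedXOR (eventually_ge_atTop 2) ⟨1, fun k => by simp [GSPlus.polyScale]⟩
      GSPlus.negligibleIn_polyScale_two_pow hl hr hm hPRNG hLPN hXOR
  · rintro hl ⟨δ, hδ, hr⟩ ⟨ε, hε, hN⟩ hm hPRNG hLPN
    refine GSPlus.indCPA_of_uniform_key GSPlus.two_le_subexpScale GSPlus.polyIn_subexpScale_id
      GSPlus.negligibleIn_subexpScale_two_pow hl ?_ hm hPRNG hLPN
      (GSPlus.negligibleIn_charMoment ht hδ hr hε hN)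
    filter_upwards [hr] with k hk
    have : (r k : ℝ) ≤ l k := hk.trans
      (mul_le_of_le_one_left (Nat.cast_nonneg _) (by linarith))
    exact_mod_cast this
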